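/- **Setting.** Let $\lambda,\mu\in\mathbb R$ satisfy $\mu>0$ and $3\lambda+2\mu>0$, let $R>0$, and for $c\in\mathbb R$ put $A(x)=c$ if $\|x\|\le R$ and $A(x)=1$ if $\|x\|>R$. Write $r=\|x\|$, $\hat x=x/r$, $B_R=\{\|x\|<R\}$, $\mathcal L_{\lambda,\mu}u=\mu\Delta u+(\lambda+\mu)\nabla(\nabla\cdot u)$ and $\partial_{\nu_{\lambda,\mu}}u=\lambda(\nabla\cdot u)\nu+\mu(\nabla u+\nabla u^T)\nu$. A function $\psi\in H^1_{loc}(\mathbb R^3)^3$ with values in $\mathbb C^3$, of class $C^2$ on $B_R$ and on $\mathbb R^3\setminus\overline{B_R}$, is called a *solution for $c$* if $$\mathcal L_{A\lambda,A\mu}\psi=0\ \text{ off }\partial B_R,\qquad \psi|_-=\psi|_+,\quad \partial_{\nu_{A\lambda,A\mu}}\psi|_-=\partial_{\nu_{A\lambda,A\mu}}\psi|_+\ \text{ on }\partial B_R,\qquad \psi(x)=O(\|x\|^{-1})\ \text{ as }\|x\|\to\infty,$$ where $\nu=x/R$ on $\partial B_R$ and $\pm$ denote the pointwise one-sided limits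 from outside and inside. Let $\mathbf Y_n=(Y_n^n,\dots,Y_n^{-n})^T$ be the vector of the orthonormal spherical harmonics of degree $n$, and let $\mathbf D_n^{(n-1)x_j}$, $\mathbf D_n^{(n+1)x_j}$ ($j=1,2,3$) be the constant matrices with $$\partial_{x_j}(r^n\mathbf Y_n(\hat x))=\mathbf D_n^{(n-1)x_j}r^{n-1}\mathbf Y_{n-1}(\hat x),\qquad \partial_{x_j}(r^{-n-1}\mathbf Y_n(\hat x))=\mathbf D_n^{(n+1)x_j}r^{-n-2}\mathbf Y_{n+1}(\hat x).$$ For $G\in\mathbb C^{3\times(2n+1)}$ with rows $G_1,G_2,G_3$ put $$t^1(G)=\sum_{j}G_j\mathbf D_n^{(n+1)x_j},\qquad t^3(G)=\sum_{j}G_j\mathbf D_n^{(n-1)x_j},$$ $$M_n=\frac{\lambda+\mu}{2((n-1)\lambda+(3n-2)\mu)},\qquad k_n=\frac{\lambda+\mu}{2((n+2)\lambda+(3n+5)\mu)},$$ and define the $\mathbb C^3$-valued fields, whose $j$-th components in the case of $P_G$ and $Q_G$ are the displayed ones, $$U_G=G\,r^n\mathbf Y_n(\hat x),\qquad V_G=G\,\frac{R^{2n+1}}{r^{n+1}}\mathbf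 Y_n(\hat x),$$ $$(P_G)_j=M_n(r^2-R^2)\,t^3(G)\mathbf D_{n-1}^{(n-2)x_j}r^{n-2}\mathbf Y_{n-2}(\hat x),\qquad (Q_G)_j=k_n(r^2-R^2)\,t^1(G)\mathbf D_{n+1}^{(n+2)x_j}\frac{R^{2n+1}}{r^{n+3}}\mathbf Y_{n+2}(\hat x).$$ Let $\psi^{(1)}_G$ be $U_G$ for $r\le R$ and $V_G$ for $r>R$; $\psi^{(2)}_G$ be $U_G-P_G$ for $r\le R$ and $V_G$ for $r>R$; $\psi^{(3)}_G$ be $U_G$ for $r\le R$ and $V_G+Q_G$ for $r>R$; and $\psi_G$ be $U_G-P_G$ for $r\le R$ and $V_G+Q_G$ for $r>R$. **Theorem 3.1.** Let $n\ge2$ and set $$\zeta_1=-1-\frac3{n-1}=-\frac{n+2}{n-1},\qquad \zeta_2=-\frac{(2n+2)((n-1)\lambda+(3n-2)\mu)}{(2n^2+1)\lambda+(2+2n(n-1))\mu},$$ $$\zeta_3=-\frac{(2n^2+4n+3)\lambda+(2n^2+6n+6)\mu}{2n((n+2)\lambda+(3n+5)\mu)}.$$ Then $\zeta_1,\zeta_2,\zeta_3<0$,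 and the following hold. 1. There are $2n+1$ matrices $G$ with $t^1(G)=0$ and $t^3(G)=0$ whose fields $\psi^{(1)}_G$ are linearly independent solutions for $c=\zeta_1$. 2. There are $2n-1$ matrices $G$ with $t^1(G)=0$ and $t^3(G)\ne0$ whose fields $\psi^{(2)}_G$ are linearly independent solutions for $c=\zeta_2$. 3. There are $2n+3$ matrices $G$ with $t^1(G)\ne0$ and $t^3(G)=0$ whose fields $\psi^{(3)}_G$ are linearly independent solutions for $c=\zeta_3$. 4. Conversely, let $c\in\mathbb R$. If $\psi^{(1)}_G$ is a solution for $c$ with $G\neq0$, $t^1(G)=0$, $t^3(G)=0$, then $c=\zeta_1$; if $\psi^{(2)}_G$ is one with $t^1(G)=0$, $t^3(G)\ne0$, then $c=\zeta_2$; if $\psi^{(3)}_G$ is one with $t^1(G)\neq0$, $t^3(G)=0$, then $c=\zeta_3$. Moreover, for every $c\in\mathbb R$, the matrices $G$ for which $\psi_G$ is a solution for $c$ span a space of dimension $(2n+1)[c=\zeta_1]+(2n-1)[c=\zeta_2]+(2n+3)[c=\zeta_3]$, where $[\cdot]$ is $1$ if the condition holds and $0$ otherwise; so there is a nonzero solution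 $\psi_G$ only for $c\in\{\zeta_1,\zeta_2,\zeta_3\}$. -/

import Mathlib

open MeasureTheory Filter Topology
open scoped ContDiff Matrix Nat

noncomputable section

namespace ElasticPlasmon

/-- Euclidean space `ℝ³`. -/
abbrev E3 := EuclideanSpace ℝ (Fin 3)

/-! ### Partial derivatives, the Sobolev space `H¹_loc`, the Lamé system -/

/-- The classical partial derivative `∂f/∂x_j` at `x`. -/
def pd (j : Fin 3) (f : E3 → ℂ) (x : E3) : ℂ :=
  fderiv ℝ f x (EuclideanSpace.single j (1 : ℝ))

/-- `u ∈ L²_loc(ℝ³)`. -/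
def MemL2loc (u : E3 → ℂ) : Prop :=
  ∀ K : Set E3, IsCompact K → MemLp u 2 (volume.restrict K)

/-- `g` is the weak (distributional) partial derivative `∂u/∂x_j` on `ℝ³`. -/
def HasWeakPD (j : Fin 3) (u g : E3 → ℂ) : Prop :=
  ∀ η : E3 → ℂ, ContDiff ℝ ∞ η → HasCompactSupport η →
    ∫ x, u x * pd j η x = - ∫ x, g x * η x

/-- `u ∈ H¹_loc(ℝ³)`. -/
def MemH1loc (u : E3 → ℂ) : Prop :=
  MemL2loc u ∧ ∀ j : Fin 3, ∃ g : E3 → ℂ, MemL2loc g ∧ HasWeakPD j u g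

/-- The divergence of a vector field. -/
def divergence (u : E3 → Fin 3 → ℂ) (x : E3) : ℂ :=
  ∑ j, pd j (fun y => u y j) x

/-- The Lamé operator `μ Δu + (λ + μ) ∇(∇ · u)`. -/
def lameOp (lam mu : ℝ) (u : E3 → Fin 3 → ℂ) (x : E3) : Fin 3 → ℂ := fun i =>
  (mu : ℂ) * ∑ j, pd j (pd j (fun y => u y i)) x + ((lam + mu : ℝ) : ℂ) * pd i (divergence u) x

/-- The conormal derivative (traction) `λ (∇ · u) ν + μ (∇u + ∇uᵀ) ν` of `u` at `x` in the
direction `ν`. -/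
def traction (lam mu : ℝ) (u : E3 → Fin 3 → ℂ) (ν x : E3) : Fin 3 → ℂ := fun i =>
  (lam : ℂ) * divergence u x * (ν i : ℂ) +
    (mu : ℂ) * ∑ j, (pd j (fun y => u y i) x + pd i (fun y => u y j) x) * (ν j : ℂ)

/-- The coefficient `A`, equal to `c` for `‖x‖ ≤ R` and to `+1` for `‖x‖ > R`. -/
def coeffA (c R : ℝ) (x : E3) : ℝ := if ‖x‖ ≤ R then c else 1

/-- `ψ` solves the homogeneous Lamé transmission problem with Lamé parameters `A λ`, `A μ`:
it lies in `H¹_loc(ℝ³)³`, satisfies the equation on both sides of the sphere `∂B_R`, its one-sided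
traces and its one-sided tractions on the sphere (with the exterior unit normal `x / R`) agree, and
it is `O(‖x‖⁻¹)` at infinity. -/
structure IsTransmissionSolution (lam mu c R : ℝ) (ψ : E3 → Fin 3 → ℂ) : Prop where
  memH1loc : ∀ i, MemH1loc (fun x => ψ x i)
  contDiff_inside : ContDiffOn ℝ 2 ψ (Metric.ball 0 R)
  contDiff_outside : ContDiffOn ℝ 2 ψ (Metric.closedBall 0 R)ᶜ
  pde : ∀ x : E3, ‖x‖ ≠ R → lameOp (coeffA c R x * lam) (coeffA c R x * mu) ψ x = 0
  trace_match : ∀ x ∈ Metric.sphere (0 : E3) R, ∃ a : Fin 3 → ℂ,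
    Tendsto ψ (𝓝[Metric.ball 0 R] x) (𝓝 a) ∧
    Tendsto ψ (𝓝[(Metric.closedBall 0 R)ᶜ] x) (𝓝 a)
  traction_match : ∀ x ∈ Metric.sphere (0 : E3) R, ∃ a : Fin 3 → ℂ,
    Tendsto (fun y => traction (coeffA c R y * lam) (coeffA c R y * mu) ψ (R⁻¹ • x) y)
      (𝓝[Metric.ball 0 R] x) (𝓝 a) ∧
    Tendsto (fun y => traction (coeffA c R y * lam) (coeffA c R y * mu) ψ (R⁻¹ • x) y)
      (𝓝[(Metric.closedBall 0 R)ᶜ] x) (𝓝 a)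
  decay : ψ =O[cocompact E3] fun x => ‖x‖⁻¹

/-! ### Spherical harmonics -/

/-- The vector `(Y_n^n, Y_n^{n-1}, …, Y_n^{-n})` of orthonormal Laplace spherical harmonics of
degree `n` (Condon-Shortley phase); the entry with index `i` is `Y_n^m` with `m = n - i`.  With
`ξ = x₁ + i x₂` and `ξ' = x₁ - i x₂`, for `x` on the unit sphere,
`Y_n^m(x) = √((2n+1)/(4π) (n+m)! (n-m)!) ∑ (-ξ/2)^p (ξ'/2)^q x₃^s / (p! q! s!)`,
the sum over `p + q + s = n`, `p - q = m`. -/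
def sphY (n : ℕ) (x : E3) : Fin (2 * n + 1) → ℂ := fun i =>
  (Real.sqrt ((2 * n + 1) / (4 * Real.pi) * ((2 * n - (i : ℕ))! : ℝ) * ((i : ℕ)! : ℝ)) : ℂ) *
    ∑ p ∈ Finset.range (n + 1), ∑ q ∈ Finset.range (n + 1), ∑ s ∈ Finset.range (n + 1),
      if p + q + s = n ∧ p + (i : ℕ) = n + q then
        (-((x 0 : ℂ) + Complex.I * (x 1 : ℂ)) / 2) ^ p *
          (((x 0 : ℂ) - Complex.I * (x 1 : ℂ)) / 2) ^ q * (x 2 : ℂ) ^ s /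
            ((p ! : ℂ) * (q ! : ℂ) * (s ! : ℂ))
      else 0

/-- The unit vector `x / ‖x‖`. -/
def unitVec (x : E3) : E3 := ‖x‖⁻¹ • x

/-- `r^n Y_n(x / r)` with `r = ‖x‖`. -/
def regY (n : ℕ) (x : E3) : Fin (2 * n + 1) → ℂ := fun i => (‖x‖ : ℂ) ^ n * sphY n (unitVec x) i

/-- `r^(-n-1) Y_n(x / r)` with `r = ‖x‖`. -/
def irrY (n : ℕ) (x : E3) : Fin (2 * n + 1) → ℂ := fun i =>
  ((‖x‖ : ℂ) ^ (n + 1))⁻¹ * sphY n (unitVec x) i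

/-- The matrix `D_n^{(n-1) x_j}`, i.e. the matrix `D` with
`∂/∂x_j (r^n Y_n) = D r^(n-1) Y_(n-1)`. -/
def Ddown (n : ℕ) (j : Fin 3) : Matrix (Fin (2 * n + 1)) (Fin (2 * (n - 1) + 1)) ℂ :=
  Classical.epsilon fun D => ∀ x : E3, x ≠ 0 → ∀ i,
    pd j (fun y => regY n y i) x = (D *ᵥ regY (n - 1) x) i

/-- The matrix `D_n^{(n+1) x_j}`, i.e. the matrix `D` with
`∂/∂x_j (r^(-n-1) Y_n) = D r^(-n-2) Y_(n+1)`. -/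
def Dup (n : ℕ) (j : Fin 3) : Matrix (Fin (2 * n + 1)) (Fin (2 * (n + 1) + 1)) ℂ :=
  Classical.epsilon fun D => ∀ x : E3, x ≠ 0 → ∀ i,
    pd j (fun y => irrY n y i) x = (D *ᵥ irrY (n + 1) x) i

/-! ### The degree-`n` waves -/

/-- Coefficient matrices of size `3 × (2n+1)`. -/
abbrev Coeff (n : ℕ) := Matrix (Fin 3) (Fin (2 * n + 1)) ℂ

/-- The row vector `t¹_{n+1} = ∑_j G_{j,:} D_n^{(n+1) x_j}`. -/
def tOne {n : ℕ} (G : Coeff n) : Fin (2 * (n + 1) + 1) → ℂ := ∑ j, (G j) ᵥ* (Dup n j)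

/-- The row vector `t³_{n-1} = ∑_j G_{j,:} D_n^{(n-1) x_j}`. -/
def tThree {n : ℕ} (G : Coeff n) : Fin (2 * (n - 1) + 1) → ℂ := ∑ j, (G j) ᵥ* (Ddown n j)

/-- `M_n = (λ + μ) / (2 ((n-1) λ + (3n-2) μ))`. -/
def coefM (lam mu : ℝ) (n : ℕ) : ℝ :=
  (lam + mu) / (2 * (((n : ℝ) - 1) * lam + (3 * n - 2) * mu))

/-- `k_n = (λ + μ) / (2 ((n+2) λ + (3n+5) μ))`. -/
def coefK (lam mu : ℝ) (n : ℕ) : ℝ :=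
  (lam + mu) / (2 * (((n : ℝ) + 2) * lam + (3 * n + 5) * mu))

/-- `G r^n Y_n`. -/
def innerMain {n : ℕ} (G : Coeff n) (x : E3) : Fin 3 → ℂ := G *ᵥ regY n x

/-- `G R^(2n+1) / r^(n+1) Y_n`. -/
def outerMain {n : ℕ} (R : ℝ) (G : Coeff n) (x : E3) : Fin 3 → ℂ :=
  ((R : ℂ) ^ (2 * n + 1) / (‖x‖ : ℂ) ^ (n + 1)) • (G *ᵥ sphY n (unitVec x))

/-- `M_n (r² - R²) [t³_{n-1} D_{n-1}^{(n-2) x_j}]_j r^(n-2) Y_(n-2)` (for `n ≥ 2`). -/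
def innerCorr {n : ℕ} (lam mu R : ℝ) (G : Coeff n) (x : E3) : Fin 3 → ℂ := fun j =>
  (coefM lam mu n : ℂ) * ((‖x‖ : ℂ) ^ 2 - (R : ℂ) ^ 2) *
    ((tThree G ᵥ* Ddown (n - 1) j) ⬝ᵥ regY (n - 1 - 1) x)

/-- `k_n (r² - R²) [t¹_{n+1} D_{n+1}^{(n+2) x_j}]_j R^(2n+1) / r^(n+3) Y_(n+2)`. -/
def outerCorr {n : ℕ} (lam mu R : ℝ) (G : Coeff n) (x : E3) : Fin 3 → ℂ := fun j =>
  (coefK lam mu n : ℂ) * ((‖x‖ : ℂ) ^ 2 - (R : ℂ) ^ 2) *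
    ((R : ℂ) ^ (2 * n + 1) / (‖x‖ : ℂ) ^ (n + 3)) *
    ((tOne G ᵥ* Dup (n + 1) j) ⬝ᵥ sphY (n + 1 + 1) (unitVec x))

/-- The wave without corrections. -/
def waveOne {n : ℕ} (R : ℝ) (G : Coeff n) (x : E3) : Fin 3 → ℂ :=
  if ‖x‖ ≤ R then innerMain G x else outerMain R G x

/-- The wave with a correction inside the ball only. -/
def waveTwo {n : ℕ} (lam mu R : ℝ) (G : Coeff n) (x : E3) : Fin 3 → ℂ :=
  if ‖x‖ ≤ R then innerMain G x - innerCorr lam mu R G x else outerMain R G x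

/-- The wave with a correction outside the ball only. -/
def waveThree {n : ℕ} (lam mu R : ℝ) (G : Coeff n) (x : E3) : Fin 3 → ℂ :=
  if ‖x‖ ≤ R then innerMain G x else outerMain R G x + outerCorr lam mu R G x

/-- The general degree-`n` wave: the Lamé field inside and the decaying Lamé field outside with the
same displacement `G R^n Y_n` on `∂B_R`. The three waves above are the cases in which
`tOne G = 0` and/or `tThree G = 0`. -/
def waveGen {n : ℕ} (lam mu R : ℝ) (G : Coeff n) (x : E3) : Fin 3 → ℂ :=
  if ‖x‖ ≤ R then innerMain G x - innerCorr lam mu R G x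
  else outerMain R G x + outerCorr lam mu R G x

/-! ### The plasmon constants -/

/-- `ζ₁ = -1 - 3/(n-1) = -(n+2)/(n-1)`. -/
def zetaOne (n : ℕ) : ℝ := -1 - 3 / ((n : ℝ) - 1)

/-- `ζ₂ = -(2n+2)((n-1)λ + (3n-2)μ) / ((2n²+1)λ + (2+2n(n-1))μ)`. -/
def zetaTwo (lam mu : ℝ) (n : ℕ) : ℝ :=
  -((2 * n + 2) * (((n : ℝ) - 1) * lam + (3 * n - 2) * mu)) /
    ((2 * n ^ 2 + 1) * lam + (2 + 2 * n * ((n : ℝ) - 1)) * mu)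

/-- `ζ₃ = -((2n²+4n+3)λ + (2n²+6n+6)μ) / (2n((n+2)λ + (3n+5)μ))`. -/
def zetaThree (lam mu : ℝ) (n : ℕ) : ℝ :=
  -((2 * n ^ 2 + 4 * n + 3) * lam + (2 * n ^ 2 + 6 * n + 6) * mu) /
    (2 * n * (((n : ℝ) + 2) * lam + (3 * n + 5) * mu))

end ElasticPlasmon

end

open ElasticPlasmon

open MeasureTheory Filter Topology
open scoped ContDiff Matrix Nat

noncomputable section

namespace ElasticPlasmon

/-! ### Divided powers and solid harmonics -/

/-! All the waves have the trace `G R^n Y_n` on the sphere, and once the corrections are included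
both pieces are Lamé fields. What is left of the transmission problem is the equality of the
tractions, with the inner one multiplied by `c`. The point is that both traction maps are diagonal
in one and the same decomposition of the coefficient matrices `G`.

The vectors `t³` and `t¹` are the coefficients of the divergences of `G r^n Y_n` and `G r^(-n-1)
Y_n` (`divergence_regField`, `divergence_irrField`). A matrix killed by both gives a tangential
field. The matrices of gradients of decaying harmonics of degree parameter `n-1` are a complement on
which `t³` is injective and `t¹` vanishes; those of gradients of harmonic polynomials of degree
`n+1` are a complement on which `t¹` is injective and `t³` vanishes. These three spaces (`torSpace`,
`upSpace`, `downSpace`) have dimensions `2n+1`, `2n-1`, `2n+3` and span everything.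

Passing between `r^n` and `r^(-n-1)` exchanges gradients with fields `r² ∇p - (2d-1) p x`, so three
traction computations serve both sides: `traction_toroidal`, `traction_gradient`,
`traction_kelvinGradient`. In units of `μ/R` the inner eigenvalues are `n-1`, `2 M_n n (2n+1) - 1`,
`2n`, and the outer ones `-(n+2)`, `-2(n+1)`, `-(1 + 2 k_n (n+1)(2n+1))`. The inner ones are
positive and the quotients outer/inner are `ζ₁`, `ζ₂`, `ζ₃`. Hence a wave is a solution exactly
when, for each component of `G`, either `c` is the matching constant or the component is zero
(`isTransmissionSolution_waveGen_iff`); existence, uniqueness and multiplicity follow by linear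
algebra.

Two preparations are needed. The derivative matrices are defined by choice, so their existence is
proved from recurrences for explicit solid harmonics, and linear independence of these harmonics
turns identities of functions into identities of coefficients. Membership in `H¹_loc` holds because
two smooth fields that agree on the sphere glue to a locally Lipschitz one. -/

/-- The divided power `z ^ k / k!`, which is zero for negative `k`. -/
def dpow (k : ℤ) (z : ℂ) : ℂ := if k < 0 then 0 else z ^ k.toNat / (k.toNat)!

lemma dpow_of_neg {k : ℤ} (hk : k < 0) (z : ℂ) : dpow k z = 0 := if_pos hk

lemma dpow_natCast (k : ℕ) (z : ℂ) : dpow k z = z ^ k / k ! := by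
  simp [dpow]

/-- Integer exponents with value zero below `0` remove all boundary cases: at `k = 0` both sides
vanish. The recurrences below can then be compared term by term. -/
lemma mul_dpow (k : ℤ) (z : ℂ) : z * dpow (k - 1) z = k * dpow k z := by
  rcases lt_trichotomy k 0 with h | rfl | h
  · simp [dpow_of_neg h, dpow_of_neg (show k - 1 < 0 by omega)]
  · simp [dpow_of_neg]
  · obtain ⟨l, rfl⟩ : ∃ l : ℕ, k = (l + 1 : ℕ) := ⟨(k - 1).toNat, by omega⟩
    rw [dpow_natCast, show ((l + 1 : ℕ) : ℤ) - 1 = (l : ℤ) by push_cast; ring, dpow_natCast,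
      Nat.factorial_succ]
    have : ((l ! : ℕ) : ℂ) ≠ 0 := by exact_mod_cast Nat.factorial_ne_zero l
    have h2 : ((l : ℂ) + 1) ≠ 0 := by exact_mod_cast Nat.succ_ne_zero l
    push_cast
    field_simp
    ring

lemma hasDerivAt_dpow (k : ℤ) (z : ℂ) : HasDerivAt (dpow k) (dpow (k - 1) z) z := by
  rcases lt_trichotomy k 0 with h | rfl | h
  · rw [dpow_of_neg (show k - 1 < 0 by omega)]
    exact (hasDerivAt_const z (0 : ℂ)).congr_of_eventuallyEq
      (Eventually.of_forall fun w => dpow_of_neg h w)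
  · rw [dpow_of_neg (by omega)]
    exact (hasDerivAt_const z (1 : ℂ)).congr_of_eventuallyEq
      (Eventually.of_forall fun w => by simp [dpow])
  · obtain ⟨l, rfl⟩ : ∃ l : ℕ, k = (l + 1 : ℕ) := ⟨(k - 1).toNat, by omega⟩
    rw [show ((l + 1 : ℕ) : ℤ) - 1 = (l : ℤ) by push_cast; ring, dpow_natCast]
    have h1 := (hasDerivAt_pow (l + 1) z).div_const (((l + 1)! : ℕ) : ℂ)
    refine (h1.congr_of_eventuallyEq
      (Eventually.of_forall fun w => dpow_natCast _ w)).congr_deriv ?_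
    have : ((l ! : ℕ) : ℂ) ≠ 0 := by exact_mod_cast Nat.factorial_ne_zero l
    have h2 : ((l : ℂ) + 1) ≠ 0 := by exact_mod_cast Nat.succ_ne_zero l
    rw [Nat.factorial_succ]
    push_cast
    field_simp

lemma contDiff_dpow (k : ℤ) : ContDiff ℂ ∞ (dpow k) := by
  unfold dpow
  split_ifs
  · exact contDiff_const
  · fun_prop

lemma dpow_mul (k : ℤ) (t z : ℂ) : dpow k (t * z) = t ^ k * dpow k z := by
  rcases lt_or_ge k 0 with h | h
  · simp [dpow_of_neg h]
  · lift k to ℕ using h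
    rw [dpow_natCast, dpow_natCast, mul_pow, zpow_natCast, mul_div_assoc]

/-- The summand of the solid harmonic of degree `n` and order `m`. -/
def solidTerm (n m : ℤ) (a b z : ℂ) (q : ℕ) : ℂ :=
  dpow (q + m) a * dpow q b * dpow (n - 2 * q - m) z

/-- The outer exponents `q + m` and `n - 2q - m` add up to `n - q`, so one of them is negative. Sums
over `q` may therefore run to any bound beyond `n`. -/
lemma solidTerm_eq_zero {n m : ℤ} {q : ℕ} (h : n < q) (a b z : ℂ) :
    solidTerm n m a b z q = 0 := by
  unfold solidTerm
  rcases lt_or_ge ((q : ℤ) + m) 0 with h1 | h1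
  · simp [dpow_of_neg h1]
  · simp [dpow_of_neg (show n - 2 * q - m < 0 by omega)]

/-- The solid harmonic of degree `n` and order `m`, up to normalization, as a polynomial in
`a = -(x₁ + i x₂) / 2`, `b = (x₁ - i x₂) / 2` and `z = x₃`. -/
def solidPoly (n m : ℤ) (a b z : ℂ) : ℂ := ∑ q ∈ Finset.range (n.toNat + 1), solidTerm n m a b z q

lemma solidPoly_eq_sum {n : ℤ} (m : ℤ) (a b z : ℂ) {N : ℕ} (hN : n < N) :
    solidPoly n m a b z = ∑ q ∈ Finset.range N, solidTerm n m a b z q := by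
  unfold solidPoly
  have key : ∀ K L : ℕ, n < K → K ≤ L → ∑ q ∈ Finset.range K, solidTerm n m a b z q =
      ∑ q ∈ Finset.range L, solidTerm n m a b z q := by
    intro K L hK hKL
    refine Finset.sum_subset (by simpa using hKL) fun q _ hq => solidTerm_eq_zero ?_ a b z
    simp only [Finset.mem_range, not_lt] at hq
    omega
  rw [key _ (max N (n.toNat + 1)) (by omega) (le_max_right _ _),
    key N (max N (n.toNat + 1)) hN (le_max_left _ _)]

lemma solidPoly_eq_zero {n m : ℤ} (h : n < |m|) (a b z : ℂ) : solidPoly n m a b z = 0 := by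
  refine Finset.sum_eq_zero fun q _ => ?_
  unfold solidTerm
  rcases lt_or_ge ((q : ℤ) + m) 0 with h1 | h1
  · simp [dpow_of_neg h1]
  · rw [dpow_of_neg (show n - 2 * q - m < 0 by rcases abs_cases m with h | h <;> omega)]
    simp

/-- The polynomial on the left is the `a`-derivative of the one of degree `n` and order `m`, so this
is the Euler operator `a ∂_a`, which weights each monomial by its exponent of `a`. The next two
lemmas do the same for `z` and `b`. -/
lemma mul_solidPoly_a (n m : ℤ) (a b z : ℂ) {N : ℕ} (hN : n < N) :
    a * solidPoly (n - 1) (m - 1) a b z =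
      ∑ q ∈ Finset.range N, ((q : ℂ) + m) * solidTerm n m a b z q := by
  rw [solidPoly_eq_sum _ a b z (show n - 1 < N by omega), Finset.mul_sum]
  refine Finset.sum_congr rfl fun q _ => ?_
  have h := mul_dpow ((q : ℤ) + m) a
  unfold solidTerm
  rw [show (q : ℤ) + (m - 1) = q + m - 1 by ring,
    show n - 1 - 2 * q - (m - 1) = n - 2 * q - m by ring]
  push_cast at h
  linear_combination dpow q b * dpow (n - 2 * q - m) z * h

lemma mul_solidPoly_z (n m : ℤ) (a b z : ℂ) {N : ℕ} (hN : n < N) :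
    z * solidPoly (n - 1) m a b z =
      ∑ q ∈ Finset.range N, ((n : ℂ) - 2 * q - m) * solidTerm n m a b z q := by
  rw [solidPoly_eq_sum _ a b z (show n - 1 < N by omega), Finset.mul_sum]
  refine Finset.sum_congr rfl fun q _ => ?_
  have h := mul_dpow (n - 2 * q - m) z
  unfold solidTerm
  rw [show n - 1 - 2 * (q : ℤ) - m = n - 2 * q - m - 1 by ring]
  push_cast at h
  linear_combination dpow (q + m) a * dpow q b * h

lemma mul_solidPoly_b (n m : ℤ) (a b z : ℂ) {N : ℕ} (hN : n < N) :
    b * solidPoly (n - 1) (m + 1) a b z =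
      ∑ q ∈ Finset.range N, (q : ℂ) * solidTerm n m a b z q := by
  -- Here the derivative shifts `q`. One zero term is added at the top so that the index can be
  -- shifted by one; the term `q = 0` has weight zero.
  rw [Finset.sum_subset (s₂ := Finset.range (N + 1))
      (by simp) (fun q _ hq => by
        rw [solidTerm_eq_zero (by simp only [Finset.mem_range] at hq; omega), mul_zero]),
    Finset.sum_range_succ', solidPoly_eq_sum _ a b z (show n - 1 < N by omega), Finset.mul_sum]
  simp only [Nat.cast_zero, zero_mul, add_zero]
  refine Finset.sum_congr rfl fun q _ => ?_
  have h := mul_dpow ((q : ℤ) + 1) b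
  unfold solidTerm
  rw [add_sub_cancel_right] at h
  rw [show (q : ℤ) + (m + 1) = ((q + 1 : ℕ) : ℤ) + m by push_cast; ring,
    show n - 1 - 2 * (q : ℤ) - (m + 1) = n - 2 * ((q + 1 : ℕ) : ℤ) - m by push_cast; ring]
  push_cast at h ⊢
  linear_combination dpow (q + 1 + m) a * dpow (n - 2 * (q + 1) - m) z * h

lemma solidPoly_euler (n m : ℤ) (a b z : ℂ) :
    a * solidPoly (n - 1) (m - 1) a b z + b * solidPoly (n - 1) (m + 1) a b z
      + z * solidPoly (n - 1) m a b z = n * solidPoly n m a b z := by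
  have hN : n < ((n.toNat + 1 : ℕ) : ℤ) := by omega
  rw [mul_solidPoly_a n m a b z hN, mul_solidPoly_b n m a b z hN, mul_solidPoly_z n m a b z hN,
    solidPoly, Finset.mul_sum, ← Finset.sum_add_distrib, ← Finset.sum_add_distrib]
  exact Finset.sum_congr rfl fun q _ => by ring

/-- The weights `n - 2q - m` and `2q` add up to `n - m`, which no longer depends on the summation
index. -/
lemma solidPoly_rec_b (n m : ℤ) (a b z : ℂ) :
    z * solidPoly (n - 1) m a b z + 2 * (b * solidPoly (n - 1) (m + 1) a b z) =
      (n - m) * solidPoly n m a b z := by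
  have hN : n < ((n.toNat + 1 : ℕ) : ℤ) := by omega
  rw [mul_solidPoly_b n m a b z hN, mul_solidPoly_z n m a b z hN,
    solidPoly, Finset.mul_sum, Finset.mul_sum, ← Finset.sum_add_distrib]
  exact Finset.sum_congr rfl fun q _ => by ring

lemma solidPoly_rec_a (n m : ℤ) (a b z : ℂ) :
    z * solidPoly (n - 1) m a b z + 2 * (a * solidPoly (n - 1) (m - 1) a b z) =
      (n + m) * solidPoly n m a b z := by
  linear_combination 2 * solidPoly_euler n m a b z - solidPoly_rec_b n m a b z

/-- The recurrence that raises the degree and keeps the order. -/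
lemma solidPoly_raise_z (n m : ℤ) (a b z : ℂ) :
    (2 * n + 1) * z * solidPoly n m a b z - (z ^ 2 - 4 * a * b) * solidPoly (n - 1) m a b z =
      (n + 1 + m) * (n + 1 - m) * solidPoly (n + 1) m a b z := by
  -- In `h1` multiplied by `n + 1 + m`, the neighbour of order `m + 1` is eliminated by `h2` and
  -- then `h3`. The factor `z² - 4ab` that appears is `‖x‖²` for the coordinate forms.
  have h1 := solidPoly_rec_b (n + 1) m a b z
  have h2 := solidPoly_rec_a n (m + 1) a b z
  have h3 := solidPoly_rec_b n m a b z
  rw [add_sub_cancel_right] at h1 h2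
  push_cast at h1 h2 h3
  linear_combination (n + 1 + m : ℂ) * h1 + 2 * b * h2 - z * h3

/-- The recurrence that raises the degree and lowers the order. -/
lemma solidPoly_raise_b (n m : ℤ) (a b z : ℂ) :
    (z ^ 2 - 4 * a * b) * solidPoly (n - 1) (m - 1) a b z
        + 2 * (2 * n + 1) * b * solidPoly n m a b z =
      (n - m + 2) * (n - m + 1) * solidPoly (n + 1) (m - 1) a b z := by
  have h1 := solidPoly_rec_b (n + 1) (m - 1) a b z
  have h2 := solidPoly_rec_b n (m - 1) a b z
  have h3 := solidPoly_rec_a n m a b z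
  rw [add_sub_cancel_right, sub_add_cancel] at h1
  rw [sub_add_cancel] at h2
  push_cast at h1 h2 h3
  linear_combination (n - m + 1 : ℂ) * h1 + z * h2 - 2 * b * h3

/-- The recurrence that raises the degree and the order. -/
lemma solidPoly_raise_a (n m : ℤ) (a b z : ℂ) :
    (z ^ 2 - 4 * a * b) * solidPoly (n - 1) (m + 1) a b z
        + 2 * (2 * n + 1) * a * solidPoly n m a b z =
      (n + m + 2) * (n + m + 1) * solidPoly (n + 1) (m + 1) a b z := by
  have h1 := solidPoly_rec_a (n + 1) (m + 1) a b z
  have h2 := solidPoly_rec_a n (m + 1) a b z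
  have h3 := solidPoly_rec_b n m a b z
  rw [add_sub_cancel_right, add_sub_cancel_right] at h1
  rw [add_sub_cancel_right] at h2
  push_cast at h1 h2 h3
  linear_combination (n + m + 1 : ℂ) * h1 + z * h2 - 2 * a * h3

lemma solidPoly_smul (n m : ℤ) {t : ℂ} (ht : t ≠ 0) (a b z : ℂ) :
    solidPoly n m (t * a) (t * b) (t * z) = t ^ n * solidPoly n m a b z := by
  unfold solidPoly
  rw [Finset.mul_sum]
  refine Finset.sum_congr rfl fun q _ => ?_
  unfold solidTerm
  rw [dpow_mul, dpow_mul, dpow_mul]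
  have : t ^ n = t ^ ((q : ℤ) + m) * t ^ (q : ℤ) * t ^ (n - 2 * q - m) := by
    rw [← zpow_add₀ ht, ← zpow_add₀ ht]
    congr 1
    ring
  rw [this]
  ring

/-! ### Solid harmonics on `ℝ³` -/

/-- The complex linear form on `ℝ³` with coefficients `u`. -/
def coordForm (u : Fin 3 → ℂ) : E3 →L[ℝ] ℂ :=
  ∑ j, (EuclideanSpace.proj j : E3 →L[ℝ] ℝ).smulRight (u j)

lemma coordForm_apply (u : Fin 3 → ℂ) (x : E3) : coordForm u x = ∑ j, (x j : ℂ) * u j := by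
  simp [coordForm]

lemma coordForm_single (u : Fin 3 → ℂ) (j : Fin 3) :
    coordForm u (EuclideanSpace.single j (1 : ℝ)) = u j := by
  rw [coordForm_apply, Finset.sum_eq_single j]
  · simp
  · intro i _ hi
    simp [hi]
  · simp

/-- The coefficients of the form `-(x₁ + i x₂) / 2`. -/
def formA : Fin 3 → ℂ := ![-1 / 2, -Complex.I / 2, 0]
/-- The coefficients of the form `(x₁ - i x₂) / 2`. -/
def formB : Fin 3 → ℂ := ![1 / 2, -Complex.I / 2, 0]
/-- The coefficients of the form `x₃`. -/
def formZ : Fin 3 → ℂ := ![0, 0, 1]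

lemma coordForm_formA (x : E3) : coordForm formA x = -((x 0 : ℂ) + Complex.I * (x 1 : ℂ)) / 2 := by
  rw [coordForm_apply, Fin.sum_univ_three]
  simp [formA]
  ring

lemma coordForm_formB (x : E3) : coordForm formB x = ((x 0 : ℂ) - Complex.I * (x 1 : ℂ)) / 2 := by
  rw [coordForm_apply, Fin.sum_univ_three]
  simp [formB]
  ring

lemma coordForm_formZ (x : E3) : coordForm formZ x = (x 2 : ℂ) := by
  rw [coordForm_apply, Fin.sum_univ_three]
  simp [formZ]

/-- The unnormalized solid harmonic of degree `n` and order `m`. -/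
def solid (n m : ℤ) (x : E3) : ℂ :=
  solidPoly n m (coordForm formA x) (coordForm formB x) (coordForm formZ x)

lemma hasFDerivAt_dpow_coordForm (k : ℤ) (u : Fin 3 → ℂ) (x : E3) :
    HasFDerivAt (fun y => dpow k (coordForm u y))
      (dpow (k - 1) (coordForm u x) • coordForm u) x := by
  have h := (hasDerivAt_dpow k (coordForm u x)).complexToReal_fderiv.comp x
    (coordForm u).hasFDerivAt
  refine h.congr_fderiv ?_
  ext v
  simp

/-- Divided powers differentiate by a shift of the exponent, so `∂_a`, `∂_b`, `∂_z` send the indices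
`(n, m)` to `(n-1, m-1)`, `(n-1, m+1)`, `(n-1, m)` without numerical factors; the rest is the chain
rule. -/
lemma hasFDerivAt_solid (n m : ℤ) (x : E3) :
    HasFDerivAt (solid n m) (solid (n - 1) (m - 1) x • coordForm formA
      + solid (n - 1) (m + 1) x • coordForm formB + solid (n - 1) m x • coordForm formZ) x := by
  have hN : n < ((n.toNat + 1 : ℕ) : ℤ) := by omega
  set N := n.toNat + 1 with hNdef
  have key : HasFDerivAt (solid n m) (∑ q ∈ Finset.range N,
      ((solidTerm (n - 1) (m - 1) (coordForm formA x) (coordForm formB x) (coordForm formZ x) q)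
          • coordForm formA
        + (dpow (q + m) (coordForm formA x) * dpow ((q : ℤ) - 1) (coordForm formB x)
          * dpow (n - 2 * q - m) (coordForm formZ x)) • coordForm formB
        + (solidTerm (n - 1) m (coordForm formA x) (coordForm formB x) (coordForm formZ x) q)
          • coordForm formZ)) x := by
    unfold solid solidPoly
    rw [← hNdef]
    refine HasFDerivAt.fun_sum fun q _ => ?_
    have h := ((hasFDerivAt_dpow_coordForm (q + m) formA x).mul
      (hasFDerivAt_dpow_coordForm q formB x)).mul
      (hasFDerivAt_dpow_coordForm (n - 2 * q - m) formZ x)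
    refine h.congr_fderiv ?_
    ext v
    simp only [solidTerm, add_apply, smul_apply,
      smul_eq_mul, Pi.mul_apply]
    rw [show (q : ℤ) + (m - 1) = q + m - 1 by ring,
      show n - 1 - 2 * (q : ℤ) - (m - 1) = n - 2 * q - m by ring,
      show n - 1 - 2 * (q : ℤ) - m = n - 2 * q - m - 1 by ring]
    ring
  refine key.congr_fderiv ?_
  rw [Finset.sum_add_distrib, Finset.sum_add_distrib, ← Finset.sum_smul, ← Finset.sum_smul,
    ← Finset.sum_smul]
  congr 2
  · congr 1
    exact (solidPoly_eq_sum _ _ _ _ (by omega)).symm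
  · congr 1
    rw [hNdef, Finset.sum_range_succ', solid,
      solidPoly_eq_sum (n := n - 1) _ _ _ _ (N := n.toNat) (by omega)]
    simp only [Nat.cast_zero, zero_sub, dpow_of_neg (show (-1 : ℤ) < 0 by norm_num), mul_zero,
      zero_mul, add_zero]
    refine Finset.sum_congr rfl fun q _ => ?_
    unfold solidTerm
    rw [show (q : ℤ) + (m + 1) = ((q + 1 : ℕ) : ℤ) + m by push_cast; ring,
      show n - 1 - 2 * (q : ℤ) - (m + 1) = n - 2 * ((q + 1 : ℕ) : ℤ) - m by push_cast; ring,
      show ((q + 1 : ℕ) : ℤ) - 1 = q by push_cast; ring]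
  · exact (solidPoly_eq_sum _ _ _ _ (by omega)).symm

lemma contDiff_solid (n m : ℤ) : ContDiff ℝ ∞ (solid n m) := by
  have h : ∀ (k : ℤ) (u : Fin 3 → ℂ), ContDiff ℝ ∞ (fun y : E3 => dpow k (coordForm u y)) :=
    fun k u => ((contDiff_dpow k).restrict_scalars ℝ).comp (coordForm u).contDiff
  unfold solid solidPoly solidTerm
  exact ContDiff.sum fun q _ => ((h _ _).mul (h _ _)).mul (h _ _)

lemma pd_solid (j : Fin 3) (n m : ℤ) (x : E3) :
    pd j (solid n m) x = solid (n - 1) (m - 1) x * formA j + solid (n - 1) (m + 1) x * formB j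
      + solid (n - 1) m x * formZ j := by
  rw [pd, (hasFDerivAt_solid n m x).fderiv]
  simp [coordForm_single]

lemma solid_smul (n m : ℤ) {t : ℝ} (ht : t ≠ 0) (x : E3) :
    solid n m (t • x) = (t : ℂ) ^ n * solid n m x := by
  unfold solid
  rw [map_smul, map_smul, map_smul, Complex.real_smul, Complex.real_smul, Complex.real_smul,
    solidPoly_smul _ _ (by exact_mod_cast ht)]

lemma sum_mul_pd_solid (n m : ℤ) (x : E3) :
    ∑ j, (x j : ℂ) * pd j (solid n m) x = n * solid n m x := by
  have h := solidPoly_euler n m (coordForm formA x) (coordForm formB x) (coordForm formZ x)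
  simp only [pd_solid]
  rw [coordForm_apply, coordForm_apply, coordForm_apply] at h
  simp only [Fin.sum_univ_three] at h ⊢
  simp only [solid, coordForm_apply, Fin.sum_univ_three]
  linear_combination h

lemma pd_pd_solid (j : Fin 3) (n m : ℤ) (x : E3) :
    pd j (pd j (solid n m)) x = solid (n - 2) (m - 2) x * formA j ^ 2
      + solid (n - 2) (m + 2) x * formB j ^ 2 + solid (n - 2) m x * formZ j ^ 2
      + 2 * solid (n - 2) m x * (formA j * formB j)
      + 2 * solid (n - 2) (m - 1) x * (formA j * formZ j)
      + 2 * solid (n - 2) (m + 1) x * (formB j * formZ j) := by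
  have e : pd j (solid n m) = fun x => solid (n - 1) (m - 1) x * formA j
      + solid (n - 1) (m + 1) x * formB j + solid (n - 1) m x * formZ j := by
    ext x; exact pd_solid j n m x
  have h := (((hasFDerivAt_solid (n - 1) (m - 1) x).mul_const (formA j)).fun_add
    ((hasFDerivAt_solid (n - 1) (m + 1) x).mul_const (formB j))).fun_add
    ((hasFDerivAt_solid (n - 1) m x).mul_const (formZ j))
  rw [e, pd, h.fderiv]
  simp only [add_apply, smul_apply, coordForm_single,
    smul_eq_mul]
  rw [show n - 1 - 1 = n - 2 by ring, show m - 1 - 1 = m - 2 by ring,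
    show m - 1 + 1 = m by ring, show m + 1 + 1 = m + 2 by ring, show m + 1 - 1 = m by ring]
  ring

/-- In the variables `a`, `b`, `z` the Laplacian is `∂_z² - ∂_a ∂_b`, and both terms send the
indices `(n, m)` to `(n-2, m)`, so they cancel. -/
lemma laplacian_solid (n m : ℤ) (x : E3) : ∑ j, pd j (pd j (solid n m)) x = 0 := by
  simp only [pd_pd_solid, Fin.sum_univ_three, formA, formB, formZ]
  simp
  linear_combination (solid (n - 2) (m - 2) x + solid (n - 2) (m + 2) x
    + 2 * solid (n - 2) m x) / 4 * Complex.I_sq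

lemma norm_sq_eq_coordForm (x : E3) : ((‖x‖ : ℂ)) ^ 2 =
    coordForm formZ x ^ 2 - 4 * coordForm formA x * coordForm formB x := by
  have h : (‖x‖ : ℝ) ^ 2 = x 0 ^ 2 + x 1 ^ 2 + x 2 ^ 2 := by
    rw [EuclideanSpace.norm_sq_eq, Fin.sum_univ_three]
    simp
  have h' : ((‖x‖ : ℂ)) ^ 2 = (x 0 : ℂ) ^ 2 + (x 1 : ℂ) ^ 2 + (x 2 : ℂ) ^ 2 := by
    exact_mod_cast congrArg (fun t : ℝ => (t : ℂ)) h
  rw [h', coordForm_formA, coordForm_formB, coordForm_formZ]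
  linear_combination (x 1 : ℂ) ^ 2 * Complex.I_sq

/-- The Kelvin-type raising relation for solid harmonics. -/
lemma norm_sq_mul_pd_solid (j : Fin 3) (n m : ℤ) (x : E3) :
    (‖x‖ : ℂ) ^ 2 * pd j (solid n m) x - (2 * n + 1) * (x j : ℂ) * solid n m x =
      (n - m + 2) * (n - m + 1) * formA j * solid (n + 1) (m - 1) x
      + (n + m + 2) * (n + m + 1) * formB j * solid (n + 1) (m + 1) x
      - (n + 1 + m) * (n + 1 - m) * formZ j * solid (n + 1) m x := by
  have h1 := solidPoly_raise_a n m (coordForm formA x) (coordForm formB x) (coordForm formZ x)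
  have h2 := solidPoly_raise_b n m (coordForm formA x) (coordForm formB x) (coordForm formZ x)
  have h3 := solidPoly_raise_z n m (coordForm formA x) (coordForm formB x) (coordForm formZ x)
  -- This is half the `j`-th derivative of `‖x‖² = z² - 4ab`. With it the claim splits into the
  -- three raising recurrences, one for each of the coefficients of the forms.
  have hx : (x j : ℂ) = -2 * formA j * coordForm formB x - 2 * formB j * coordForm formA x
      + formZ j * coordForm formZ x := by
    rw [coordForm_formA, coordForm_formB, coordForm_formZ]
    fin_cases j <;> simp [formA, formB, formZ]
    · ring
    · linear_combination (x 1 : ℂ) * Complex.I_sq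
  rw [pd_solid, norm_sq_eq_coordForm, hx]
  unfold solid
  linear_combination formA j * h2 + formB j * h1 - formZ j * h3

lemma solid_zero_zero (x : E3) : solid 0 0 x = 1 := by
  simp [solid, solidPoly, solidTerm, dpow]

/-! ### Linear independence -/

/-- Induction on the degree: the derivatives along `a`, `z`, `b` of a vanishing combination are
vanishing combinations one degree lower, with the coefficient sequence shifted by `0`, `1`, `2`.
Orders that leave the admissible range contribute nothing. -/
lemma eq_zero_of_sum_mul_solid_eq_zero (n : ℕ) : ∀ b : ℕ → ℂ,
    (∀ x : E3, ∑ i ∈ Finset.range (2 * n + 1), b i * solid n (n - i) x = 0) →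
      ∀ i < 2 * n + 1, b i = 0 := by
  induction n with
  | zero =>
    intro b hb i hi
    obtain rfl : i = 0 := by omega
    simpa [solid_zero_zero] using hb 0
  | succ n ih =>
    intro b hb
    have hpd : ∀ x : E3, ∀ j : Fin 3, ∑ i ∈ Finset.range (2 * (n + 1) + 1),
        b i * (solid n (n - i) x * formA j + solid n (n - i + 2) x * formB j
          + solid n (n - i + 1) x * formZ j) = 0 := by
      intro x j
      have h1 : HasFDerivAt (fun x => ∑ i ∈ Finset.range (2 * (n + 1) + 1),
          b i * solid (n + 1 : ℕ) ((n + 1 : ℕ) - i) x) _ x :=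
        HasFDerivAt.fun_sum fun i _ =>
          (hasFDerivAt_solid (n + 1 : ℕ) ((n + 1 : ℕ) - i) x).const_mul (b i)
      have h2 := h1.unique ((hasFDerivAt_const (0 : ℂ) x).congr_of_eventuallyEq
        (Eventually.of_forall hb))
      have h3 := congrArg (fun L => L (EuclideanSpace.single j (1 : ℝ))) h2
      simp only [sum_apply, smul_apply,
        add_apply, coordForm_single, smul_eq_mul,
        zero_apply] at h3
      rw [← h3]
      refine Finset.sum_congr rfl fun i _ => ?_
      rw [show ((n + 1 : ℕ) : ℤ) - 1 = n by push_cast; ring,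
        show ((n + 1 : ℕ) : ℤ) - i - 1 = n - i by push_cast; ring,
        show ((n + 1 : ℕ) : ℤ) - i + 1 = n - i + 2 by push_cast; ring,
        show ((n + 1 : ℕ) : ℤ) - i = n - i + 1 by push_cast; ring]
    have hsplit : ∀ x : E3, ∀ j : Fin 3,
        (∑ i ∈ Finset.range (2 * (n + 1) + 1), b i * solid n (n - i) x) * formA j
        + (∑ i ∈ Finset.range (2 * (n + 1) + 1), b i * solid n (n - i + 2) x) * formB j
        + (∑ i ∈ Finset.range (2 * (n + 1) + 1), b i * solid n (n - i + 1) x) * formZ j = 0 := by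
      intro x j
      rw [← hpd x j, Finset.sum_mul, Finset.sum_mul, Finset.sum_mul, ← Finset.sum_add_distrib,
        ← Finset.sum_add_distrib]
      exact Finset.sum_congr rfl fun i _ => by ring
    have hvan : ∀ (x : E3) (m : ℤ), (n : ℤ) < |m| → solid n m x = 0 :=
      fun x m hm => solidPoly_eq_zero hm _ _ _
    have hA : ∀ x : E3, ∑ i ∈ Finset.range (2 * n + 1), b i * solid n (n - i) x = 0 := by
      intro x
      have h0 := hsplit x 0
      have h1 := hsplit x 1
      simp only [formA, formB, formZ, Matrix.cons_val_zero, Matrix.cons_val_one, mul_zero,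
        add_zero] at h0 h1
      -- The operator `-∂₁ + i ∂₂` isolates the `a`-derivative; in the same way `∂₁ + i ∂₂` isolates
      -- the `b`-derivative below.
      have h : ∑ i ∈ Finset.range (2 * (n + 1) + 1), b i * solid n (n - i) x = 0 := by
        linear_combination -h0 + Complex.I * h1
          + ((∑ i ∈ Finset.range (2 * (n + 1) + 1), b i * solid n (n - i) x)
            + (∑ i ∈ Finset.range (2 * (n + 1) + 1), b i * solid n (n - i + 2) x)) / 2
            * Complex.I_sq
      rw [show 2 * (n + 1) + 1 = 2 * n + 1 + 1 + 1 by ring, Finset.sum_range_succ,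
        Finset.sum_range_succ,
        hvan x (n - (2 * n + 1 : ℕ)) (by push_cast; rw [abs_of_neg] <;> omega),
        hvan x (n - (2 * n + 1 + 1 : ℕ)) (by push_cast; rw [abs_of_neg] <;> omega)] at h
      simpa using h
    have hB : ∀ x : E3, ∑ i ∈ Finset.range (2 * n + 1), b (i + 2) * solid n (n - i) x = 0 := by
      intro x
      have h0 := hsplit x 0
      have h1 := hsplit x 1
      simp only [formA, formB, formZ, Matrix.cons_val_zero, Matrix.cons_val_one, mul_zero,
        add_zero] at h0 h1
      have h : ∑ i ∈ Finset.range (2 * (n + 1) + 1), b i * solid n (n - i + 2) x = 0 := by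
        linear_combination h0 + Complex.I * h1
          + ((∑ i ∈ Finset.range (2 * (n + 1) + 1), b i * solid n (n - i) x)
            + (∑ i ∈ Finset.range (2 * (n + 1) + 1), b i * solid n (n - i + 2) x)) / 2
            * Complex.I_sq
      rw [show 2 * (n + 1) + 1 = 2 * n + 1 + 1 + 1 by ring, Finset.sum_range_succ',
        Finset.sum_range_succ',
        hvan x (n - (0 : ℕ) + 2) (by rw [abs_of_pos] <;> push_cast <;> omega),
        hvan x (n - (0 + 1 : ℕ) + 2) (by rw [abs_of_pos] <;> push_cast <;> omega)] at h
      rw [← h]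
      simp only [mul_zero, add_zero]
      refine Finset.sum_congr rfl fun i _ => ?_
      rw [show (n : ℤ) - (i + 1 + 1 : ℕ) + 2 = n - i by push_cast; ring]
    have hZ : ∀ x : E3, ∑ i ∈ Finset.range (2 * n + 1), b (i + 1) * solid n (n - i) x = 0 := by
      intro x
      have h := hsplit x 2
      simp only [formA, formB, formZ, Matrix.cons_val, mul_zero, zero_add, mul_one] at h
      rw [show 2 * (n + 1) + 1 = 2 * n + 1 + 1 + 1 by ring, Finset.sum_range_succ,
        Finset.sum_range_succ',
        hvan x (n - (0 : ℕ) + 1) (by rw [abs_of_pos] <;> push_cast <;> omega),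
        hvan x (n - (2 * n + 1 + 1 : ℕ) + 1) (by push_cast; rw [abs_of_neg] <;> omega)] at h
      rw [← h]
      simp only [mul_zero, add_zero]
      refine Finset.sum_congr rfl fun i _ => ?_
      rw [show (n : ℤ) - (i + 1 : ℕ) + 1 = n - i by push_cast; ring]
    -- The unshifted sequence covers all indices but the last two; these are reached by the shifts
    -- by one and by two.
    intro i hi
    rcases lt_or_ge i (2 * n + 1) with h | h
    · exact ih b hA i h
    · rcases lt_or_ge i (2 * n + 2) with h' | h'
      · obtain ⟨l, rfl⟩ : ∃ l, i = l + 1 := ⟨i - 1, by omega⟩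
        exact ih _ hZ l (by omega)
      · obtain ⟨l, rfl⟩ : ∃ l, i = l + 2 := ⟨i - 2, by omega⟩
        exact ih _ hB l (by omega)

/-! ### The vectors `regY`, `irrY` and their derivative matrices -/

/-- The normalization constant relating `sphY` to `solid`. -/
def sphNorm (n : ℕ) (i : Fin (2 * n + 1)) : ℂ :=
  (Real.sqrt ((2 * n + 1) / (4 * Real.pi) * ((2 * n - (i : ℕ))! : ℝ) * ((i : ℕ)! : ℝ)) : ℂ)

lemma sphNorm_ne_zero (n : ℕ) (i : Fin (2 * n + 1)) : sphNorm n i ≠ 0 := by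
  unfold sphNorm
  have : 0 < ((2 * n + 1) / (4 * Real.pi) * ((2 * n - (i : ℕ))! : ℝ) * ((i : ℕ)! : ℝ)) := by
    have h1 := Nat.factorial_pos (2 * n - (i : ℕ))
    have h2 := Nat.factorial_pos (i : ℕ)
    positivity
  exact_mod_cast (Real.sqrt_pos.2 this).ne'

/-- The two constraints of the triple sum determine `p = n + q - i` and `s = i - 2q` from `q`, so
only the sum over `q` remains, and it is empty where one of these is negative. -/
lemma sphY_eq (n : ℕ) (x : E3) (i : Fin (2 * n + 1)) :
    sphY n x i = sphNorm n i * solid n (n - (i : ℕ)) x := by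
  unfold sphY sphNorm
  congr 1
  rw [solid, solidPoly_eq_sum (N := n + 1) _ _ _ _ (by push_cast; omega), Finset.sum_comm]
  refine Finset.sum_congr rfl fun q hq => ?_
  rw [Finset.mem_range] at hq
  unfold solidTerm
  rw [coordForm_formA, coordForm_formB, coordForm_formZ, dpow_natCast]
  rcases lt_or_ge (n + q) (i : ℕ) with h1 | h1
  · rw [dpow_of_neg (by omega), zero_mul, zero_mul]
    exact Finset.sum_eq_zero fun p _ => Finset.sum_eq_zero fun s _ => if_neg (by omega)
  rcases lt_or_ge (i : ℕ) (2 * q) with h2 | h2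
  · rw [dpow_of_neg (k := (n : ℤ) - 2 * q - (n - (i : ℕ))) (by omega), mul_zero]
    exact Finset.sum_eq_zero fun p _ => Finset.sum_eq_zero fun s _ => if_neg (by omega)
  obtain ⟨p, hp⟩ : ∃ p, p + (i : ℕ) = n + q := ⟨n + q - i, by omega⟩
  obtain ⟨s, hs⟩ : ∃ s, s + 2 * q = (i : ℕ) := ⟨i - 2 * q, by omega⟩
  rw [show (q : ℤ) + (n - (i : ℕ)) = (p : ℕ) by omega,
    show (n : ℤ) - 2 * q - (n - (i : ℕ)) = (s : ℕ) by omega, dpow_natCast, dpow_natCast,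
    Finset.sum_eq_single p, Finset.sum_eq_single s, if_pos ⟨by omega, hp⟩]
  · rw [div_mul_div_comm, div_mul_div_comm]
  · intro t _ ht
    exact if_neg (by omega)
  · intro h
    exact absurd (Finset.mem_range.2 (by omega)) h
  · intro t _ ht
    exact Finset.sum_eq_zero fun s _ => if_neg (by omega)
  · intro h
    exact absurd (Finset.mem_range.2 (by omega)) h

/-- Euler's identity at the origin reads `0 = n f(0)`. -/
lemma solid_zero_of_pos {n : ℕ} (hn : n ≠ 0) (m : ℤ) : solid n m 0 = 0 := by
  have h := sum_mul_pd_solid n m 0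
  simpa [hn] using h.symm

/-- Homogeneity absorbs `r^n`, which shows that these functions are polynomials, smooth also at the
origin. There the convention `‖0‖⁻¹ = 0` makes the unit vector zero, and both sides still agree. -/
lemma regY_eq (n : ℕ) (x : E3) (i : Fin (2 * n + 1)) :
    regY n x i = sphNorm n i * solid n (n - (i : ℕ)) x := by
  unfold regY
  rw [sphY_eq]
  rcases eq_or_ne x 0 with rfl | hx
  · have h0 : unitVec 0 = 0 := by simp [unitVec]
    rw [h0]
    rcases eq_or_ne n 0 with rfl | hn
    · simp
    · simp [solid_zero_of_pos hn, hn]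
  · have hr : ‖x‖ ≠ 0 := norm_ne_zero_iff.2 hx
    have hr' : (‖x‖ : ℂ) ≠ 0 := by exact_mod_cast hr
    rw [unitVec, solid_smul _ _ (inv_ne_zero hr)]
    push_cast
    rw [zpow_natCast, inv_pow]
    field_simp

lemma irrY_eq_regY (n : ℕ) {x : E3} (hx : x ≠ 0) :
    irrY n x = ((‖x‖ : ℂ) ^ (2 * n + 1))⁻¹ • regY n x := by
  have hr' : (‖x‖ : ℂ) ≠ 0 := by exact_mod_cast norm_ne_zero_iff.2 hx
  ext i
  simp only [irrY, regY, Pi.smul_apply, smul_eq_mul]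
  field_simp
  ring

/-- Differentiation can push the order out of range; allowing every integer `m`, with the zero row
outside the range, avoids a case distinction in the derivative matrices. -/
lemma exists_solid_eq_dotProduct_regY (n : ℕ) (m : ℤ) :
    ∃ d : Fin (2 * n + 1) → ℂ, ∀ x, solid n m x = d ⬝ᵥ regY n x := by
  rcases lt_or_ge (n : ℤ) |m| with h | h
  · exact ⟨0, fun x => by rw [zero_dotProduct]; exact solidPoly_eq_zero h _ _ _⟩
  · have h1 := abs_le.1 h
    obtain ⟨i, hi⟩ : ∃ i : Fin (2 * n + 1), m = n - (i : ℕ) :=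
      ⟨⟨(n - m).toNat, by omega⟩, by simp only; omega⟩
    refine ⟨Pi.single i (sphNorm n i)⁻¹, fun x => ?_⟩
    rw [single_dotProduct, regY_eq, hi, inv_mul_cancel_left₀ (sphNorm_ne_zero n i)]

lemma contDiff_regY (n : ℕ) (i : Fin (2 * n + 1)) : ContDiff ℝ ∞ (fun x => regY n x i) := by
  simp only [regY_eq]
  exact contDiff_const.mul (contDiff_solid _ _)

lemma continuous_regY (n : ℕ) : Continuous (regY n) :=
  continuous_pi fun i => (contDiff_regY n i).continuous

lemma regY_smul (n : ℕ) {t : ℝ} (ht : t ≠ 0) (x : E3) :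
    regY n (t • x) = (t : ℂ) ^ n • regY n x := by
  ext i
  rw [regY_eq, solid_smul _ _ ht, Pi.smul_apply, smul_eq_mul, regY_eq, zpow_natCast]
  ring

/-- The entries of `regY n` are linearly independent functions. -/
lemma eq_zero_of_dotProduct_regY (n : ℕ) (a : Fin (2 * n + 1) → ℂ)
    (h : ∀ x, x ≠ 0 → a ⬝ᵥ regY n x = 0) : a = 0 := by
  have hall : ∀ x, a ⬝ᵥ regY n x = 0 := by
    have hc : Continuous fun x => a ⬝ᵥ regY n x := continuous_const.dotProduct (continuous_regY n)
    have := hc.ext_on (dense_compl_singleton (0 : E3)) continuous_const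
      (fun x hx => h x hx)
    exact fun x => congrFun this x
  have hz := eq_zero_of_sum_mul_solid_eq_zero n
    (fun i => if hi : i < 2 * n + 1 then a ⟨i, hi⟩ * sphNorm n ⟨i, hi⟩ else 0) (fun x => by
      rw [← hall x, dotProduct, Finset.sum_range]
      refine Finset.sum_congr rfl fun i _ => ?_
      rw [regY_eq, dif_pos i.2, mul_assoc])
  ext i
  have := hz i i.2
  rw [dif_pos i.2] at this
  exact (mul_eq_zero.1 this).resolve_right (sphNorm_ne_zero n i)

/-- By homogeneity the values on one sphere determine the polynomial on every ray. -/
lemma eq_zero_of_dotProduct_regY_sphere (n : ℕ) {R : ℝ} (hR : 0 < R) (a : Fin (2 * n + 1) → ℂ)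
    (h : ∀ x, ‖x‖ = R → a ⬝ᵥ regY n x = 0) : a = 0 := by
  refine eq_zero_of_dotProduct_regY n a fun x hx => ?_
  have hr : ‖x‖ ≠ 0 := norm_ne_zero_iff.2 hx
  have ht : R * ‖x‖⁻¹ ≠ 0 := mul_ne_zero hR.ne' (inv_ne_zero hr)
  have h1 := h ((R * ‖x‖⁻¹) • x) (by
    rw [norm_smul, Real.norm_eq_abs, abs_of_pos (by positivity)]
    field_simp)
  rw [regY_smul n ht, dotProduct_smul, smul_eq_mul] at h1
  exact (mul_eq_zero.1 h1).resolve_left (pow_ne_zero _ (by exact_mod_cast ht))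

lemma eq_zero_of_dotProduct_irrY (n : ℕ) (a : Fin (2 * n + 1) → ℂ)
    (h : ∀ x, x ≠ 0 → a ⬝ᵥ irrY n x = 0) : a = 0 := by
  refine eq_zero_of_dotProduct_regY n a fun x hx => ?_
  have h1 := h x hx
  rw [irrY_eq_regY n hx, dotProduct_smul, smul_eq_mul] at h1
  refine (mul_eq_zero.1 h1).resolve_left (inv_ne_zero (pow_ne_zero _ ?_))
  exact_mod_cast norm_ne_zero_iff.2 hx

/-! ### Rules for partial derivatives and powers of the norm. -/

lemma pd_const_mul (j : Fin 3) (c : ℂ) {f : E3 → ℂ} {x : E3} (hf : DifferentiableAt ℝ f x) :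
    pd j (fun y => c * f y) x = c * pd j f x := by
  unfold pd
  rw [fderiv_const_mul hf]
  simp

lemma pd_add (j : Fin 3) {f g : E3 → ℂ} {x : E3} (hf : DifferentiableAt ℝ f x)
    (hg : DifferentiableAt ℝ g x) : pd j (fun y => f y + g y) x = pd j f x + pd j g x := by
  unfold pd
  rw [fderiv_fun_add hf hg]
  simp

lemma pd_mul (j : Fin 3) {f g : E3 → ℂ} {x : E3} (hf : DifferentiableAt ℝ f x)
    (hg : DifferentiableAt ℝ g x) :
    pd j (fun y => f y * g y) x = f x * pd j g x + g x * pd j f x := by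
  unfold pd
  rw [fderiv_fun_mul hf hg]
  simp

lemma pd_sum {ι : Type*} (s : Finset ι) (j : Fin 3) {f : ι → E3 → ℂ} {x : E3}
    (hf : ∀ i ∈ s, DifferentiableAt ℝ (f i) x) :
    pd j (fun y => ∑ i ∈ s, f i y) x = ∑ i ∈ s, pd j (f i) x := by
  unfold pd
  rw [fderiv_fun_sum hf]
  simp

lemma pd_congr (j : Fin 3) {f g : E3 → ℂ} {x : E3} (h : f =ᶠ[𝓝 x] g) : pd j f x = pd j g x := by
  unfold pd
  rw [h.fderiv_eq]

lemma pd_norm_zpow (j : Fin 3) (k : ℤ) {x : E3} (hx : x ≠ 0) :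
    pd j (fun y : E3 => (‖y‖ : ℂ) ^ k) x = k * (‖x‖ : ℂ) ^ (k - 2) * (x j : ℂ) := by
  have hr : ‖x‖ ≠ 0 := norm_ne_zero_iff.2 hx
  have hr' : (‖x‖ : ℂ) ≠ 0 := by exact_mod_cast hr
  have h1 : HasFDerivAt (fun y : E3 => ‖y‖) (‖x‖⁻¹ • innerSL ℝ x) x := by
    have h2 : HasFDerivAt (fun y : E3 => ‖y‖ ^ 2) (2 • innerSL ℝ x) x :=
      (hasStrictFDerivAt_norm_sq x).hasFDerivAt
    have h3 := h2.sqrt (by positivity)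
    simp only [Real.sqrt_sq (norm_nonneg _)] at h3
    refine h3.congr_fderiv ?_
    ext v
    simp
    field_simp
  have h2 := (hasDerivAt_zpow k (‖x‖ : ℂ) (Or.inl hr')).complexToReal_fderiv.comp x
    (Complex.ofRealCLM.hasFDerivAt.comp x h1)
  have h3 : HasFDerivAt (fun y : E3 => (‖y‖ : ℂ) ^ k) _ x := h2
  rw [pd, h3.fderiv]
  have h4 : inner ℝ x (EuclideanSpace.single j (1 : ℝ)) = x j := by
    simp [EuclideanSpace.inner_single_right]
  simp [h4]
  rw [show k - 2 = k - 1 - 1 by ring, zpow_sub_one₀ hr' (k - 1)]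
  ring

lemma contDiffAt_norm_zpow (k : ℤ) {x : E3} (hx : x ≠ 0) :
    ContDiffAt ℝ ∞ (fun y : E3 => (‖y‖ : ℂ) ^ k) x := by
  have h1 : ContDiffAt ℝ ∞ (fun y : E3 => (‖y‖ : ℂ)) x :=
    Complex.ofRealCLM.contDiff.contDiffAt.comp x (contDiffAt_norm ℝ hx)
  have hr' : (‖x‖ : ℂ) ≠ 0 := by exact_mod_cast norm_ne_zero_iff.2 hx
  rcases k with k | k
  · simpa using h1.pow k
  · simp only [zpow_negSucc]
    exact (h1.pow (k + 1)).inv (pow_ne_zero _ hr')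

/-! ### Existence of the derivative matrices. -/

lemma pd_dotProduct_regY (j : Fin 3) (n : ℕ) (a : Fin (2 * n + 1) → ℂ) (x : E3) :
    pd j (fun y => a ⬝ᵥ regY n y) x = ∑ i, a i * pd j (fun y => regY n y i) x := by
  have hd : ∀ i, DifferentiableAt ℝ (fun y => regY n y i) x := fun i =>
    (contDiff_regY n i).contDiffAt.differentiableAt (by simp)
  simp only [dotProduct]
  rw [pd_sum _ _ fun i _ => (hd i).const_mul _]
  exact Finset.sum_congr rfl fun i _ => pd_const_mul _ _ (hd i)

lemma pd_regY (j : Fin 3) (n : ℕ) (x : E3) (i : Fin (2 * n + 1)) :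
    pd j (fun y => regY n y i) x = sphNorm n i * pd j (solid n (n - (i : ℕ))) x := by
  simp only [regY_eq]
  exact pd_const_mul _ _ ((contDiff_solid _ _).contDiffAt.differentiableAt (by simp))

lemma exists_pd_regY (n : ℕ) (j : Fin 3) :
    ∃ D : Matrix (Fin (2 * (n + 1) + 1)) (Fin (2 * n + 1)) ℂ, ∀ x i,
      pd j (fun y => regY (n + 1) y i) x = (D *ᵥ regY n x) i := by
  have h : ∀ i : Fin (2 * (n + 1) + 1), ∃ d : Fin (2 * n + 1) → ℂ, ∀ x,
      pd j (fun y => regY (n + 1) y i) x = d ⬝ᵥ regY n x := by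
    intro i
    obtain ⟨d1, h1⟩ := exists_solid_eq_dotProduct_regY n ((n + 1 : ℕ) - (i : ℕ) - 1)
    obtain ⟨d2, h2⟩ := exists_solid_eq_dotProduct_regY n ((n + 1 : ℕ) - (i : ℕ) + 1)
    obtain ⟨d3, h3⟩ := exists_solid_eq_dotProduct_regY n ((n + 1 : ℕ) - (i : ℕ))
    refine ⟨(sphNorm (n + 1) i * formA j) • d1 + (sphNorm (n + 1) i * formB j) • d2
      + (sphNorm (n + 1) i * formZ j) • d3, fun x => ?_⟩
    rw [pd_regY, pd_solid, show ((n + 1 : ℕ) : ℤ) - 1 = n by push_cast; ring, h1, h2, h3]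
    simp only [add_dotProduct, smul_dotProduct, smul_eq_mul]
    ring
  choose d hd using h
  exact ⟨d, fun x i => hd i x⟩

/-- Off the origin the function is a multiple of `r^(-2n-1) S` with `S` a solid harmonic, and
`r^(2n+3) ∂_j (r^(-2n-1) S) = r² ∂_j S - (2n+1) x_j S`. By `norm_sq_mul_pd_solid` the right side is
a combination of solid harmonics of degree `n + 1`. -/
lemma exists_pd_irrY (n : ℕ) (j : Fin 3) :
    ∃ D : Matrix (Fin (2 * n + 1)) (Fin (2 * (n + 1) + 1)) ℂ, ∀ x, x ≠ 0 → ∀ i,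
      pd j (fun y => irrY n y i) x = (D *ᵥ irrY (n + 1) x) i := by
  have h : ∀ i : Fin (2 * n + 1), ∃ d : Fin (2 * (n + 1) + 1) → ℂ, ∀ x, x ≠ 0 →
      pd j (fun y => irrY n y i) x = d ⬝ᵥ irrY (n + 1) x := by
    intro i
    set m : ℤ := n - (i : ℕ) with hm
    obtain ⟨d1, h1⟩ := exists_solid_eq_dotProduct_regY (n + 1) (m - 1)
    obtain ⟨d2, h2⟩ := exists_solid_eq_dotProduct_regY (n + 1) (m + 1)
    obtain ⟨d3, h3⟩ := exists_solid_eq_dotProduct_regY (n + 1) m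
    refine ⟨(sphNorm n i * ((n - m + 2) * (n - m + 1) * formA j)) • d1
      + (sphNorm n i * ((n + m + 2) * (n + m + 1) * formB j)) • d2
      - (sphNorm n i * ((n + 1 + m) * (n + 1 - m) * formZ j)) • d3, fun x hx => ?_⟩
    have hr' : (‖x‖ : ℂ) ≠ 0 := by exact_mod_cast norm_ne_zero_iff.2 hx
    have hev : (fun y => irrY n y i) =ᶠ[𝓝 x]
        fun y => sphNorm n i * ((‖y‖ : ℂ) ^ (-(2 * n + 1 : ℕ) : ℤ) * solid n m y) := by
      filter_upwards [isOpen_ne.mem_nhds hx] with y hy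
      rw [irrY_eq_regY n hy, Pi.smul_apply, regY_eq, smul_eq_mul, zpow_neg, zpow_natCast]
      ring
    have hd1 := (contDiffAt_norm_zpow (-(2 * n + 1 : ℕ) : ℤ) hx).differentiableAt (by simp)
    have hd2 : DifferentiableAt ℝ (solid n m) x :=
      (contDiff_solid _ _).contDiffAt.differentiableAt (by simp)
    rw [pd_congr j hev, pd_const_mul _ _ (hd1.fun_mul hd2), pd_mul _ hd1 hd2, pd_norm_zpow _ _ hx,
      irrY_eq_regY _ hx]
    simp only [add_dotProduct, sub_dotProduct, smul_dotProduct, dotProduct_smul, smul_eq_mul,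
      ← h1, ← h2, ← h3]
    have hk := norm_sq_mul_pd_solid j n m x
    have e1 : (‖x‖ : ℂ) ^ (-(2 * n + 1 : ℕ) : ℤ)
        = ((‖x‖ : ℂ) ^ (2 * (n + 1) + 1))⁻¹ * (‖x‖ : ℂ) ^ 2 := by
      rw [zpow_neg, zpow_natCast]
      field_simp
      ring
    have e2 : (‖x‖ : ℂ) ^ ((-(2 * n + 1 : ℕ) : ℤ) - 2) = ((‖x‖ : ℂ) ^ (2 * (n + 1) + 1))⁻¹ := by
      rw [show (-(2 * n + 1 : ℕ) : ℤ) - 2 = -((2 * (n + 1) + 1 : ℕ) : ℤ) by push_cast; ring,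
        zpow_neg, zpow_natCast]
    rw [e1, e2]
    push_cast at hk ⊢
    linear_combination sphNorm n i * ((‖x‖ : ℂ) ^ (2 * (n + 1) + 1))⁻¹ * hk
  choose d hd using h
  exact ⟨d, fun x hx i => hd i x hx⟩

lemma Dup_spec (n : ℕ) (j : Fin 3) {x : E3} (hx : x ≠ 0) (i : Fin (2 * n + 1)) :
    pd j (fun y => irrY n y i) x = (Dup n j *ᵥ irrY (n + 1) x) i :=
  Classical.epsilon_spec (exists_pd_irrY n j) x hx i

/-- The matrix `Ddown (n + 1) j` with its column index set in simplified form. -/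
def lowerD (n : ℕ) (j : Fin 3) : Matrix (Fin (2 * (n + 1) + 1)) (Fin (2 * n + 1)) ℂ :=
  Ddown (n + 1) j

/-- The choice guarantees the property only off the origin. Linear independence identifies the
chosen matrix, row by row, with one for which it holds everywhere. -/
lemma lowerD_spec (n : ℕ) (j : Fin 3) (x : E3) (i : Fin (2 * (n + 1) + 1)) :
    pd j (fun y => regY (n + 1) y i) x = (lowerD n j *ᵥ regY n x) i := by
  obtain ⟨D, hD⟩ := exists_pd_regY n j
  have hs : ∀ x : E3, x ≠ 0 → ∀ i, pd j (fun y => regY (n + 1) y i) x =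
      (lowerD n j *ᵥ regY n x) i :=
    Classical.epsilon_spec (p := fun D : Matrix (Fin (2 * (n + 1) + 1)) (Fin (2 * n + 1)) ℂ =>
      ∀ x : E3, x ≠ 0 → ∀ i, pd j (fun y => regY (n + 1) y i) x = (D *ᵥ regY n x) i)
      ⟨D, fun x _ i => hD x i⟩
  have hDD : D i - lowerD n j i = 0 := by
    refine eq_zero_of_dotProduct_regY n _ fun x hx => ?_
    have h1 := hs x hx i
    rw [hD x i] at h1
    rw [sub_dotProduct]
    exact sub_eq_zero.2 h1
  rw [hD x i, Matrix.mulVec, Matrix.mulVec, sub_eq_zero.1 hDD]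

/-! ### Calculus of partial derivatives of smooth functions -/

lemma _root_.ContDiffAt.pd {f : E3 → ℂ} {x : E3} (hf : ContDiffAt ℝ ∞ f x) (j : Fin 3) :
    ContDiffAt ℝ ∞ (pd j f) x :=
  (hf.fderiv_right (m := ∞) (by simp)).clm_apply contDiffAt_const

lemma _root_.ContDiffAt.differentiableAt_infty {f : E3 → ℂ} {x : E3} (hf : ContDiffAt ℝ ∞ f x) :
    DifferentiableAt ℝ f x := hf.differentiableAt (by simp)

lemma pd_comm {f : E3 → ℂ} {x : E3} (hf : ContDiffAt ℝ ∞ f x) (i j : Fin 3) :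
    pd i (pd j f) x = pd j (pd i f) x := by
  have hd : DifferentiableAt ℝ (fderiv ℝ f) x :=
    (hf.fderiv_right (m := ∞) (by simp)).differentiableAt (by simp)
  have key : ∀ a b : Fin 3, pd a (pd b f) x = fderiv ℝ (fderiv ℝ f) x
      (EuclideanSpace.single a (1 : ℝ)) (EuclideanSpace.single b (1 : ℝ)) := by
    intro a b
    have h := hd.hasFDerivAt.clm_apply
      (hasFDerivAt_const (EuclideanSpace.single b (1 : ℝ) : E3) x)
    change fderiv ℝ (fun y => fderiv ℝ f y (EuclideanSpace.single b (1 : ℝ))) x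
      (EuclideanSpace.single a (1 : ℝ)) = _
    rw [h.fderiv]
    simp
  rw [key, key]
  refine (hf.isSymmSndFDerivAt ?_) _ _
  rw [minSmoothness_of_isRCLikeNormedField]
  exact WithTop.coe_le_coe.2 (le_top : (2 : ℕ∞) ≤ ⊤)

lemma contDiff_coord (j : Fin 3) : ContDiff ℝ ∞ (fun y : E3 => (y j : ℂ)) :=
  Complex.ofRealCLM.contDiff.comp (EuclideanSpace.proj j : E3 →L[ℝ] ℝ).contDiff

lemma pd_coord (i j : Fin 3) (x : E3) :
    pd i (fun y : E3 => (y j : ℂ)) x = if i = j then 1 else 0 := by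
  have h : HasFDerivAt (fun y : E3 => (y j : ℂ))
      (Complex.ofRealCLM.comp (EuclideanSpace.proj j : E3 →L[ℝ] ℝ)) x :=
    (Complex.ofRealCLM.comp (EuclideanSpace.proj j : E3 →L[ℝ] ℝ)).hasFDerivAt
  rw [pd, h.fderiv]
  rcases eq_or_ne i j with rfl | hij
  · simp
  · simp [hij, hij.symm]

lemma norm_sq_eq_sum (x : E3) : (‖x‖ : ℂ) ^ 2 = ∑ j, (x j : ℂ) * (x j : ℂ) := by
  have h : (‖x‖ : ℝ) ^ 2 = ∑ j, x j * x j := by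
    rw [EuclideanSpace.norm_sq_eq]
    simp [sq]
  exact_mod_cast congrArg (fun t : ℝ => (t : ℂ)) h

lemma contDiff_norm_sq : ContDiff ℝ ∞ (fun y : E3 => (‖y‖ : ℂ) ^ 2) := by
  simp only [norm_sq_eq_sum]
  exact ContDiff.sum fun j _ => (contDiff_coord j).mul (contDiff_coord j)

lemma pd_norm_sq (j : Fin 3) (x : E3) : pd j (fun y : E3 => (‖y‖ : ℂ) ^ 2) x = 2 * (x j : ℂ) := by
  have hc := fun i => (contDiff_coord i).contDiffAt.differentiableAt_infty (x := x)
  simp only [norm_sq_eq_sum]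
  rw [pd_sum _ _ fun i _ => (hc i).fun_mul (hc i)]
  simp only [pd_mul _ (hc _) (hc _), pd_coord]
  simp [Finset.sum_add_distrib]
  ring

lemma pd_sub (j : Fin 3) {f g : E3 → ℂ} {x : E3} (hf : DifferentiableAt ℝ f x)
    (hg : DifferentiableAt ℝ g x) : pd j (fun y => f y - g y) x = pd j f x - pd j g x := by
  unfold pd
  rw [fderiv_fun_sub hf hg]
  simp

lemma pd_const (j : Fin 3) (c : ℂ) (x : E3) : pd j (fun _ => c) x = 0 := by
  simp [pd]

/-- The Laplacian of a product. -/
lemma laplacian_mul {Ω : Set E3} (hΩ : IsOpen Ω) {p f : E3 → ℂ}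
    (hp : ∀ x ∈ Ω, ContDiffAt ℝ ∞ p x) (hf : ∀ x ∈ Ω, ContDiffAt ℝ ∞ f x) {x : E3} (hx : x ∈ Ω) :
    ∑ k, pd k (pd k (fun y => p y * f y)) x =
      p x * ∑ k, pd k (pd k f) x + 2 * ∑ k, pd k p x * pd k f x
        + f x * ∑ k, pd k (pd k p) x := by
  rw [Finset.mul_sum, Finset.mul_sum, Finset.mul_sum, ← Finset.sum_add_distrib,
    ← Finset.sum_add_distrib]
  refine Finset.sum_congr rfl fun k _ => ?_
  have hev : pd k (fun y => p y * f y) =ᶠ[𝓝 x] fun y => p y * pd k f y + f y * pd k p y := by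
    filter_upwards [hΩ.mem_nhds hx] with y hy
    exact pd_mul k (hp y hy).differentiableAt_infty (hf y hy).differentiableAt_infty
  have h1 := (hp x hx).differentiableAt_infty
  have h2 := (hf x hx).differentiableAt_infty
  have h3 := ((hp x hx).pd k).differentiableAt_infty
  have h4 := ((hf x hx).pd k).differentiableAt_infty
  rw [pd_congr k hev, pd_add _ (h1.fun_mul h4) (h2.fun_mul h3), pd_mul _ h1 h4, pd_mul _ h2 h3]
  ring

/-! ### Homogeneous harmonic functions -/

/-- `f` is smooth, harmonic and homogeneous of degree `d` (in the sense of Euler's identity)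
on `Ω`. -/
structure HarmHom (Ω : Set E3) (d : ℤ) (f : E3 → ℂ) : Prop where
  contDiffAt : ∀ x ∈ Ω, ContDiffAt ℝ ∞ f x
  laplacian : ∀ x ∈ Ω, ∑ j, pd j (pd j f) x = 0
  euler : ∀ x ∈ Ω, ∑ j, (x j : ℂ) * pd j f x = d * f x

namespace HarmHom

variable {Ω : Set E3} {d : ℤ} {f g : E3 → ℂ}

lemma mono {Ω' : Set E3} (hf : HarmHom Ω d f) (h : Ω' ⊆ Ω) : HarmHom Ω' d f :=
  ⟨fun x hx => hf.contDiffAt x (h hx), fun x hx => hf.laplacian x (h hx),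
    fun x hx => hf.euler x (h hx)⟩

lemma diff (hf : HarmHom Ω d f) {x : E3} (hx : x ∈ Ω) : DifferentiableAt ℝ f x :=
  (hf.contDiffAt x hx).differentiableAt_infty

lemma congr (hΩ : IsOpen Ω) (hf : HarmHom Ω d f) (h : ∀ x ∈ Ω, g x = f x) : HarmHom Ω d g := by
  have hev : ∀ x ∈ Ω, g =ᶠ[𝓝 x] f := fun x hx => by
    filter_upwards [hΩ.mem_nhds hx] with y hy using h y hy
  have hpd : ∀ j, ∀ x ∈ Ω, ElasticPlasmon.pd j g =ᶠ[𝓝 x] ElasticPlasmon.pd j f := fun j x hx => by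
    filter_upwards [hΩ.mem_nhds hx] with y hy using pd_congr j (hev y hy)
  refine ⟨fun x hx => (hf.contDiffAt x hx).congr_of_eventuallyEq (hev x hx), fun x hx => ?_,
    fun x hx => ?_⟩
  · rw [← hf.laplacian x hx]
    exact Finset.sum_congr rfl fun j _ => pd_congr j (hpd j x hx)
  · rw [h x hx, ← hf.euler x hx]
    exact Finset.sum_congr rfl fun j _ => by rw [pd_congr j (hev x hx)]

lemma add (hΩ : IsOpen Ω) (hf : HarmHom Ω d f) (hg : HarmHom Ω d g) :
    HarmHom Ω d (fun x => f x + g x) := by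
  have hpd : ∀ j, ∀ x ∈ Ω, ElasticPlasmon.pd j (fun x => f x + g x) x =
      ElasticPlasmon.pd j f x + ElasticPlasmon.pd j g x :=
    fun j x hx => pd_add j (hf.diff hx) (hg.diff hx)
  refine ⟨fun x hx => (hf.contDiffAt x hx).add (hg.contDiffAt x hx), fun x hx => ?_,
    fun x hx => ?_⟩
  · have : ∀ j, ElasticPlasmon.pd j (ElasticPlasmon.pd j (fun x => f x + g x)) x =
        ElasticPlasmon.pd j (ElasticPlasmon.pd j f) x
          + ElasticPlasmon.pd j (ElasticPlasmon.pd j g) x := fun j => by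
      rw [← pd_add j ((hf.contDiffAt x hx).pd j).differentiableAt_infty
        ((hg.contDiffAt x hx).pd j).differentiableAt_infty]
      refine pd_congr j ?_
      filter_upwards [hΩ.mem_nhds hx] with y hy using hpd j y hy
    simp only [this, Finset.sum_add_distrib, hf.laplacian x hx, hg.laplacian x hx, add_zero]
  · simp only [hpd _ x hx, mul_add, Finset.sum_add_distrib, hf.euler x hx, hg.euler x hx]

lemma const_mul (hΩ : IsOpen Ω) (c : ℂ) (hf : HarmHom Ω d f) :
    HarmHom Ω d (fun x => c * f x) := by
  have hpd : ∀ j, ∀ x ∈ Ω, ElasticPlasmon.pd j (fun x => c * f x) x =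
      c * ElasticPlasmon.pd j f x := fun j x hx => pd_const_mul j c (hf.diff hx)
  refine ⟨fun x hx => contDiffAt_const.mul (hf.contDiffAt x hx), fun x hx => ?_, fun x hx => ?_⟩
  · have : ∀ j, ElasticPlasmon.pd j (ElasticPlasmon.pd j (fun x => c * f x)) x =
        c * ElasticPlasmon.pd j (ElasticPlasmon.pd j f) x := fun j => by
      rw [← pd_const_mul j c ((hf.contDiffAt x hx).pd j).differentiableAt_infty]
      refine pd_congr j ?_
      filter_upwards [hΩ.mem_nhds hx] with y hy using hpd j y hy
    simp only [this, ← Finset.mul_sum, hf.laplacian x hx, mul_zero]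
  · simp only [hpd _ x hx, mul_left_comm _ c, ← Finset.mul_sum, hf.euler x hx]

lemma zero : HarmHom Ω d (fun _ => 0) := by
  have h : ∀ j : Fin 3, ElasticPlasmon.pd j (fun _ : E3 => (0 : ℂ)) = fun _ => 0 := fun j => by
    ext x; exact pd_const j 0 x
  exact ⟨fun x _ => contDiffAt_const, fun x _ => by simp [h], fun x _ => by simp [h]⟩

lemma sum (hΩ : IsOpen Ω) {ι : Type*} (s : Finset ι) {F : ι → E3 → ℂ}
    (hF : ∀ i ∈ s, HarmHom Ω d (F i)) : HarmHom Ω d (fun x => ∑ i ∈ s, F i x) := by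
  classical
  induction s using Finset.induction_on with
  | empty => simpa using zero
  | insert i s hi ih =>
    simp only [Finset.sum_insert hi]
    exact (hF i (Finset.mem_insert_self i s)).add hΩ
      (ih fun k hk => hF k (Finset.mem_insert_of_mem hk))

/-- Differentiating Euler's identity, the factor `x_j` gives back one copy of `∂_i f`, which lowers
`d` by one. The derivatives are kept in the order in which they enter the tractions. -/
lemma euler_pd (hΩ : IsOpen Ω) (hf : HarmHom Ω d f) (i : Fin 3) {x : E3} (hx : x ∈ Ω) :
    ∑ j, (x j : ℂ) * ElasticPlasmon.pd i (ElasticPlasmon.pd j f) x =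
      (d - 1) * ElasticPlasmon.pd i f x := by
  have h1 : ElasticPlasmon.pd i (fun y => ∑ j, (y j : ℂ) * ElasticPlasmon.pd j f y) x =
      d * ElasticPlasmon.pd i f x := by
    rw [← pd_const_mul i (d : ℂ) (hf.diff hx)]
    refine pd_congr i ?_
    filter_upwards [hΩ.mem_nhds hx] with y hy using hf.euler y hy
  have hc := fun j => (contDiff_coord j).contDiffAt.differentiableAt_infty (x := x)
  have hp := fun j => ((hf.contDiffAt x hx).pd j).differentiableAt_infty
  rw [pd_sum _ _ fun j _ => (hc j).fun_mul (hp j)] at h1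
  simp only [pd_mul _ (hc _) (hp _), pd_coord, Finset.sum_add_distrib] at h1
  simp at h1
  linear_combination h1

lemma pd (hΩ : IsOpen Ω) (hf : HarmHom Ω d f) (i : Fin 3) :
    HarmHom Ω (d - 1) (ElasticPlasmon.pd i f) := by
  refine ⟨fun x hx => (hf.contDiffAt x hx).pd i, fun x hx => ?_, fun x hx => ?_⟩
  · have h1 : ∀ j, ElasticPlasmon.pd j (ElasticPlasmon.pd j (ElasticPlasmon.pd i f)) x =
        ElasticPlasmon.pd i (ElasticPlasmon.pd j (ElasticPlasmon.pd j f)) x := fun j => by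
      rw [pd_comm ((hf.contDiffAt x hx).pd j) i j]
      refine pd_congr j ?_
      filter_upwards [hΩ.mem_nhds hx] with y hy using pd_comm (hf.contDiffAt y hy) j i
    simp only [h1]
    rw [← pd_sum _ _ fun j _ => (((hf.contDiffAt x hx).pd j).pd j).differentiableAt_infty,
      ← pd_const i 0 x]
    refine pd_congr i ?_
    filter_upwards [hΩ.mem_nhds hx] with y hy using hf.laplacian y hy
  · have h := hf.euler_pd hΩ i hx
    push_cast
    rw [← h]
    exact Finset.sum_congr rfl fun j _ => by rw [pd_comm (hf.contDiffAt x hx)]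

/-- The Kelvin transform of a homogeneous harmonic function. -/
lemma kelvin {d : ℤ} {f : E3 → ℂ} (hf : HarmHom {0}ᶜ d f) :
    HarmHom {0}ᶜ (-d - 1) (fun x => (‖x‖ : ℂ) ^ (-2 * d - 1) * f x) := by
  have hΩ : IsOpen ({0}ᶜ : Set E3) := isOpen_compl_singleton
  -- For harmonic `f` of degree `d`, `Δ(r^m f) = m (m + 1 + 2d) r^(m-2) f`; this is the nontrivial
  -- exponent that makes it vanish.
  set m : ℤ := -2 * d - 1 with hm
  have hp : ∀ x ∈ ({0}ᶜ : Set E3), ContDiffAt ℝ ∞ (fun y : E3 => (‖y‖ : ℂ) ^ m) x :=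
    fun x hx => contDiffAt_norm_zpow m hx
  have hsq : ∀ x ∈ ({0}ᶜ : Set E3), (‖x‖ : ℂ) ^ m = (‖x‖ : ℂ) ^ (m - 2) * (‖x‖ : ℂ) ^ 2 :=
    fun x hx => by
      have hr' : (‖x‖ : ℂ) ≠ 0 := by exact_mod_cast norm_ne_zero_iff.2 hx
      rw [← zpow_natCast, ← zpow_add₀ hr']
      congr 1
      push_cast
      ring
  refine ⟨fun x hx => (hp x hx).mul (hf.contDiffAt x hx), fun x hx => ?_, fun x hx => ?_⟩
  · rw [laplacian_mul hΩ hp hf.contDiffAt hx, hf.laplacian x hx]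
    have h1 : ∑ k, ElasticPlasmon.pd k (fun y : E3 => (‖y‖ : ℂ) ^ m) x * ElasticPlasmon.pd k f x =
        m * (‖x‖ : ℂ) ^ (m - 2) * (d * f x) := by
      rw [← hf.euler x hx, Finset.mul_sum]
      exact Finset.sum_congr rfl fun k _ => by rw [pd_norm_zpow k m hx]; ring
    have h2 : ∑ k, ElasticPlasmon.pd k (ElasticPlasmon.pd k (fun y : E3 => (‖y‖ : ℂ) ^ m)) x =
        m * (m + 1) * (‖x‖ : ℂ) ^ (m - 2) := by
      have h3 : ∀ k : Fin 3, ElasticPlasmon.pd k (ElasticPlasmon.pd k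
          (fun y : E3 => (‖y‖ : ℂ) ^ m)) x = m * (‖x‖ : ℂ) ^ (m - 2)
            + m * (m - 2) * (‖x‖ : ℂ) ^ (m - 2 - 2) * ((x k : ℂ) * (x k : ℂ)) := fun k => by
        have hev : ElasticPlasmon.pd k (fun y : E3 => (‖y‖ : ℂ) ^ m) =ᶠ[𝓝 x]
            fun y => m * ((‖y‖ : ℂ) ^ (m - 2) * (y k : ℂ)) := by
          filter_upwards [hΩ.mem_nhds hx] with y hy
          rw [pd_norm_zpow k m hy, mul_assoc]
        have hd1 := (contDiffAt_norm_zpow (m - 2) hx).differentiableAt_infty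
        have hd2 := (contDiff_coord k).contDiffAt.differentiableAt_infty (x := x)
        rw [pd_congr k hev, pd_const_mul _ _ (hd1.fun_mul hd2), pd_mul _ hd1 hd2, pd_coord,
          pd_norm_zpow k _ hx]
        push_cast
        simp
        ring
      have hr' : (‖x‖ : ℂ) ≠ 0 := by exact_mod_cast norm_ne_zero_iff.2 hx
      simp only [h3, Finset.sum_add_distrib, ← Finset.mul_sum, ← norm_sq_eq_sum]
      have : (‖x‖ : ℂ) ^ (m - 2) = (‖x‖ : ℂ) ^ (m - 2 - 2) * (‖x‖ : ℂ) ^ 2 := by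
        rw [← zpow_natCast, ← zpow_add₀ hr']
        congr 1
        push_cast
        ring
      simp only [Finset.sum_const, Finset.card_univ, Fintype.card_fin, nsmul_eq_mul]
      rw [this]
      push_cast
      ring
    rw [h1, h2, hm]
    push_cast
    ring
  · have h : ∀ k : Fin 3, (x k : ℂ) * ElasticPlasmon.pd k (fun y : E3 => (‖y‖ : ℂ) ^ m * f y) x =
        (‖x‖ : ℂ) ^ m * ((x k : ℂ) * ElasticPlasmon.pd k f x)
          + m * f x * (‖x‖ : ℂ) ^ (m - 2) * ((x k : ℂ) * (x k : ℂ)) := fun k => by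
      rw [pd_mul _ (hp x hx).differentiableAt_infty (hf.diff hx), pd_norm_zpow k m hx]
      ring
    simp only [h, Finset.sum_add_distrib, ← Finset.mul_sum, ← norm_sq_eq_sum, hf.euler x hx]
    rw [hsq x hx, hm]
    push_cast
    ring

end HarmHom

lemma harmHom_solid (n m : ℤ) : HarmHom Set.univ n (solid n m) :=
  ⟨fun _ _ => (contDiff_solid n m).contDiffAt, fun x _ => laplacian_solid n m x,
    fun x _ => sum_mul_pd_solid n m x⟩

lemma harmHom_regY (n : ℕ) (a : Fin (2 * n + 1) → ℂ) :
    HarmHom Set.univ n (fun x => a ⬝ᵥ regY n x) := by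
  simp only [dotProduct, regY_eq]
  exact HarmHom.sum isOpen_univ _ fun i _ =>
    ((harmHom_solid _ _).const_mul isOpen_univ _).const_mul isOpen_univ _

lemma dotProduct_irrY (n : ℕ) (a : Fin (2 * n + 1) → ℂ) {x : E3} (hx : x ≠ 0) :
    a ⬝ᵥ irrY n x = (‖x‖ : ℂ) ^ (-2 * (n : ℤ) - 1) * (a ⬝ᵥ regY n x) := by
  rw [irrY_eq_regY n hx, dotProduct_smul, smul_eq_mul,
    show (-2 * (n : ℤ) - 1) = -((2 * n + 1 : ℕ) : ℤ) by push_cast; ring, zpow_neg, zpow_natCast]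

lemma harmHom_irrY (n : ℕ) (a : Fin (2 * n + 1) → ℂ) :
    HarmHom {0}ᶜ (-n - 1) (fun x => a ⬝ᵥ irrY n x) :=
  (((harmHom_regY n a).mono (Set.subset_univ _)).kelvin).congr isOpen_compl_singleton
    fun _ hx => dotProduct_irrY n a hx

lemma pd_dotProduct_lowerD (j : Fin 3) (n : ℕ) (a : Fin (2 * (n + 1) + 1) → ℂ) (x : E3) :
    pd j (fun y => a ⬝ᵥ regY (n + 1) y) x = (a ᵥ* lowerD n j) ⬝ᵥ regY n x := by
  rw [pd_dotProduct_regY, ← Matrix.dotProduct_mulVec]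
  simp only [lowerD_spec, dotProduct]

lemma pd_dotProduct_Dup (j : Fin 3) (n : ℕ) (a : Fin (2 * n + 1) → ℂ) {x : E3} (hx : x ≠ 0) :
    pd j (fun y => a ⬝ᵥ irrY n y) x = (a ᵥ* Dup n j) ⬝ᵥ irrY (n + 1) x := by
  have hd : ∀ i, DifferentiableAt ℝ (fun y => irrY n y i) x := fun i => by
    have := (harmHom_irrY n (Pi.single i 1)).diff (x := x) hx
    simpa using this
  rw [← Matrix.dotProduct_mulVec]
  simp only [dotProduct]
  rw [pd_sum _ _ fun i _ => (hd i).const_mul _]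
  exact Finset.sum_congr rfl fun i _ => by rw [pd_const_mul _ _ (hd i), Dup_spec n j hx]

/-! ### Lamé fields obtained from harmonic vector fields -/

/-- The field `g + M (r² - R²) ∇(∇ · g)`, which agrees with `g` on the sphere of radius `R`. -/
def corrField (R : ℝ) (M : ℂ) (g : E3 → Fin 3 → ℂ) (x : E3) : Fin 3 → ℂ := fun i =>
  g x i + M * (((‖x‖ : ℂ) ^ 2 - (R : ℂ) ^ 2) * pd i (divergence g) x)

lemma divergence_congr {u v : E3 → Fin 3 → ℂ} {x : E3} (h : u =ᶠ[𝓝 x] v) :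
    divergence u x = divergence v x :=
  Finset.sum_congr rfl fun j _ => pd_congr j (h.mono fun _ hy => congrFun hy j)

lemma traction_congr (lam mu : ℝ) {u v : E3 → Fin 3 → ℂ} (ν : E3) {x : E3} (h : u =ᶠ[𝓝 x] v) :
    traction lam mu u ν x = traction lam mu v ν x := by
  have hc : ∀ i j : Fin 3, pd j (fun y => u y i) x = pd j (fun y => v y i) x := fun i j =>
    pd_congr j (h.mono fun _ hy => congrFun hy i)
  ext i
  simp only [traction, divergence_congr h, hc]

lemma lameOp_congr (lam mu : ℝ) {u v : E3 → Fin 3 → ℂ} {x : E3} (h : u =ᶠ[𝓝 x] v) :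
    lameOp lam mu u x = lameOp lam mu v x := by
  have hd : divergence u =ᶠ[𝓝 x] divergence v :=
    h.eventually_nhds.mono fun _ hy => divergence_congr hy
  have hc : ∀ i j : Fin 3, pd j (pd j (fun y => u y i)) x = pd j (pd j (fun y => v y i)) x :=
    fun i j => pd_congr j (h.eventually_nhds.mono fun _ hy =>
      pd_congr j (hy.mono fun _ hz => congrFun hz i))
  ext i
  simp only [lameOp, hc, pd_congr i hd]

lemma lameOp_smul (c lam mu : ℝ) (u : E3 → Fin 3 → ℂ) (x : E3) :
    lameOp (c * lam) (c * mu) u x = (c : ℂ) • lameOp lam mu u x := by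
  ext i
  simp only [lameOp, Pi.smul_apply, smul_eq_mul]
  push_cast
  ring

lemma traction_smul (c lam mu : ℝ) (u : E3 → Fin 3 → ℂ) (ν x : E3) :
    traction (c * lam) (c * mu) u ν x = (c : ℂ) • traction lam mu u ν x := by
  ext i
  simp only [traction, Pi.smul_apply, smul_eq_mul]
  push_cast
  ring

lemma traction_add (lam mu : ℝ) {u v : E3 → Fin 3 → ℂ} (ν : E3) {x : E3}
    (hu : ∀ i, DifferentiableAt ℝ (fun y => u y i) x)
    (hv : ∀ i, DifferentiableAt ℝ (fun y => v y i) x) :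
    traction lam mu (fun y => u y + v y) ν x = traction lam mu u ν x + traction lam mu v ν x := by
  ext i
  simp only [traction, divergence, Pi.add_apply, pd_add _ (hu _) (hv _), Finset.sum_add_distrib,
    add_mul]
  ring

section VectorField

variable {Ω : Set E3} {d : ℤ} {g : E3 → Fin 3 → ℂ}

lemma harmHom_divergence (hΩ : IsOpen Ω) (hg : ∀ i, HarmHom Ω d (fun x => g x i)) :
    HarmHom Ω (d - 1) (divergence g) :=
  HarmHom.sum hΩ _ fun j _ => (hg j).pd hΩ j

lemma contDiffAt_corrField (R : ℝ) (M : ℂ) (hΩ : IsOpen Ω)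
    (hg : ∀ i, HarmHom Ω d (fun x => g x i)) (i : Fin 3) {x : E3} (hx : x ∈ Ω) :
    ContDiffAt ℝ ∞ (fun y => corrField R M g y i) x :=
  ((hg i).contDiffAt x hx).add (contDiffAt_const.mul
    ((contDiff_norm_sq.contDiffAt.sub contDiffAt_const).mul
      (((harmHom_divergence hΩ hg).contDiffAt x hx).pd i)))

lemma pd_norm_sq_sub (j : Fin 3) (R : ℝ) (x : E3) :
    pd j (fun y : E3 => (‖y‖ : ℂ) ^ 2 - (R : ℂ) ^ 2) x = 2 * (x j : ℂ) := by
  rw [pd_sub _ contDiff_norm_sq.contDiffAt.differentiableAt_infty (differentiableAt_const _),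
    pd_norm_sq, pd_const, sub_zero]

lemma pd_corrField (R : ℝ) (M : ℂ) (hΩ : IsOpen Ω) (hg : ∀ i, HarmHom Ω d (fun x => g x i))
    (k i : Fin 3) {x : E3} (hx : x ∈ Ω) :
    pd k (fun y => corrField R M g y i) x = pd k (fun y => g y i) x
      + M * (((‖x‖ : ℂ) ^ 2 - (R : ℂ) ^ 2) * pd k (pd i (divergence g)) x
        + pd i (divergence g) x * (2 * (x k : ℂ))) := by
  have h1 := (hg i).diff hx
  have h2 : DifferentiableAt ℝ (fun y : E3 => (‖y‖ : ℂ) ^ 2 - (R : ℂ) ^ 2) x :=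
    contDiff_norm_sq.contDiffAt.differentiableAt_infty.sub_const _
  have h3 := ((harmHom_divergence hΩ hg).pd hΩ i).diff hx
  simp only [corrField]
  rw [pd_add _ h1 ((h2.fun_mul h3).const_mul M), pd_const_mul _ _ (h2.fun_mul h3),
    pd_mul _ h2 h3, pd_norm_sq_sub]

/-- Since `∇(∇ · g)` is itself divergence free, only the derivative `2x` of `r²` acts, and `x · ∇(∇
· g) = (d-1) ∇ · g` by Euler's identity. -/
lemma divergence_corrField (R : ℝ) (M : ℂ) (hΩ : IsOpen Ω)
    (hg : ∀ i, HarmHom Ω d (fun x => g x i)) {x : E3} (hx : x ∈ Ω) :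
    divergence (corrField R M g) x = (1 + 2 * M * (d - 1)) * divergence g x := by
  have hh := harmHom_divergence hΩ hg
  have h1 := hh.laplacian x hx
  have h2 := hh.euler x hx
  rw [divergence]
  simp only [pd_corrField R M hΩ hg _ _ hx, Finset.sum_add_distrib, ← Finset.mul_sum, h1]
  have h3 : ∑ k, pd k (divergence g) x * (2 * (x k : ℂ)) =
      2 * ∑ k, (x k : ℂ) * pd k (divergence g) x := by
    rw [Finset.mul_sum]
    exact Finset.sum_congr rfl fun k _ => by ring
  rw [h3, h2, divergence]
  push_cast
  ring

/-- For `h` harmonic of degree `d - 2`, `Δ((r² - R²) h) = (6 + 4(d-2)) h`. -/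
lemma laplacian_corrField (R : ℝ) (M : ℂ) (hΩ : IsOpen Ω)
    (hg : ∀ i, HarmHom Ω d (fun x => g x i)) (i : Fin 3) {x : E3} (hx : x ∈ Ω) :
    ∑ j, pd j (pd j (fun y => corrField R M g y i)) x =
      M * (4 * d - 2) * pd i (divergence g) x := by
  have hψ := (harmHom_divergence hΩ hg).pd hΩ i
  have hN : ∀ x ∈ Ω, ContDiffAt ℝ ∞ (fun y : E3 => (‖y‖ : ℂ) ^ 2 - (R : ℂ) ^ 2) x :=
    fun x _ => contDiff_norm_sq.contDiffAt.sub contDiffAt_const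
  have hprod : ∀ y ∈ Ω, ContDiffAt ℝ ∞
      (fun y : E3 => ((‖y‖ : ℂ) ^ 2 - (R : ℂ) ^ 2) * pd i (divergence g) y) y :=
    fun y hy => (hN y hy).mul (hψ.contDiffAt y hy)
  have h1 : ∀ j, pd j (pd j (fun y => corrField R M g y i)) x =
      pd j (pd j (fun y => g y i)) x + M * pd j (pd j
        (fun y : E3 => ((‖y‖ : ℂ) ^ 2 - (R : ℂ) ^ 2) * pd i (divergence g) y)) x := fun j => by
    rw [← pd_const_mul j M ((hprod x hx).pd j).differentiableAt_infty,
      ← pd_add j (((hg i).contDiffAt x hx).pd j).differentiableAt_infty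
        (((hprod x hx).pd j).differentiableAt_infty.const_mul M)]
    refine pd_congr j ?_
    filter_upwards [hΩ.mem_nhds hx] with y hy
    rw [← pd_const_mul j M (hprod y hy).differentiableAt_infty,
      ← pd_add j ((hg i).diff hy) ((hprod y hy).differentiableAt_infty.const_mul M)]
    rfl
  have h2 : ∀ j : Fin 3, pd j (pd j (fun y : E3 => (‖y‖ : ℂ) ^ 2 - (R : ℂ) ^ 2)) x = 2 := by
    intro j
    have : pd j (fun y : E3 => (‖y‖ : ℂ) ^ 2 - (R : ℂ) ^ 2) = fun y => 2 * (y j : ℂ) := by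
      ext y; exact pd_norm_sq_sub j R y
    rw [this, pd_const_mul _ _ (contDiff_coord j).contDiffAt.differentiableAt_infty, pd_coord]
    simp
  have h3 := hψ.euler x hx
  simp only [h1, Finset.sum_add_distrib, ← Finset.mul_sum, (hg i).laplacian x hx]
  rw [laplacian_mul hΩ hN hψ.contDiffAt hx, hψ.laplacian x hx]
  simp only [h2, pd_norm_sq_sub, mul_assoc, ← Finset.mul_sum, h3]
  simp only [Finset.sum_const, Finset.card_univ, Fintype.card_fin, nsmul_eq_mul]
  push_cast
  ring

/-- Both terms of the Lamé operator are multiples of `∇(∇ · g)`, and `hM` says that the total factor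
is zero. It is this equation that determines `M_n` (for `d = n`) and `k_n` (for `d = -n-1`). -/
lemma lameOp_corrField {lam mu : ℝ} (R : ℝ) {M : ℂ} (hΩ : IsOpen Ω)
    (hg : ∀ i, HarmHom Ω d (fun x => g x i))
    (hM : (mu : ℂ) * (M * (4 * d - 2)) + (lam + mu) * (1 + 2 * M * (d - 1)) = 0)
    {x : E3} (hx : x ∈ Ω) : lameOp lam mu (corrField R M g) x = 0 := by
  ext i
  have h1 : pd i (divergence (corrField R M g)) x =
      (1 + 2 * M * (d - 1)) * pd i (divergence g) x := by
    rw [← pd_const_mul i _ ((harmHom_divergence hΩ hg).diff hx)]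
    refine pd_congr i ?_
    filter_upwards [hΩ.mem_nhds hx] with y hy using divergence_corrField R M hΩ hg hy
  rw [lameOp, laplacian_corrField R M hΩ hg i hx, h1]
  simp only [Pi.zero_apply]
  push_cast
  linear_combination pd i (divergence g) x * hM

/-- On the sphere `r² - R²` is zero, so second derivatives of the divergence drop out. Euler's
identity evaluates the radial derivatives of `g` and of its divergence; only the transposed gradient
term is left as a sum. -/
lemma traction_corrField (lam mu : ℝ) {R : ℝ} (M : ℂ) (hΩ : IsOpen Ω)
    (hg : ∀ i, HarmHom Ω d (fun x => g x i)) {x : E3} (hx : x ∈ Ω) (hxR : ‖x‖ = R) (i : Fin 3) :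
    traction lam mu (corrField R M g) (R⁻¹ • x) x i = (R : ℂ)⁻¹ *
      ((lam * (1 + 2 * M * (d - 1)) + 2 * mu * M * (d - 1)) * ((x i : ℂ) * divergence g x)
        + mu * (d * g x i + 2 * M * ((‖x‖ : ℂ) ^ 2 * pd i (divergence g) x)
          + ∑ j, (x j : ℂ) * pd i (fun y => g y j) x)) := by
  have hν : ∀ j, (((R⁻¹ • x) j : ℝ) : ℂ) = (R : ℂ)⁻¹ * (x j : ℂ) := fun j => by
    simp
  have h1 := (hg i).euler x hx
  have h2 := (harmHom_divergence hΩ hg).euler x hx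
  have h3 := norm_sq_eq_sum x
  rw [traction, divergence_corrField R M hΩ hg hx]
  simp only [hν, pd_corrField R M hΩ hg _ _ hx, hxR, sub_self, zero_mul, zero_add]
  rw [hxR] at h3
  simp only [Fin.sum_univ_three] at h1 h2 h3 ⊢
  rw [← h1, h3]
  push_cast at h2
  linear_combination 2 * mu * M * (R : ℂ)⁻¹ * (x i : ℂ) * h2

lemma divergence_eq_zero_pd (hΩ : IsOpen Ω) (h : ∀ x ∈ Ω, divergence g x = 0) (i : Fin 3) {x : E3}
    (hx : x ∈ Ω) : pd i (divergence g) x = 0 := by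
  rw [← pd_const i 0 x]
  refine pd_congr i ?_
  filter_upwards [hΩ.mem_nhds hx] with y hy using h y hy

/-- The field in `hgp` is `r^(2d+1) ∇(r^(1-2d) p)`, a power of `r` times the gradient of the Kelvin
transform of `p`. This is what a gradient becomes when its coefficient matrix is used on the other
side of the sphere. -/
lemma pd_kelvinGradient (hΩ : IsOpen Ω) {p : E3 → ℂ} (hp : HarmHom Ω (d - 1) p)
    (hgp : ∀ x ∈ Ω, ∀ i, g x i = (‖x‖ : ℂ) ^ 2 * pd i p x - (2 * d - 1) * ((x i : ℂ) * p x))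
    (i k : Fin 3) {x : E3} (hx : x ∈ Ω) : pd k (fun y => g y i) x =
      (‖x‖ : ℂ) ^ 2 * pd k (pd i p) x + pd i p x * (2 * (x k : ℂ))
        - (2 * d - 1) * ((x i : ℂ) * pd k p x + p x * (if k = i then 1 else 0)) := by
  have h1 : DifferentiableAt ℝ (fun y : E3 => (‖y‖ : ℂ) ^ 2) x :=
    contDiff_norm_sq.contDiffAt.differentiableAt_infty
  have h2 := (hp.pd hΩ i).diff hx
  have h3 := (contDiff_coord i).contDiffAt.differentiableAt_infty (x := x)
  have h4 := hp.diff hx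
  rw [← pd_norm_sq, ← pd_coord, ← pd_mul _ h1 h2, ← pd_mul _ h3 h4,
    ← pd_const_mul _ _ (h3.fun_mul h4), ← pd_sub _ (h1.fun_mul h2) ((h3.fun_mul h4).const_mul _)]
  refine pd_congr k ?_
  filter_upwards [hΩ.mem_nhds hx] with y hy using hgp y hy i

lemma divergence_kelvinGradient (hΩ : IsOpen Ω) {p : E3 → ℂ} (hp : HarmHom Ω (d - 1) p)
    (hgp : ∀ x ∈ Ω, ∀ i, g x i = (‖x‖ : ℂ) ^ 2 * pd i p x - (2 * d - 1) * ((x i : ℂ) * p x))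
    {x : E3} (hx : x ∈ Ω) : divergence g x = -(d * (2 * d + 1)) * p x := by
  have h1 := hp.laplacian x hx
  have h2 := hp.euler x hx
  have h3 : divergence g x = ∑ j, pd j (fun y => g y j) x := rfl
  rw [h3]
  simp only [pd_kelvinGradient hΩ hp hgp _ _ hx, if_true]
  simp only [Fin.sum_univ_three] at h1 h2 ⊢
  push_cast at h2
  linear_combination (‖x‖ : ℂ) ^ 2 * h1 + (2 - (2 * d - 1)) * h2

lemma divergence_gradient (hΩ : IsOpen Ω) {e : ℤ} {p : E3 → ℂ} (hp : HarmHom Ω e p)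
    (hgp : ∀ x ∈ Ω, ∀ i, g x i = pd i p x) {x : E3} (hx : x ∈ Ω) : divergence g x = 0 := by
  rw [← hp.laplacian x hx]
  refine Finset.sum_congr rfl fun j _ => pd_congr j ?_
  filter_upwards [hΩ.mem_nhds hx] with y hy using hgp y hy j

/-- The traction of a toroidal field. -/
lemma traction_toroidal (lam mu : ℝ) {R : ℝ} (M : ℂ) (hΩ : IsOpen Ω)
    (hg : ∀ i, HarmHom Ω d (fun x => g x i)) (hdiv : ∀ x ∈ Ω, divergence g x = 0)
    (hrad : ∀ x ∈ Ω, ∑ j, (x j : ℂ) * g x j = 0) {x : E3} (hx : x ∈ Ω) (hxR : ‖x‖ = R) :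
    traction lam mu (corrField R M g) (R⁻¹ • x) x = ((R : ℂ)⁻¹ * (mu * (d - 1))) • g x := by
  ext i
  rw [traction_corrField lam mu M hΩ hg hx hxR, hdiv x hx, divergence_eq_zero_pd hΩ hdiv i hx]
  -- Differentiating `x · g = 0` gives `∑ x_j ∂_i g_j = -g_i`, which turns the factor `d` into `d -
  -- 1`.
  have h1 : pd i (fun y => ∑ j, (y j : ℂ) * g y j) x = 0 := by
    rw [← pd_const i 0 x]
    refine pd_congr i ?_
    filter_upwards [hΩ.mem_nhds hx] with y hy using hrad y hy
  have hc := fun j => (contDiff_coord j).contDiffAt.differentiableAt_infty (x := x)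
  rw [pd_sum _ _ fun j _ => (hc j).fun_mul ((hg j).diff hx)] at h1
  simp only [pd_mul _ (hc _) ((hg _).diff hx), pd_coord, Finset.sum_add_distrib] at h1
  simp at h1
  rw [Pi.smul_apply, smul_eq_mul]
  linear_combination (R : ℂ)⁻¹ * mu * h1

/-- The traction of a harmonic gradient field. -/
lemma traction_gradient (lam mu : ℝ) {R : ℝ} (M : ℂ) (hΩ : IsOpen Ω)
    (hg : ∀ i, HarmHom Ω d (fun x => g x i)) {p : E3 → ℂ} (hp : HarmHom Ω (d + 1) p)
    (hgp : ∀ x ∈ Ω, ∀ i, g x i = pd i p x) {x : E3} (hx : x ∈ Ω) (hxR : ‖x‖ = R) :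
    traction lam mu (corrField R M g) (R⁻¹ • x) x = ((R : ℂ)⁻¹ * (mu * (2 * d))) • g x := by
  have hpd : ∀ i k : Fin 3, ∀ x ∈ Ω, pd k (fun y => g y i) x = pd k (pd i p) x :=
    fun i k x hx => pd_congr k (by
      filter_upwards [hΩ.mem_nhds hx] with y hy using hgp y hy i)
  have hdiv : ∀ x ∈ Ω, divergence g x = 0 := fun x hx => divergence_gradient hΩ hp hgp hx
  ext i
  rw [traction_corrField lam mu M hΩ hg hx hxR, hdiv x hx, divergence_eq_zero_pd hΩ hdiv i hx]
  -- For a gradient the gradient matrix is symmetric, so the transposed term contributes a second `d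
  -- g`.
  have h1 := hp.euler_pd hΩ i hx
  simp only [hpd _ _ x hx, h1, ← hgp x hx i]
  rw [Pi.smul_apply, smul_eq_mul]
  push_cast
  ring

/-- The traction of the field `r² ∇p - (2d - 1) p x`. -/
lemma traction_kelvinGradient {lam mu R : ℝ} {M : ℂ} (hΩ : IsOpen Ω)
    (hg : ∀ i, HarmHom Ω d (fun x => g x i)) {p : E3 → ℂ} (hp : HarmHom Ω (d - 1) p)
    (hgp : ∀ x ∈ Ω, ∀ i, g x i = (‖x‖ : ℂ) ^ 2 * pd i p x - (2 * d - 1) * ((x i : ℂ) * p x))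
    (hM : (mu : ℂ) * (M * (4 * d - 2)) + (lam + mu) * (1 + 2 * M * (d - 1)) = 0)
    {x : E3} (hx : x ∈ Ω) (hxR : ‖x‖ = R) :
    traction lam mu (corrField R M g) (R⁻¹ • x) x =
      ((R : ℂ)⁻¹ * (-mu * (1 + 2 * M * d * (2 * d + 1)))) • g x := by
  have hpd := fun i k : Fin 3 => pd_kelvinGradient hΩ hp hgp i k hx
  have hdiv : ∀ x ∈ Ω, divergence g x = -(d * (2 * d + 1)) * p x :=
    fun x hx => divergence_kelvinGradient hΩ hp hgp hx
  have hpdiv : ∀ i, pd i (divergence g) x = -(d * (2 * d + 1)) * pd i p x := fun i => by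
    rw [← pd_const_mul _ _ (hp.diff hx)]
    refine pd_congr i ?_
    filter_upwards [hΩ.mem_nhds hx] with y hy using hdiv y hy
  ext i
  have h1 := hp.euler_pd hΩ i hx
  have h2 := hp.euler x hx
  have h3 := norm_sq_eq_sum x
  have hs : ∑ j, (x j : ℂ) * pd i (fun y => g y j) x =
      -((x i : ℂ) * p x) - (d + 1) * ((‖x‖ : ℂ) ^ 2 * pd i p x) := by
    have e1 : ∑ j, (x j : ℂ) * pd i (fun y => g y j) x =
        (‖x‖ : ℂ) ^ 2 * (∑ j, (x j : ℂ) * pd i (pd j p) x)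
          + 2 * (x i : ℂ) * (∑ j, (x j : ℂ) * pd j p x)
          - (2 * d - 1) * ((∑ j, (x j : ℂ) * (x j : ℂ)) * pd i p x
            + p x * ∑ j, (x j : ℂ) * (if i = j then 1 else 0)) := by
      simp only [hpd, Fin.sum_univ_three]
      ring
    rw [e1, h1, h2, ← h3]
    simp only [mul_ite, mul_one, mul_zero, Finset.sum_ite_eq, Finset.mem_univ, if_true]
    push_cast
    ring
  rw [traction_corrField lam mu M hΩ hg hx hxR, hdiv x hx, hpdiv, hs, Pi.smul_apply, smul_eq_mul,
    hgp x hx i]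
  -- The traction is a combination of `x_i p` and `r² ∂_i p`. The Lamé condition `hM` is what puts
  -- their coefficients in the ratio they have in `g`, so that the field is an eigenvector.
  linear_combination (-(R : ℂ)⁻¹ * d * (2 * d + 1) * (x i : ℂ) * p x) * hM

end VectorField

/-! ### Harmonic fields with coefficient matrix `G` and the decomposition of coefficient space -/

/-- `G r^n Y_n` as a vector field. -/
def regField {n : ℕ} (G : Coeff n) (x : E3) : Fin 3 → ℂ := G *ᵥ regY n x

/-- `G r^(-n-1) Y_n` as a vector field. -/
def irrField {n : ℕ} (G : Coeff n) (x : E3) : Fin 3 → ℂ := G *ᵥ irrY n x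

lemma harmHom_regField {n : ℕ} (G : Coeff n) (i : Fin 3) :
    HarmHom Set.univ n (fun x => regField G x i) := harmHom_regY n (G i)

lemma harmHom_irrField {n : ℕ} (G : Coeff n) (i : Fin 3) :
    HarmHom {0}ᶜ (-n - 1) (fun x => irrField G x i) := harmHom_irrY n (G i)

lemma irrField_eq {n : ℕ} (G : Coeff n) {x : E3} (hx : x ≠ 0) (i : Fin 3) :
    irrField G x i = (‖x‖ : ℂ) ^ (-2 * (n : ℤ) - 1) * regField G x i :=
  dotProduct_irrY n (G i) hx

/-- `tThree` as a linear map, with its index set in simplified form. -/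
def lowerT (k : ℕ) : Coeff (k + 1) →ₗ[ℂ] (Fin (2 * k + 1) → ℂ) where
  toFun G := ∑ j, (G j) ᵥ* (lowerD k j)
  map_add' G H := by
    simp only [← Finset.sum_add_distrib]
    exact Finset.sum_congr rfl fun j _ => Matrix.add_vecMul _ _ _
  map_smul' c G := by
    simp only [Finset.smul_sum, RingHom.id_apply]
    exact Finset.sum_congr rfl fun j _ => Matrix.smul_vecMul c (G j) (lowerD k j)

/-- `tOne` as a linear map. -/
def raiseT (n : ℕ) : Coeff n →ₗ[ℂ] (Fin (2 * (n + 1) + 1) → ℂ) where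
  toFun G := ∑ j, (G j) ᵥ* (Dup n j)
  map_add' G H := by
    simp only [← Finset.sum_add_distrib]
    exact Finset.sum_congr rfl fun j _ => Matrix.add_vecMul _ _ _
  map_smul' c G := by
    simp only [Finset.smul_sum, RingHom.id_apply]
    exact Finset.sum_congr rfl fun j _ => Matrix.smul_vecMul c (G j) (Dup n j)

/-- This and the next lemma give `t³` and `t¹` their meaning: their vanishing says that the regular,
respectively the decaying, field with matrix `G` is solenoidal. -/
lemma divergence_regField {k : ℕ} (G : Coeff (k + 1)) (x : E3) :
    divergence (regField G) x = lowerT k G ⬝ᵥ regY k x := by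
  change ∑ j, pd j (fun y => G j ⬝ᵥ regY (k + 1) y) x = (∑ j, (G j) ᵥ* (lowerD k j)) ⬝ᵥ regY k x
  rw [sum_dotProduct]
  exact Finset.sum_congr rfl fun j _ => pd_dotProduct_lowerD j k (G j) x

lemma divergence_irrField {n : ℕ} (G : Coeff n) {x : E3} (hx : x ≠ 0) :
    divergence (irrField G) x = raiseT n G ⬝ᵥ irrY (n + 1) x := by
  change ∑ j, pd j (fun y => G j ⬝ᵥ irrY n y) x = (∑ j, (G j) ᵥ* (Dup n j)) ⬝ᵥ irrY (n + 1) x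
  rw [sum_dotProduct]
  exact Finset.sum_congr rfl fun j _ => pd_dotProduct_Dup j n (G j) hx

/-- The coefficients of the gradient of a decaying harmonic function of degree `-k-1`. -/
def gradUp (k : ℕ) : (Fin (2 * k + 1) → ℂ) →ₗ[ℂ] Coeff (k + 1) where
  toFun a := fun j => a ᵥ* Dup k j
  map_add' a b := by exact funext fun j => Matrix.add_vecMul (Dup k j) a b
  map_smul' c a := by exact funext fun j => Matrix.smul_vecMul c a (Dup k j)

/-- The coefficients of the gradient of a regular harmonic function of degree `n+1`. -/
def gradDown (n : ℕ) : (Fin (2 * (n + 1) + 1) → ℂ) →ₗ[ℂ] Coeff n where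
  toFun b := fun j => b ᵥ* lowerD n j
  map_add' a b := by exact funext fun j => Matrix.add_vecMul (lowerD n j) a b
  map_smul' c a := by exact funext fun j => Matrix.smul_vecMul c a (lowerD n j)

lemma irrField_gradUp (k : ℕ) (a : Fin (2 * k + 1) → ℂ) {x : E3} (hx : x ≠ 0) (i : Fin 3) :
    irrField (gradUp k a) x i = pd i (fun y => a ⬝ᵥ irrY k y) x :=
  (pd_dotProduct_Dup i k a hx).symm

lemma regField_gradDown (n : ℕ) (b : Fin (2 * (n + 1) + 1) → ℂ) (x : E3) (i : Fin 3) :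
    regField (gradDown n b) x i = pd i (fun y => b ⬝ᵥ regY (n + 1) y) x :=
  (pd_dotProduct_lowerD i n b x).symm

lemma pd_norm_zpow_mul (i : Fin 3) (m : ℤ) {f : E3 → ℂ} {x : E3} (hx : x ≠ 0)
    (hf : DifferentiableAt ℝ f x) :
    pd i (fun y => (‖y‖ : ℂ) ^ m * f y) x =
      (‖x‖ : ℂ) ^ (m - 2) * ((‖x‖ : ℂ) ^ 2 * pd i f x + m * ((x i : ℂ) * f x)) := by
  have hr' : (‖x‖ : ℂ) ≠ 0 := by exact_mod_cast norm_ne_zero_iff.2 hx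
  have : (‖x‖ : ℂ) ^ m = (‖x‖ : ℂ) ^ (m - 2) * (‖x‖ : ℂ) ^ 2 := by
    rw [← zpow_natCast, ← zpow_add₀ hr']
    congr 1
    push_cast
    ring
  rw [pd_mul _ (contDiffAt_norm_zpow m hx).differentiableAt_infty hf, pd_norm_zpow i m hx, this]
  ring

/-- With `P` the polynomial `a · r^k Y_k`, `∇(r^(-2k-1) P) = r^(-2k-3) (r² ∇P - (2k+1) P x)`;
multiplying by `r^(2k+3)` passes to the regular field with the same matrix. -/
lemma regField_gradUp (k : ℕ) (a : Fin (2 * k + 1) → ℂ) {x : E3} (hx : x ≠ 0) (i : Fin 3) :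
    regField (gradUp k a) x i = (‖x‖ : ℂ) ^ 2 * pd i (fun y => a ⬝ᵥ regY k y) x
      - (2 * ((k + 1 : ℕ) : ℤ) - 1) * ((x i : ℂ) * (a ⬝ᵥ regY k x)) := by
  have hr' : (‖x‖ : ℂ) ≠ 0 := by exact_mod_cast norm_ne_zero_iff.2 hx
  have h1 := irrField_gradUp k a hx i
  have hev : (fun y => a ⬝ᵥ irrY k y) =ᶠ[𝓝 x]
      fun y => (‖y‖ : ℂ) ^ (-2 * (k : ℤ) - 1) * (a ⬝ᵥ regY k y) := by
    filter_upwards [isOpen_ne.mem_nhds hx] with y hy using dotProduct_irrY k a hy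
  rw [irrField_eq _ hx, pd_congr i hev,
    pd_norm_zpow_mul i _ hx ((harmHom_regY k a).diff (Set.mem_univ x)),
    show -2 * ((k + 1 : ℕ) : ℤ) - 1 = -2 * (k : ℤ) - 1 - 2 by push_cast; ring] at h1
  rw [mul_left_cancel₀ (zpow_ne_zero _ hr') h1]
  push_cast
  ring

/-- The mirror image of `regField_gradUp`, with `d = -n-1` in place of `k + 1`: a regular gradient,
moved to the decaying side, acquires the Kelvin form. -/
lemma irrField_gradDown (n : ℕ) (b : Fin (2 * (n + 1) + 1) → ℂ) {x : E3} (hx : x ≠ 0)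
    (i : Fin 3) :
    irrField (gradDown n b) x i = (‖x‖ : ℂ) ^ 2 * pd i (fun y => b ⬝ᵥ irrY (n + 1) y) x
      - (2 * ((-n - 1 : ℤ) : ℂ) - 1) * ((x i : ℂ) * (b ⬝ᵥ irrY (n + 1) x)) := by
  have hr' : (‖x‖ : ℂ) ≠ 0 := by exact_mod_cast norm_ne_zero_iff.2 hx
  have hev : (fun y => b ⬝ᵥ regY (n + 1) y) =ᶠ[𝓝 x]
      fun y => (‖y‖ : ℂ) ^ (2 * (n : ℤ) + 3) * (b ⬝ᵥ irrY (n + 1) y) := by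
    filter_upwards [isOpen_ne.mem_nhds hx] with y hy
    have hy' : (‖y‖ : ℂ) ≠ 0 := by exact_mod_cast norm_ne_zero_iff.2 hy
    rw [dotProduct_irrY (n + 1) b hy, ← mul_assoc, ← zpow_add₀ hy',
      show 2 * (n : ℤ) + 3 + (-2 * ((n + 1 : ℕ) : ℤ) - 1) = 0 by push_cast; ring, zpow_zero,
      one_mul]
  rw [irrField_eq _ hx, regField_gradDown, pd_congr i hev,
    pd_norm_zpow_mul i _ hx ((harmHom_irrY (n + 1) b).diff hx), ← mul_assoc, ← zpow_add₀ hr',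
    show -2 * (n : ℤ) - 1 + (2 * (n : ℤ) + 3 - 2) = 0 by ring, zpow_zero, one_mul]
  push_cast
  ring

/-- The divergence of a Kelvin gradient is `-d(2d+1) p`, here with `d = k + 1`. As the factor is
nonzero, `gradUp` is injective and `gradUp ∘ lowerT` is, after scaling, a projection. The three
following lemmas complete the table: a mixed composition is the divergence of a harmonic gradient,
hence zero. -/
lemma lowerT_gradUp (k : ℕ) (a : Fin (2 * k + 1) → ℂ) :
    lowerT k (gradUp k a) = (-(((k : ℂ) + 1) * (2 * k + 3))) • a := by
  refine sub_eq_zero.1 (eq_zero_of_dotProduct_regY k _ fun x hx => ?_)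
  have h := divergence_kelvinGradient (d := ((k + 1 : ℕ) : ℤ)) isOpen_compl_singleton
    (p := fun y => a ⬝ᵥ regY k y)
    (by simpa using (harmHom_regY k a).mono (Set.subset_univ ({0}ᶜ : Set E3)))
    (fun x hx i => regField_gradUp k a hx i) hx
  rw [divergence_regField] at h
  rw [sub_dotProduct, h, smul_dotProduct, smul_eq_mul]
  push_cast
  ring

lemma raiseT_gradUp (k : ℕ) (a : Fin (2 * k + 1) → ℂ) : raiseT (k + 1) (gradUp k a) = 0 := by
  refine eq_zero_of_dotProduct_irrY _ _ fun x hx => ?_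
  rw [← divergence_irrField _ hx]
  exact divergence_gradient isOpen_compl_singleton (harmHom_irrY k a)
    (fun x hx i => irrField_gradUp k a hx i) hx

lemma raiseT_gradDown (n : ℕ) (b : Fin (2 * (n + 1) + 1) → ℂ) :
    raiseT n (gradDown n b) = (-(((n : ℂ) + 1) * (2 * n + 1))) • b := by
  refine sub_eq_zero.1 (eq_zero_of_dotProduct_irrY _ _ fun x hx => ?_)
  have h := divergence_kelvinGradient (d := -n - 1) isOpen_compl_singleton
    (p := fun y => b ⬝ᵥ irrY (n + 1) y)
    (by
      have := harmHom_irrY (n + 1) b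
      rwa [show (-((n + 1 : ℕ) : ℤ) - 1) = -n - 1 - 1 by push_cast; ring] at this)
    (fun x hx i => irrField_gradDown n b hx i) hx
  rw [divergence_irrField _ hx] at h
  rw [sub_dotProduct, h, smul_dotProduct, smul_eq_mul]
  push_cast
  ring

lemma lowerT_gradDown (k : ℕ) (b : Fin (2 * (k + 1 + 1) + 1) → ℂ) :
    lowerT k (gradDown (k + 1) b) = 0 := by
  refine eq_zero_of_dotProduct_regY _ _ fun x _ => ?_
  rw [← divergence_regField]
  exact divergence_gradient isOpen_univ (harmHom_regY (k + 1 + 1) b)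
    (fun x _ i => regField_gradDown (k + 1) b x i) (Set.mem_univ x)

/-- Fields with `t¹ = 0` and `t³ = 0` are tangential. -/
lemma sum_mul_regField_eq_zero {k : ℕ} {G : Coeff (k + 1)} (h1 : raiseT (k + 1) G = 0)
    (h3 : lowerT k G = 0) (x : E3) : ∑ j, (x j : ℂ) * regField G x j = 0 := by
  rcases eq_or_ne x 0 with rfl | hx
  · simp
  have hr' : (‖x‖ : ℂ) ≠ 0 := by exact_mod_cast norm_ne_zero_iff.2 hx
  have h := divergence_irrField G hx
  have hd := divergence_regField G x
  rw [h3, zero_dotProduct] at hd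
  rw [h1, zero_dotProduct] at h
  -- The decaying field is `r^m` times the regular one with `m = -2(k+1) - 1`, and `∇ · (r^m g) =
  -- r^m ∇ · g + m r^(m-2) x · g`. Both divergences vanish and `m ≠ 0`, so `x · g = 0`.
  have hpd : ∀ j, pd j (fun y => irrField G y j) x = (‖x‖ : ℂ) ^ (-2 * ((k + 1 : ℕ) : ℤ) - 1 - 2) *
      ((‖x‖ : ℂ) ^ 2 * pd j (fun y => regField G y j) x
        + (-2 * ((k + 1 : ℕ) : ℤ) - 1 : ℤ) * ((x j : ℂ) * regField G x j)) := fun j => by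
    rw [← pd_norm_zpow_mul j _ hx ((harmHom_regField G j).diff (Set.mem_univ x))]
    refine pd_congr j ?_
    filter_upwards [isOpen_ne.mem_nhds hx] with y hy using irrField_eq G hy j
  have h' : ∑ j, pd j (fun y => irrField G y j) x = 0 := h
  have hd' : ∑ j, pd j (fun y => regField G y j) x = 0 := hd
  simp only [hpd, ← Finset.mul_sum, Finset.sum_add_distrib, hd', mul_zero, zero_add] at h'
  refine ((mul_eq_zero.1 h').resolve_left (zpow_ne_zero _ hr') |> mul_eq_zero.1).resolve_left ?_
  exact_mod_cast (show -2 * ((k + 1 : ℕ) : ℤ) - 1 ≠ 0 by omega)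

/-! ### The three projections of a coefficient matrix. -/

/-- The component of `G` in the range of `gradUp`. -/
def partUp (k : ℕ) : Coeff (k + 1) →ₗ[ℂ] Coeff (k + 1) :=
  (-(((k : ℂ) + 1) * (2 * k + 3)))⁻¹ • (gradUp k ∘ₗ lowerT k)

/-- The component of `G` in the range of `gradDown`. -/
def partDown (n : ℕ) : Coeff n →ₗ[ℂ] Coeff n :=
  (-(((n : ℂ) + 1) * (2 * n + 1)))⁻¹ • (gradDown n ∘ₗ raiseT n)

/-- The component of `G` with `t¹ = 0` and `t³ = 0`. -/
def partTor (k : ℕ) : Coeff (k + 1) →ₗ[ℂ] Coeff (k + 1) :=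
  LinearMap.id - partUp k - partDown (k + 1)

lemma gradUp_const_ne_zero (k : ℕ) : (-(((k : ℂ) + 1) * (2 * k + 3))) ≠ 0 := by
  have : -(((k : ℤ) + 1) * (2 * k + 3)) ≠ 0 := by
    have : 0 < ((k : ℤ) + 1) * (2 * k + 3) := by positivity
    omega
  exact_mod_cast this

lemma gradDown_const_ne_zero (n : ℕ) : (-(((n : ℂ) + 1) * (2 * n + 1))) ≠ 0 := by
  have : -(((n : ℤ) + 1) * (2 * n + 1)) ≠ 0 := by
    have : 0 < ((n : ℤ) + 1) * (2 * n + 1) := by positivity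
    omega
  exact_mod_cast this

lemma partTor_add (k : ℕ) (G : Coeff (k + 1)) :
    partTor k G + partUp k G + partDown (k + 1) G = G := by
  simp only [partTor, LinearMap.sub_apply, LinearMap.id_apply]
  abel

lemma lowerT_partUp (k : ℕ) (G : Coeff (k + 1)) : lowerT k (partUp k G) = lowerT k G := by
  simp only [partUp, LinearMap.smul_apply, LinearMap.comp_apply, map_smul, lowerT_gradUp,
    smul_smul, inv_mul_cancel₀ (gradUp_const_ne_zero k), one_smul]

lemma raiseT_partUp (k : ℕ) (G : Coeff (k + 1)) : raiseT (k + 1) (partUp k G) = 0 := by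
  simp only [partUp, LinearMap.smul_apply, LinearMap.comp_apply, map_smul, raiseT_gradUp,
    smul_zero]

lemma raiseT_partDown (n : ℕ) (G : Coeff n) : raiseT n (partDown n G) = raiseT n G := by
  simp only [partDown, LinearMap.smul_apply, LinearMap.comp_apply, map_smul, raiseT_gradDown,
    smul_smul, inv_mul_cancel₀ (gradDown_const_ne_zero n), one_smul]

lemma lowerT_partDown (k : ℕ) (G : Coeff (k + 1)) : lowerT k (partDown (k + 1) G) = 0 := by
  simp only [partDown, LinearMap.smul_apply, LinearMap.comp_apply, map_smul, lowerT_gradDown,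
    smul_zero]

lemma lowerT_partTor (k : ℕ) (G : Coeff (k + 1)) : lowerT k (partTor k G) = 0 := by
  simp [partTor, lowerT_partUp, lowerT_partDown]

lemma raiseT_partTor (k : ℕ) (G : Coeff (k + 1)) : raiseT (k + 1) (partTor k G) = 0 := by
  simp [partTor, raiseT_partUp, raiseT_partDown]

lemma partUp_eq_zero_iff {k : ℕ} {G : Coeff (k + 1)} : partUp k G = 0 ↔ lowerT k G = 0 := by
  refine ⟨fun h => by rw [← lowerT_partUp, h, map_zero], fun h => by simp [partUp, h]⟩

lemma partDown_eq_zero_iff {n : ℕ} {G : Coeff n} : partDown n G = 0 ↔ raiseT n G = 0 := by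
  refine ⟨fun h => by rw [← raiseT_partDown, h, map_zero], fun h => by simp [partDown, h]⟩

/-! ### Locally Lipschitz functions are in `H¹_loc` -/

section Sobolev

open scoped NNReal

/-- On a ball containing the support of `θ` the function `a` agrees with a globally Lipschitz one,
and replacing it changes neither integrand. For global Lipschitz functions integration by parts is
available. -/
lemma lipschitz_integral_by_parts {a θ : E3 → ℝ} (ha : LocallyLipschitz a) (hθ : ContDiff ℝ ∞ θ)
    (hc : HasCompactSupport θ) (v : E3) :
    Integrable (fun x => lineDeriv ℝ a x v * θ x) ∧ Integrable (fun x => a x * fderiv ℝ θ x v) ∧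
      ∫ x, a x * fderiv ℝ θ x v = -∫ x, lineDeriv ℝ a x v * θ x := by
  obtain ⟨ρ, hρ⟩ := hc.isCompact.isBounded.subset_ball (0 : E3)
  obtain ⟨C, hC⟩ := LocallyLipschitzOn.exists_lipschitzOnWith_of_compact
    (isCompact_closedBall (0 : E3) ρ) (ha.locallyLipschitzOn (s := Metric.closedBall (0 : E3) ρ))
  obtain ⟨b, hb, hab⟩ := hC.extend_real
  obtain ⟨D, hD⟩ := hθ.lipschitzWith_of_hasCompactSupport hc (by simp)
  have hθd : ∀ x w, lineDeriv ℝ θ x w = fderiv ℝ θ x w := fun x w =>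
    ((hθ.differentiable (by simp)) x).lineDeriv_eq_fderiv
  have e1 : (fun x => lineDeriv ℝ a x v * θ x) = fun x => lineDeriv ℝ b x v * θ x := by
    ext x
    by_cases hx : x ∈ tsupport θ
    · have : a =ᶠ[𝓝 x] b := by
        filter_upwards [Metric.isOpen_ball.mem_nhds (hρ hx)] with y hy
        exact hab (Metric.ball_subset_closedBall hy)
      rw [this.lineDeriv_eq]
    · rw [image_eq_zero_of_notMem_tsupport hx, mul_zero, mul_zero]
  have e2 : (fun x => a x * fderiv ℝ θ x v) = fun x => b x * fderiv ℝ θ x v := by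
    ext x
    by_cases hx : x ∈ tsupport θ
    · rw [hab (Metric.ball_subset_closedBall (hρ hx))]
    · have : fderiv ℝ θ x = 0 := by
        by_contra h
        exact hx (support_fderiv_subset ℝ h)
      simp [this]
  have hcd : HasCompactSupport fun x => fderiv ℝ θ x v := hc.fderiv_apply ℝ v
  have hcont : Continuous fun x => fderiv ℝ θ x v :=
    (hθ.continuous_fderiv (by simp)).clm_apply continuous_const
  rw [e1, e2]
  refine ⟨?_, (hb.continuous.mul hcont).integrable_of_hasCompactSupport hcd.mul_left, ?_⟩
  · have := (hb.locallyIntegrable_lineDeriv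
      (μ := volume) v).integrable_smul_left_of_hasCompactSupport hθ.continuous hc
    refine this.congr (Eventually.of_forall fun x => ?_)
    simp [mul_comm]
  · rw [hb.integral_lineDeriv_mul_eq hD hc v, ← integral_neg]
    refine integral_congr_ae (Eventually.of_forall fun x => ?_)
    simp only [hθd, map_neg]
    ring

lemma _root_.Continuous.memL2loc {u : E3 → ℂ} (hu : Continuous u) : MemL2loc u := by
  intro K hK
  have : IsFiniteMeasure (volume.restrict K) := ⟨by simpa using hK.measure_lt_top⟩
  obtain ⟨C, hC⟩ := hK.exists_bound_of_continuousOn hu.continuousOn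
  exact MemLp.of_bound hu.aestronglyMeasurable C
    ((ae_restrict_iff' hK.measurableSet).2 (Eventually.of_forall hC))

lemma memL2loc_lineDeriv {a : E3 → ℝ} (ha : LocallyLipschitz a) (v : E3) (c : ℂ) :
    MemL2loc fun x => c * ((lineDeriv ℝ a x v : ℝ) : ℂ) := by
  intro K hK
  have : IsFiniteMeasure (volume.restrict K) := ⟨by simpa using hK.measure_lt_top⟩
  obtain ⟨ρ, hρ⟩ := hK.isBounded.subset_ball (0 : E3)
  obtain ⟨C, hC⟩ := LocallyLipschitzOn.exists_lipschitzOnWith_of_compact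
    (isCompact_closedBall (0 : E3) ρ) (ha.locallyLipschitzOn (s := Metric.closedBall (0 : E3) ρ))
  have hm : Measurable fun x => lineDeriv ℝ a x v := measurable_lineDeriv ha.continuous
  refine MemLp.of_bound ((Complex.measurable_ofReal.comp hm).const_mul c).aestronglyMeasurable
    (‖c‖ * (C * ‖v‖)) ((ae_restrict_iff' hK.measurableSet).2 (Eventually.of_forall fun x hx => ?_))
  rw [norm_mul, Complex.norm_real]
  gcongr
  exact norm_lineDeriv_le_of_lipschitzOn ℝ
    (mem_of_superset (Metric.isOpen_ball.mem_nhds (hρ hx)) Metric.ball_subset_closedBall) hC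

lemma MemL2loc.add {u v : E3 → ℂ} (hu : MemL2loc u) (hv : MemL2loc v) :
    MemL2loc fun x => u x + v x := fun K hK => (hu K hK).add (hv K hK)

lemma pd_eq_re_im {η : E3 → ℂ} (hη : ContDiff ℝ ∞ η) (j : Fin 3) (x : E3) :
    pd j η x = (fderiv ℝ (fun y => (η y).re) x (EuclideanSpace.single j 1) : ℂ)
      + Complex.I * (fderiv ℝ (fun y => (η y).im) x (EuclideanSpace.single j 1) : ℂ) := by
  have hd := (hη.differentiable (by simp) x).hasFDerivAt
  have h1 : HasFDerivAt (fun y => (η y).re) _ x := Complex.reCLM.hasFDerivAt.comp x hd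
  have h2 : HasFDerivAt (fun y => (η y).im) _ x := Complex.imCLM.hasFDerivAt.comp x hd
  rw [h1.fderiv, h2.fderiv, pd]
  simp [mul_comm Complex.I, Complex.re_add_im]

/-- The weak derivative is built from the line derivatives of the real and imaginary parts, which
are bounded on compact sets. Complex test functions are split in the same way, giving four real
integrations by parts. -/
theorem memH1loc_of_locallyLipschitz {u : E3 → ℂ} (hu : LocallyLipschitz u) : MemH1loc u := by
  refine ⟨hu.continuous.memL2loc, fun j => ?_⟩
  set e : E3 := EuclideanSpace.single j 1 with he
  have ha : LocallyLipschitz fun x => (u x).re :=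
    Complex.reCLM.lipschitz.locallyLipschitz.comp hu
  have hb : LocallyLipschitz fun x => (u x).im :=
    Complex.imCLM.lipschitz.locallyLipschitz.comp hu
  set a := fun x => (u x).re with hadef
  set b := fun x => (u x).im with hbdef
  refine ⟨fun x => 1 * ((lineDeriv ℝ a x e : ℝ) : ℂ) + Complex.I * ((lineDeriv ℝ b x e : ℝ) : ℂ),
    (memL2loc_lineDeriv ha e 1).add (memL2loc_lineDeriv hb e Complex.I), fun η hη hc => ?_⟩
  have hs : ContDiff ℝ ∞ fun x => (η x).re := Complex.reCLM.contDiff.comp hη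
  have ht : ContDiff ℝ ∞ fun x => (η x).im := Complex.imCLM.contDiff.comp hη
  have hcs : HasCompactSupport fun x => (η x).re := hc.comp_left (g := Complex.re) rfl
  have hct : HasCompactSupport fun x => (η x).im := hc.comp_left (g := Complex.im) rfl
  set s := fun x => (η x).re with hsdef
  set t := fun x => (η x).im with htdef
  obtain ⟨i1, i1', p1⟩ := lipschitz_integral_by_parts ha hs hcs e
  obtain ⟨i2, i2', p2⟩ := lipschitz_integral_by_parts ha ht hct e
  obtain ⟨i3, i3', p3⟩ := lipschitz_integral_by_parts hb hs hcs e
  obtain ⟨i4, i4', p4⟩ := lipschitz_integral_by_parts hb ht hct e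
  have huab : ∀ x, u x = (a x : ℂ) + Complex.I * (b x : ℂ) := fun x => by
    simp [hadef, hbdef, mul_comm Complex.I, Complex.re_add_im]
  have hηst : ∀ x, η x = (s x : ℂ) + Complex.I * (t x : ℂ) := fun x => by
    simp [hsdef, htdef, mul_comm Complex.I, Complex.re_add_im]
  have l1 : ∀ x, u x * pd j η x =
      ((a x * fderiv ℝ s x e - b x * fderiv ℝ t x e : ℝ) : ℂ)
        + Complex.I * ((a x * fderiv ℝ t x e + b x * fderiv ℝ s x e : ℝ) : ℂ) := fun x => by
    rw [pd_eq_re_im hη, huab]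
    push_cast
    linear_combination (b x : ℂ) * (fderiv ℝ t x e : ℂ) * Complex.I_sq
  have l2 : ∀ x,
      (1 * ((lineDeriv ℝ a x e : ℝ) : ℂ) + Complex.I * ((lineDeriv ℝ b x e : ℝ) : ℂ)) * η x =
      ((lineDeriv ℝ a x e * s x - lineDeriv ℝ b x e * t x : ℝ) : ℂ)
        + Complex.I * ((lineDeriv ℝ a x e * t x + lineDeriv ℝ b x e * s x : ℝ) : ℂ) := fun x => by
    rw [hηst]
    push_cast
    linear_combination ((lineDeriv ℝ b x e : ℝ) : ℂ) * (t x : ℂ) * Complex.I_sq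
  simp only [l1, l2]
  rw [integral_add (i1'.sub i4').ofReal ((i2'.add i3').ofReal.const_mul _),
    integral_add (i1.sub i4).ofReal ((i2.add i3).ofReal.const_mul _),
    integral_const_mul, integral_const_mul, integral_complex_ofReal, integral_complex_ofReal,
    integral_complex_ofReal, integral_complex_ofReal, integral_sub i1' i4',
    integral_add i2' i3', integral_sub i1 i4, integral_add i2 i3, p1, p2, p3, p4]
  push_cast
  ring

end Sobolev

/-! ### Gluing an inner and an outer field along a sphere -/

section Glue

open scoped NNReal

/-- Only points on opposite sides near the sphere need care: the segment between them meets the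
sphere at a point where `f = e`. The estimates for `f` and `e` on the two pieces add up, because
distances are additive along a segment. -/
lemma locallyLipschitz_glue {R : ℝ} (hR : 0 < R) {f e : E3 → ℂ} (hf : ∀ x, ContDiffAt ℝ ∞ f x)
    (he : ∀ x, x ≠ 0 → ContDiffAt ℝ ∞ e x) (hfe : ∀ x, ‖x‖ = R → f x = e x) :
    LocallyLipschitz fun x => if ‖x‖ ≤ R then f x else e x := by
  intro x
  rcases lt_trichotomy ‖x‖ R with hx | hx | hx
  · obtain ⟨K, t, ht, hK⟩ := ((hf x).of_le (by simp)).exists_lipschitzOnWith (𝕂 := ℝ)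
    refine ⟨K, t ∩ {y | ‖y‖ < R}, inter_mem ht
      ((isOpen_lt continuous_norm continuous_const).mem_nhds hx), ?_⟩
    intro y hy z hz
    simp only [if_pos (show ‖y‖ ≤ R from le_of_lt hy.2), if_pos (show ‖z‖ ≤ R from le_of_lt hz.2)]
    exact hK hy.1 hz.1
  · have hx0 : x ≠ 0 := by
      rintro rfl
      simp at hx
      exact hR.ne hx
    obtain ⟨K, t, ht, hK⟩ := ((hf x).of_le (by simp)).exists_lipschitzOnWith (𝕂 := ℝ)
    obtain ⟨K', t', ht', hK'⟩ := ((he x hx0).of_le (by simp)).exists_lipschitzOnWith (𝕂 := ℝ)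
    obtain ⟨ε, hε, hball⟩ := Metric.mem_nhds_iff.1 (inter_mem ht ht')
    have hKm : LipschitzOnWith (max K K') f (Metric.ball x ε) :=
      (hK.mono fun y hy => (hball hy).1).weaken (le_max_left _ _)
    have hKm' : LipschitzOnWith (max K K') e (Metric.ball x ε) :=
      (hK'.mono fun y hy => (hball hy).2).weaken (le_max_right _ _)
    refine ⟨max K K', Metric.ball x ε, Metric.ball_mem_nhds x hε, ?_⟩
    have cross : ∀ y ∈ Metric.ball x ε, ∀ z ∈ Metric.ball x ε, ‖y‖ ≤ R → R < ‖z‖ →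
        dist (f y) (e z) ≤ (max K K' : ℝ≥0) * dist y z := by
      intro y hy z hz hyR hzR
      obtain ⟨p, hp, hpR⟩ := (convex_segment (𝕜 := ℝ) y z).isPreconnected.intermediate_value
        (left_mem_segment ℝ y z) (right_mem_segment ℝ y z) continuous_norm.continuousOn
        (show R ∈ Set.Icc ‖y‖ ‖z‖ from ⟨hyR, hzR.le⟩)
      have hpb : p ∈ Metric.ball x ε := (convex_ball x ε).segment_subset hy hz hp
      calc dist (f y) (e z) ≤ dist (f y) (f p) + dist (e p) (e z) := by
            rw [← hfe p hpR]; exact dist_triangle _ _ _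
        _ ≤ (max K K' : ℝ≥0) * dist y p + (max K K' : ℝ≥0) * dist p z :=
            add_le_add (hKm.dist_le_mul y hy p hpb) (hKm'.dist_le_mul p hpb z hz)
        _ = (max K K' : ℝ≥0) * dist y z := by
            rw [← mul_add, dist_add_dist_of_mem_segment hp]
    refine LipschitzOnWith.of_dist_le_mul fun y hy z hz => ?_
    by_cases h1 : ‖y‖ ≤ R <;> by_cases h2 : ‖z‖ ≤ R
    · simp only [if_pos h1, if_pos h2]
      exact hKm.dist_le_mul y hy z hz
    · simp only [if_pos h1, if_neg h2]
      exact cross y hy z hz h1 (not_le.1 h2)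
    · simp only [if_neg h1, if_pos h2]
      rw [dist_comm, dist_comm y z]
      exact cross z hz y hy h2 (not_le.1 h1)
    · simp only [if_neg h1, if_neg h2]
      exact hKm'.dist_le_mul y hy z hz
  · have hx0 : x ≠ 0 := norm_pos_iff.1 (hR.trans hx)
    obtain ⟨K, t, ht, hK⟩ := ((he x hx0).of_le (by simp)).exists_lipschitzOnWith (𝕂 := ℝ)
    refine ⟨K, t ∩ {y | R < ‖y‖}, inter_mem ht
      ((isOpen_lt continuous_const continuous_norm).mem_nhds hx), ?_⟩
    intro y hy z hz
    simp only [if_neg (show ¬ ‖y‖ ≤ R from not_le.2 hy.2),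
      if_neg (show ¬ ‖z‖ ≤ R from not_le.2 hz.2)]
    exact hK hy.1 hz.1

/-- The field equal to `f` on the closed ball of radius `R` and to `e` outside. -/
def glue (R : ℝ) (f e : E3 → Fin 3 → ℂ) (x : E3) : Fin 3 → ℂ := if ‖x‖ ≤ R then f x else e x

lemma glue_apply (R : ℝ) (f e : E3 → Fin 3 → ℂ) (x : E3) (i : Fin 3) :
    glue R f e x i = if ‖x‖ ≤ R then f x i else e x i := by
  unfold glue
  split_ifs <;> rfl

lemma continuousAt_traction (lam mu : ℝ) {u : E3 → Fin 3 → ℂ} (ν : E3) {x : E3}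
    (hu : ∀ i, ContDiffAt ℝ ∞ (fun y => u y i) x) :
    ContinuousAt (fun y => traction lam mu u ν y) x := by
  have h : ∀ i j : Fin 3, ContinuousAt (pd j fun y => u y i) x := fun i j =>
    ((hu i).pd j).continuousAt
  have hd : ContinuousAt (divergence u) x :=
    tendsto_finsetSum _ fun j _ => h j j
  refine continuousAt_pi.2 fun i => ?_
  refine ((continuousAt_const.mul hd).mul continuousAt_const).add (continuousAt_const.mul ?_)
  exact tendsto_finsetSum _ fun j _ => ((h i j).add (h j i)).mul continuousAt_const

lemma mem_nhds_ball_iff {R : ℝ} {y : E3} : y ∈ Metric.ball (0 : E3) R ↔ ‖y‖ < R := by simp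

lemma mem_compl_closedBall_iff {R : ℝ} {y : E3} :
    y ∈ (Metric.closedBall (0 : E3) R)ᶜ ↔ R < ‖y‖ := by simp

lemma glue_eventuallyEq_inside {R : ℝ} (f e : E3 → Fin 3 → ℂ) {y : E3} (hy : ‖y‖ < R) :
    glue R f e =ᶠ[𝓝 y] f := by
  filter_upwards [(isOpen_lt continuous_norm continuous_const).mem_nhds hy] with z hz
  exact if_pos (le_of_lt hz)

lemma glue_eventuallyEq_outside {R : ℝ} (f e : E3 → Fin 3 → ℂ) {y : E3} (hy : R < ‖y‖) :
    glue R f e =ᶠ[𝓝 y] e := by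
  filter_upwards [(isOpen_lt continuous_const continuous_norm).mem_nhds hy] with z hz
  exact if_neg (not_le.2 hz)

lemma nhdsWithin_ball_neBot {R : ℝ} (hR : 0 < R) {x : E3} (hx : x ∈ Metric.sphere (0 : E3) R) :
    (𝓝[Metric.ball 0 R] x).NeBot := by
  rw [← mem_closure_iff_nhdsWithin_neBot, closure_ball _ hR.ne']
  exact Metric.sphere_subset_closedBall hx

lemma nhdsWithin_compl_closedBall_neBot {R : ℝ} (hR : 0 < R) {x : E3}
    (hx : x ∈ Metric.sphere (0 : E3) R) : (𝓝[(Metric.closedBall 0 R)ᶜ] x).NeBot := by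
  rw [← mem_closure_iff_nhdsWithin_neBot, closure_compl, interior_closedBall _ hR.ne']
  intro h
  exact (Metric.mem_ball.1 h).ne hx

variable {lam mu R : ℝ} {f e : E3 → Fin 3 → ℂ}

lemma tendsto_traction_glue_inside (c : ℝ) (hf : ∀ i x, ContDiffAt ℝ ∞ (fun y => f y i) x)
    (x ν : E3) :
    Tendsto (fun y => traction (coeffA c R y * lam) (coeffA c R y * mu) (glue R f e) ν y)
      (𝓝[Metric.ball 0 R] x) (𝓝 ((c : ℂ) • traction lam mu f ν x)) := by
  have h := (continuousAt_traction lam mu ν (fun i => hf i x)).const_smul (c : ℂ)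
  refine (h.tendsto.mono_left nhdsWithin_le_nhds).congr' ?_
  filter_upwards [self_mem_nhdsWithin] with y hy
  rw [mem_nhds_ball_iff] at hy
  rw [coeffA, if_pos hy.le, traction_smul,
    traction_congr lam mu ν (glue_eventuallyEq_inside f e hy)]
  rfl

lemma tendsto_traction_glue_outside (c : ℝ)
    {x : E3} (he : ∀ i, ContDiffAt ℝ ∞ (fun y => e y i) x) (ν : E3) :
    Tendsto (fun y => traction (coeffA c R y * lam) (coeffA c R y * mu) (glue R f e) ν y)
      (𝓝[(Metric.closedBall 0 R)ᶜ] x) (𝓝 (traction lam mu e ν x)) := by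
  have h := continuousAt_traction lam mu ν he
  refine (h.tendsto.mono_left nhdsWithin_le_nhds).congr' ?_
  filter_upwards [self_mem_nhdsWithin] with y hy
  rw [mem_compl_closedBall_iff] at hy
  rw [coeffA, if_neg (not_le.2 hy), one_mul, one_mul,
    traction_congr lam mu ν (glue_eventuallyEq_outside f e hy)]

/-- Two Lamé fields that agree on the sphere form a transmission solution if and only if their
tractions match. -/
theorem isTransmissionSolution_glue_iff (c : ℝ) (hR : 0 < R)
    (hf : ∀ i x, ContDiffAt ℝ ∞ (fun y => f y i) x)
    (he : ∀ i x, x ≠ 0 → ContDiffAt ℝ ∞ (fun y => e y i) x) (hfe : ∀ x, ‖x‖ = R → f x = e x)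
    (hLf : ∀ x, lameOp lam mu f x = 0) (hLe : ∀ x, x ≠ 0 → lameOp lam mu e x = 0)
    (hdecay : e =O[cocompact E3] fun x => ‖x‖⁻¹) :
    IsTransmissionSolution lam mu c R (glue R f e) ↔ ∀ x, ‖x‖ = R →
      (c : ℂ) • traction lam mu f (R⁻¹ • x) x = traction lam mu e (R⁻¹ • x) x := by
  have hne : ∀ x : E3, ‖x‖ = R → x ≠ 0 := fun x hx => norm_pos_iff.1 (hx ▸ hR)
  constructor
  · intro h x hx
    have hxs : x ∈ Metric.sphere (0 : E3) R := by simpa using hx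
    -- Both one-sided filters are nontrivial, so the limits are unique and the common limit equals
    -- each of the two computed tractions.
    have := nhdsWithin_ball_neBot hR hxs
    have := nhdsWithin_compl_closedBall_neBot hR hxs
    obtain ⟨a, h1, h2⟩ := h.traction_match x hxs
    rw [tendsto_nhds_unique (tendsto_traction_glue_inside c hf x (R⁻¹ • x)) h1,
      tendsto_nhds_unique
        (tendsto_traction_glue_outside c (fun i => he i x (hne x hx)) (R⁻¹ • x)) h2]
  · intro h
    refine ⟨fun i => ?_, ?_, ?_, fun x hx => ?_, fun x hx => ?_, fun x hx => ?_, ?_⟩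
    · simp only [glue_apply]
      exact memH1loc_of_locallyLipschitz (locallyLipschitz_glue hR (hf i) (he i)
        fun x hx => by rw [hfe x hx])
    · refine contDiffOn_pi.2 fun i x hx => ?_
      rw [mem_nhds_ball_iff] at hx
      exact (((hf i x).congr_of_eventuallyEq ((glue_eventuallyEq_inside f e hx).mono
        fun y hy => congrFun hy i)).of_le (WithTop.coe_le_coe.2 le_top)).contDiffWithinAt
    · refine contDiffOn_pi.2 fun i x hx => ?_
      rw [mem_compl_closedBall_iff] at hx
      exact (((he i x (norm_pos_iff.1 (hR.trans hx))).congr_of_eventuallyEq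
        ((glue_eventuallyEq_outside f e hx).mono
          fun y hy => congrFun hy i)).of_le (WithTop.coe_le_coe.2 le_top)).contDiffWithinAt
    · rw [lameOp_smul]
      rcases lt_or_gt_of_ne hx with hx | hx
      · rw [lameOp_congr lam mu (glue_eventuallyEq_inside f e hx), hLf, smul_zero]
      · rw [lameOp_congr lam mu (glue_eventuallyEq_outside f e hx),
          hLe x (norm_pos_iff.1 (hR.trans hx)), smul_zero]
    · have hxR : ‖x‖ = R := by simpa using hx
      refine ⟨f x, ?_, ?_⟩
      · have h1 : ContinuousAt f x := continuousAt_pi.2 fun i => (hf i x).continuousAt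
        refine (h1.tendsto.mono_left nhdsWithin_le_nhds).congr' ?_
        filter_upwards [self_mem_nhdsWithin] with y hy
        exact (if_pos (mem_nhds_ball_iff.1 hy).le).symm
      · have h1 : ContinuousAt e x := continuousAt_pi.2 fun i => (he i x (hne x hxR)).continuousAt
        rw [hfe x hxR]
        refine (h1.tendsto.mono_left nhdsWithin_le_nhds).congr' ?_
        filter_upwards [self_mem_nhdsWithin] with y hy
        exact (if_neg (not_le.2 (mem_compl_closedBall_iff.1 hy))).symm
    · have hxR : ‖x‖ = R := by simpa using hx
      refine ⟨_, tendsto_traction_glue_inside c hf x (R⁻¹ • x), ?_⟩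
      rw [h x hxR]
      exact tendsto_traction_glue_outside c (fun i => he i x (hne x hxR)) (R⁻¹ • x)
    · refine hdecay.congr' ?_ EventuallyEq.rfl
      filter_upwards [(isCompact_closedBall (0 : E3) R).compl_mem_cocompact] with y hy
      exact (if_neg (not_le.2 (mem_compl_closedBall_iff.1 hy))).symm

end Glue

/-! ### The degree-`n` waves as glued Lamé fields -/

lemma regField_add {n : ℕ} (G H : Coeff n) (x : E3) :
    regField (G + H) x = regField G x + regField H x := Matrix.add_mulVec _ _ _

lemma regField_smul {n : ℕ} (c : ℂ) (G : Coeff n) (x : E3) :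
    regField (c • G) x = c • regField G x := Matrix.smul_mulVec _ _ _

lemma irrField_add {n : ℕ} (G H : Coeff n) (x : E3) :
    irrField (G + H) x = irrField G x + irrField H x := Matrix.add_mulVec _ _ _

lemma eq_of_regField_eq_on_sphere {n : ℕ} {R : ℝ} (hR : 0 < R) {G H : Coeff n}
    (h : ∀ x, ‖x‖ = R → regField G x = regField H x) : G = H := by
  refine funext fun i => sub_eq_zero.1 ?_
  refine eq_zero_of_dotProduct_regY_sphere n hR _ fun x hx => ?_
  rw [sub_dotProduct]
  exact sub_eq_zero.2 (congrFun (h x hx) i)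

/-- The decaying field that agrees with `regField G` on the sphere of radius `R`. -/
def decField {n : ℕ} (R : ℝ) (G : Coeff n) : E3 → Fin 3 → ℂ :=
  irrField ((R : ℂ) ^ (2 * n + 1) • G)

lemma decField_add {n : ℕ} (R : ℝ) (G H : Coeff n) (x : E3) :
    decField R (G + H) x = decField R G x + decField R H x := by
  rw [decField, smul_add, irrField_add]
  rfl

lemma decField_eq_regField {n : ℕ} {R : ℝ} (hR : 0 < R) (G : Coeff n) {x : E3} (hx : ‖x‖ = R) :
    decField R G x = regField G x := by
  have hx0 : x ≠ 0 := norm_pos_iff.1 (hx ▸ hR)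
  have hr' : (R : ℂ) ≠ 0 := by exact_mod_cast hR.ne'
  ext i
  rw [decField, irrField_eq _ hx0, regField_smul, Pi.smul_apply, smul_eq_mul, ← mul_assoc, hx,
    ← zpow_natCast, ← zpow_add₀ hr',
    show -2 * (n : ℤ) - 1 + ((2 * n + 1 : ℕ) : ℤ) = 0 by push_cast; ring, zpow_zero, one_mul]

lemma corrField_of_norm_eq (R : ℝ) (M : ℂ) (g : E3 → Fin 3 → ℂ) {x : E3} (hx : ‖x‖ = R) :
    corrField R M g x = g x := by
  ext i
  simp [corrField, hx]

lemma traction_corrField_add (lam mu R : ℝ) (M : ℂ) {Ω : Set E3} (hΩ : IsOpen Ω) {d : ℤ}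
    {g h : E3 → Fin 3 → ℂ} (hg : ∀ i, HarmHom Ω d (fun x => g x i))
    (hh : ∀ i, HarmHom Ω d (fun x => h x i)) (ν : E3) {x : E3} (hx : x ∈ Ω) :
    traction lam mu (corrField R M fun y => g y + h y) ν x =
      traction lam mu (corrField R M g) ν x + traction lam mu (corrField R M h) ν x := by
  rw [← traction_add lam mu ν
    (fun i => (contDiffAt_corrField R M hΩ hg i hx).differentiableAt_infty)
    (fun i => (contDiffAt_corrField R M hΩ hh i hx).differentiableAt_infty)]
  have hdiv : ∀ y ∈ Ω, divergence (fun y => g y + h y) y = divergence g y + divergence h y :=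
    fun y hy => by
      simp only [divergence, Pi.add_apply, ← Finset.sum_add_distrib]
      exact Finset.sum_congr rfl fun j _ => pd_add j ((hg j).diff hy) ((hh j).diff hy)
  refine traction_congr lam mu ν ?_
  filter_upwards [hΩ.mem_nhds hx] with y hy
  ext i
  have : pd i (divergence fun y => g y + h y) y =
      pd i (divergence g) y + pd i (divergence h) y := by
    rw [← pd_add i ((harmHom_divergence hΩ hg).diff hy) ((harmHom_divergence hΩ hh).diff hy)]
    refine pd_congr i ?_
    filter_upwards [hΩ.mem_nhds hy] with z hz using hdiv z hz
  simp only [corrField, Pi.add_apply, this]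
  ring

/-- The angular factor is bounded on the compact unit sphere, and the radial factor is exactly the
claimed power. -/
lemma isBigO_irrY (n : ℕ) (a : Fin (2 * n + 1) → ℂ) :
    (fun x => a ⬝ᵥ irrY n x) =O[cocompact E3] fun x => (‖x‖ ^ (n + 1))⁻¹ := by
  obtain ⟨C, hC⟩ := (isCompact_sphere (0 : E3) 1).exists_bound_of_continuousOn
    (f := fun x => a ⬝ᵥ regY n x)
    (continuous_const.dotProduct (continuous_regY n)).continuousOn
  refine Asymptotics.IsBigO.of_bound C ?_
  filter_upwards [(isCompact_singleton (x := (0 : E3))).compl_mem_cocompact] with x hx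
  have hr : ‖x‖ ≠ 0 := norm_ne_zero_iff.2 hx
  have hu : ‖unitVec x‖ = 1 := by
    rw [unitVec, norm_smul, norm_inv, norm_norm, inv_mul_cancel₀ hr]
  have h1 : irrY n x = ((‖x‖ : ℂ) ^ (n + 1))⁻¹ • regY n (unitVec x) := by
    have : unitVec (unitVec x) = unitVec x := by
      conv_lhs => rw [unitVec, hu, inv_one, one_smul]
    ext i
    simp [irrY, regY, hu, this]
  rw [h1, dotProduct_smul, smul_eq_mul, norm_mul, norm_inv, norm_pow, Complex.norm_real, norm_norm,
    mul_comm, norm_inv, norm_pow, norm_norm]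
  gcongr
  exact hC _ (by simpa using hu)

section Waves

variable {k : ℕ} {lam mu R : ℝ}

lemma divergence_regField_eq (G : Coeff (k + 1)) :
    divergence (regField G) = fun x => lowerT k G ⬝ᵥ regY k x :=
  funext fun x => divergence_regField G x

lemma pd_divergence_regField (i : Fin 3) (G : Coeff (k + 2)) (x : E3) :
    pd i (divergence (regField G)) x = (lowerT (k + 1) G ᵥ* lowerD k i) ⬝ᵥ regY k x := by
  rw [divergence_regField_eq, pd_dotProduct_lowerD]

lemma pd_divergence_irrField {n : ℕ} (i : Fin 3) (G : Coeff n) {x : E3} (hx : x ≠ 0) :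
    pd i (divergence (irrField G)) x = (raiseT n G ᵥ* Dup (n + 1) i) ⬝ᵥ irrY (n + 1 + 1) x := by
  rw [← pd_dotProduct_Dup i _ _ hx]
  refine pd_congr i ?_
  filter_upwards [isOpen_ne.mem_nhds hx] with y hy using divergence_irrField G hy

/-- Lowering twice is taking the gradient of the divergence, so the prescribed correction is a
multiple of `(r² - R²) ∇(∇ · g)`. -/
lemma innerMain_sub_innerCorr (G : Coeff (k + 2)) (x : E3) :
    innerMain G x - innerCorr lam mu R G x =
      corrField R (-(coefM lam mu (k + 2) : ℂ)) (regField G) x := by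
  ext i
  rw [corrField, pd_divergence_regField]
  -- Writing `n = k + 2` makes the index sets for `n - 1` and `n - 1 - 1` reduce definitionally to
  -- those for `k + 1` and `k`.
  change regField G x i - (coefM lam mu (k + 2) : ℂ) * ((‖x‖ : ℂ) ^ 2 - (R : ℂ) ^ 2) *
    ((lowerT (k + 1) G ᵥ* lowerD k i) ⬝ᵥ regY k x) = _
  ring

lemma outerMain_eq {n : ℕ} (G : Coeff n) (x : E3) : outerMain R G x = decField R G x := by
  have h : irrY n x = ((‖x‖ : ℂ) ^ (n + 1))⁻¹ • sphY n (unitVec x) := rfl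
  rw [outerMain, decField, irrField, Matrix.smul_mulVec, h, Matrix.mulVec_smul, smul_smul,
    div_eq_mul_inv]

lemma outerMain_add_outerCorr {n : ℕ} (G : Coeff n) {x : E3} (hx : x ≠ 0) :
    outerMain R G x + outerCorr lam mu R G x =
      corrField R (coefK lam mu n : ℂ) (decField R G) x := by
  ext i
  have h : irrY (n + 1 + 1) x = ((‖x‖ : ℂ) ^ (n + 3))⁻¹ • sphY (n + 1 + 1) (unitVec x) := rfl
  rw [Pi.add_apply, outerMain_eq, corrField]
  simp only [decField]
  rw [pd_divergence_irrField i _ hx, map_smul, Matrix.smul_vecMul, smul_dotProduct, h,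
    dotProduct_smul]
  change _ + (coefK lam mu n : ℂ) * ((‖x‖ : ℂ) ^ 2 - (R : ℂ) ^ 2) *
    ((R : ℂ) ^ (2 * n + 1) / (‖x‖ : ℂ) ^ (n + 3)) *
    ((raiseT n G ᵥ* Dup (n + 1) i) ⬝ᵥ sphY (n + 1 + 1) (unitVec x)) = _
  simp only [smul_eq_mul, div_eq_mul_inv]
  ring

lemma harmHom_decField {n : ℕ} (R : ℝ) (G : Coeff n) (i : Fin 3) :
    HarmHom {0}ᶜ (-n - 1) (fun x => decField R G x i) := harmHom_irrField _ i

lemma waveGen_eq_glue (hR : 0 < R) (G : Coeff (k + 2)) :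
    waveGen lam mu R G = glue R (corrField R (-(coefM lam mu (k + 2) : ℂ)) (regField G))
      (corrField R (coefK lam mu (k + 2) : ℂ) (decField R G)) := by
  ext x : 1
  unfold waveGen glue
  split_ifs with h
  · exact innerMain_sub_innerCorr G x
  · exact outerMain_add_outerCorr G (norm_pos_iff.1 (hR.trans (not_le.1 h)))

lemma innerCorr_eq_zero {G : Coeff (k + 2)} (h : tThree G = 0) (x : E3) :
    innerCorr lam mu R G x = 0 := by
  ext j
  simp [innerCorr, h]

lemma outerCorr_eq_zero {n : ℕ} {G : Coeff n} (h : tOne G = 0) (x : E3) :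
    outerCorr lam mu R G x = 0 := by
  ext j
  simp [outerCorr, h]

lemma waveOne_eq_waveGen (lam mu : ℝ) {G : Coeff (k + 2)} (h1 : tOne G = 0) (h3 : tThree G = 0) :
    waveOne R G = waveGen lam mu R G := by
  ext x : 1
  rw [waveOne, waveGen, innerCorr_eq_zero h3, outerCorr_eq_zero h1, sub_zero, add_zero]

lemma waveTwo_eq_waveGen {G : Coeff (k + 2)} (h1 : tOne G = 0) :
    waveTwo lam mu R G = waveGen lam mu R G := by
  ext x : 1
  rw [waveTwo, waveGen, outerCorr_eq_zero h1, add_zero]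

lemma waveThree_eq_waveGen {G : Coeff (k + 2)} (h3 : tThree G = 0) :
    waveThree lam mu R G = waveGen lam mu R G := by
  ext x : 1
  rw [waveThree, waveGen, innerCorr_eq_zero h3, sub_zero]

/-- The second derivatives in the correction decay like `r^(-n-3)`; the factor `r² - R²` costs two
powers and leaves `r^(-n-1)`. -/
lemma isBigO_corrField_decField {n : ℕ} (R : ℝ) (K : ℂ) (G : Coeff n) :
    corrField R K (decField R G) =O[cocompact E3] fun x => ‖x‖⁻¹ := by
  have hbig : ∀ᶠ x in cocompact E3, 1 ≤ ‖x‖ := by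
    filter_upwards [(isCompact_closedBall (0 : E3) 1).compl_mem_cocompact] with x hx
    exact (mem_compl_closedBall_iff.1 hx).le
  have hpow : ∀ m : ℕ, 1 ≤ m → (fun x : E3 => (‖x‖ ^ m)⁻¹) =O[cocompact E3] fun x => ‖x‖⁻¹ := by
    intro m hm
    refine Asymptotics.IsBigO.of_bound 1 ?_
    filter_upwards [hbig] with x hx
    rw [one_mul, norm_inv, norm_inv, norm_pow, norm_norm]
    have : ‖x‖ ≤ ‖x‖ ^ m := le_self_pow₀ hx (by omega)
    gcongr
  refine Asymptotics.isBigO_pi.2 fun i => ?_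
  refine Asymptotics.IsBigO.add ?_ (Asymptotics.IsBigO.const_mul_left ?_ K)
  · exact (isBigO_irrY n _).trans (hpow _ (by omega))
  · have h1 : (fun x : E3 => (‖x‖ : ℂ) ^ 2 - (R : ℂ) ^ 2) =O[cocompact E3]
        fun x => ‖x‖ ^ 2 := by
      refine Asymptotics.IsBigO.of_bound (1 + R ^ 2) ?_
      filter_upwards [hbig] with x hx
      have h2 : (1 : ℝ) ≤ ‖x‖ ^ 2 := one_le_pow₀ hx
      calc ‖(‖x‖ : ℂ) ^ 2 - (R : ℂ) ^ 2‖ ≤ ‖(‖x‖ : ℂ) ^ 2‖ + ‖(R : ℂ) ^ 2‖ := norm_sub_le _ _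
        _ = ‖x‖ ^ 2 + R ^ 2 * 1 := by
            simp [← Complex.ofReal_pow]
        _ ≤ ‖x‖ ^ 2 + R ^ 2 * ‖x‖ ^ 2 := by gcongr
        _ = (1 + R ^ 2) * ‖‖x‖ ^ 2‖ := by
            rw [norm_pow, norm_norm]; ring
    have h2 : (fun x => pd i (divergence (decField R G)) x) =O[cocompact E3]
        fun x => (‖x‖ ^ (n + 1 + 1 + 1))⁻¹ := by
      refine (isBigO_irrY (n + 1 + 1)
        (raiseT n ((R : ℂ) ^ (2 * n + 1) • G) ᵥ* Dup (n + 1) i)).congr'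
        ?_ EventuallyEq.rfl
      filter_upwards [hbig] with x hx
      exact (pd_divergence_irrField i _ (norm_pos_iff.1 (by linarith))).symm
    refine ((h1.mul h2).congr' EventuallyEq.rfl ?_).trans (hpow (n + 1) (by omega))
    filter_upwards [hbig] with x hx
    have : ‖x‖ ≠ 0 := by linarith
    field_simp
    ring

end Waves

/-! ### The plasmon constants -/

section Constants

variable {lam mu : ℝ} {n : ℕ}

/-- As `λ` may be negative, it is absorbed into `3λ + 2μ`: three times the expression is
`(n-1)(3λ+2μ) + (7n-4)μ`. The next three lemmas use the same splitting. -/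
lemma coefM_denom_pos (hmu : 0 < mu) (hconv : 0 < 3 * lam + 2 * mu) (hn : 2 ≤ n) :
    0 < ((n : ℝ) - 1) * lam + (3 * n - 2) * mu := by
  have h : (2 : ℝ) ≤ n := by exact_mod_cast hn
  nlinarith [mul_pos (show (0 : ℝ) < n - 1 by linarith) hconv,
    mul_pos (show (0 : ℝ) < n by linarith) hmu]

lemma coefK_denom_pos (hmu : 0 < mu) (hconv : 0 < 3 * lam + 2 * mu) (n : ℕ) :
    0 < ((n : ℝ) + 2) * lam + (3 * n + 5) * mu := by
  have h : (0 : ℝ) ≤ n := n.cast_nonneg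
  nlinarith [mul_pos (show (0 : ℝ) < n + 2 by linarith) hconv, mul_nonneg h hmu.le]

lemma zetaTwo_denom_pos (hmu : 0 < mu) (hconv : 0 < 3 * lam + 2 * mu) (hn : 2 ≤ n) :
    0 < (2 * (n : ℝ) ^ 2 + 1) * lam + (2 + 2 * n * ((n : ℝ) - 1)) * mu := by
  have h : (2 : ℝ) ≤ n := by exact_mod_cast hn
  -- After the splitting the remaining coefficient of `μ` is `2(n-1)(n-2)`.
  have h1 : 0 ≤ ((n : ℝ) - 1) * (n - 2) * mu :=
    mul_nonneg (mul_nonneg (by linarith) (by linarith)) hmu.le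
  nlinarith [mul_pos (show (0 : ℝ) < 2 * (n : ℝ) ^ 2 + 1 by positivity) hconv]

lemma zetaThree_num_pos (hmu : 0 < mu) (hconv : 0 < 3 * lam + 2 * mu) (n : ℕ) :
    0 < (2 * (n : ℝ) ^ 2 + 4 * n + 3) * lam + (2 * n ^ 2 + 6 * n + 6) * mu := by
  have h : (0 : ℝ) ≤ n := n.cast_nonneg
  have h1 : 0 ≤ (2 * (n : ℝ) ^ 2 + 10 * n + 12) * mu := by positivity
  nlinarith [mul_pos (show (0 : ℝ) < 2 * (n : ℝ) ^ 2 + 4 * n + 3 by positivity) hconv]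

lemma coefM_mul (hmu : 0 < mu) (hconv : 0 < 3 * lam + 2 * mu) (hn : 2 ≤ n) :
    coefM lam mu n * (2 * (((n : ℝ) - 1) * lam + (3 * n - 2) * mu)) = lam + mu :=
  div_mul_cancel₀ _ (mul_ne_zero two_ne_zero (coefM_denom_pos hmu hconv hn).ne')

lemma coefK_mul (hmu : 0 < mu) (hconv : 0 < 3 * lam + 2 * mu) (n : ℕ) :
    coefK lam mu n * (2 * (((n : ℝ) + 2) * lam + (3 * n + 5) * mu)) = lam + mu :=
  div_mul_cancel₀ _ (mul_ne_zero two_ne_zero (coefK_denom_pos hmu hconv n).ne')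

lemma zetaOne_neg (hn : 2 ≤ n) : zetaOne n < 0 := by
  have h : (2 : ℝ) ≤ n := by exact_mod_cast hn
  have : 0 < 3 / ((n : ℝ) - 1) := div_pos (by norm_num) (by linarith)
  unfold zetaOne
  linarith

lemma zetaTwo_neg (hmu : 0 < mu) (hconv : 0 < 3 * lam + 2 * mu) (hn : 2 ≤ n) :
    zetaTwo lam mu n < 0 := by
  have h1 := coefM_denom_pos hmu hconv hn
  refine div_neg_of_neg_of_pos ?_ (zetaTwo_denom_pos hmu hconv hn)
  have : 0 < (2 * (n : ℝ) + 2) * (((n : ℝ) - 1) * lam + (3 * n - 2) * mu) :=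
    mul_pos (by positivity) h1
  linarith

lemma zetaThree_neg (hmu : 0 < mu) (hconv : 0 < 3 * lam + 2 * mu) (hn : 2 ≤ n) :
    zetaThree lam mu n < 0 := by
  have h : (2 : ℝ) ≤ n := by exact_mod_cast hn
  refine div_neg_of_neg_of_pos ?_ (mul_pos (by linarith) (coefK_denom_pos hmu hconv n))
  have := zetaThree_num_pos hmu hconv n
  linarith

/-- Here and in `zetaTwo_mul` and `zetaThree_mul`, the constant times an inner traction eigenvalue
is the corresponding outer one. -/
lemma zetaOne_mul (hn : 2 ≤ n) : zetaOne n * ((n : ℝ) - 1) = -(n + 2) := by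
  have h : (2 : ℝ) ≤ n := by exact_mod_cast hn
  have : (n : ℝ) - 1 ≠ 0 := by linarith
  unfold zetaOne
  field_simp
  ring

/-- The eigenvalue of the interior traction on the range of `gradUp` is positive. -/
lemma energyUp_pos (hmu : 0 < mu) (hconv : 0 < 3 * lam + 2 * mu) (hn : 2 ≤ n) :
    0 < 2 * coefM lam mu n * n * (2 * n + 1) - 1 := by
  have h1 := coefM_denom_pos hmu hconv hn
  have h2 := coefM_mul hmu hconv hn
  have h3 := zetaTwo_denom_pos hmu hconv hn
  -- Multiplied by the denominator of `M_n`, up to the factor two, the eigenvalue becomes the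
  -- denominator of `ζ₂`.
  refine pos_of_mul_pos_left ?_ h1.le
  linear_combination h3 - n * (2 * n + 1) * h2

lemma zetaTwo_mul (hmu : 0 < mu) (hconv : 0 < 3 * lam + 2 * mu) (hn : 2 ≤ n) :
    zetaTwo lam mu n * (2 * coefM lam mu n * n * (2 * n + 1) - 1) = -(2 * (n + 1)) := by
  have h1 := (coefM_denom_pos hmu hconv hn).ne'
  have h2 := coefM_mul hmu hconv hn
  have h3 : zetaTwo lam mu n * ((2 * (n : ℝ) ^ 2 + 1) * lam + (2 + 2 * n * ((n : ℝ) - 1)) * mu) =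
      -((2 * n + 2) * (((n : ℝ) - 1) * lam + (3 * n - 2) * mu)) :=
    div_mul_cancel₀ _ (zetaTwo_denom_pos hmu hconv hn).ne'
  refine mul_right_cancel₀ h1 ?_
  linear_combination h3 + zetaTwo lam mu n * (n * (2 * n + 1)) * h2

lemma zetaThree_mul (hmu : 0 < mu) (hconv : 0 < 3 * lam + 2 * mu) (hn : 2 ≤ n) :
    zetaThree lam mu n * (2 * n) = -(1 + 2 * coefK lam mu n * (n + 1) * (2 * n + 1)) := by
  have h : (2 : ℝ) ≤ n := by exact_mod_cast hn
  have h1 := (coefK_denom_pos hmu hconv n).ne'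
  have h2 := coefK_mul hmu hconv n
  have h3 : zetaThree lam mu n * (2 * n * (((n : ℝ) + 2) * lam + (3 * n + 5) * mu)) =
      -((2 * n ^ 2 + 4 * n + 3) * lam + (2 * n ^ 2 + 6 * n + 6) * mu) :=
    div_mul_cancel₀ _ (mul_ne_zero (by linarith) h1)
  refine mul_right_cancel₀ h1 ?_
  linear_combination h3 + (n + 1) * (2 * n + 1) * h2

end Constants

/-! ### Characterization of the solutions -/

section Solutions

variable {k : ℕ} {lam mu R : ℝ}

lemma lame_coefM (hmu : 0 < mu) (hconv : 0 < 3 * lam + 2 * mu) {n : ℕ} (hn : 2 ≤ n) :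
    (mu : ℂ) * (-(coefM lam mu n : ℂ) * (4 * ((n : ℤ) : ℂ) - 2))
      + (lam + mu) * (1 + 2 * -(coefM lam mu n : ℂ) * (((n : ℤ) : ℂ) - 1)) = 0 := by
  have h := congrArg (fun t : ℝ => (t : ℂ)) (coefM_mul hmu hconv hn)
  push_cast at h ⊢
  linear_combination -h

lemma lame_coefK (hmu : 0 < mu) (hconv : 0 < 3 * lam + 2 * mu) (n : ℕ) :
    (mu : ℂ) * ((coefK lam mu n : ℂ) * (4 * ((-n - 1 : ℤ) : ℂ) - 2))
      + (lam + mu) * (1 + 2 * (coefK lam mu n : ℂ) * (((-n - 1 : ℤ) : ℂ) - 1)) = 0 := by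
  have h := congrArg (fun t : ℝ => (t : ℂ)) (coefK_mul hmu hconv n)
  push_cast at h ⊢
  linear_combination -h

lemma harmHom_regField' (G : Coeff (k + 1)) (i : Fin 3) :
    HarmHom {0}ᶜ ((k + 1 : ℕ) : ℤ) (fun x => regField G x i) :=
  (harmHom_regField G i).mono (Set.subset_univ _)

/-- The interior traction on the sphere. -/
lemma traction_inner (hmu : 0 < mu) (hconv : 0 < 3 * lam + 2 * mu) (G : Coeff (k + 2))
    {x : E3} (hx0 : x ≠ 0) (hx : ‖x‖ = R) :
    traction lam mu (corrField R (-(coefM lam mu (k + 2) : ℂ)) (regField G)) (R⁻¹ • x) x =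
      ((R : ℂ)⁻¹ * mu) • regField
        (((((k + 2 : ℕ) : ℝ) - 1 : ℝ) : ℂ) • partTor (k + 1) G
          + ((2 * coefM lam mu (k + 2) * (k + 2 : ℕ) * (2 * (k + 2 : ℕ) + 1) - 1 : ℝ) : ℂ)
            • partUp (k + 1) G
          + ((2 * (k + 2 : ℕ) : ℝ) : ℂ) • partDown (k + 2) G) x := by
  have hΩ : IsOpen ({0}ᶜ : Set E3) := isOpen_compl_singleton
  set M : ℂ := -(coefM lam mu (k + 2) : ℂ)
  have hG : regField G = fun y => (regField (partTor (k + 1) G + partUp (k + 1) G) y)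
      + regField (partDown (k + 2) G) y := by
    ext y : 1
    rw [← regField_add, partTor_add]
  have hG' : regField (partTor (k + 1) G + partUp (k + 1) G) =
      fun y => regField (partTor (k + 1) G) y + regField (partUp (k + 1) G) y :=
    funext fun y => regField_add _ _ y
  have e1 := traction_toroidal lam mu M hΩ (harmHom_regField' (partTor (k + 1) G))
    (fun y _ => by rw [divergence_regField, lowerT_partTor, zero_dotProduct])
    (fun y _ => sum_mul_regField_eq_zero (raiseT_partTor _ _) (lowerT_partTor _ _) y) hx0 hx
  -- Inside, the `partUp` component has the Kelvin form and the `partDown` component is a true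
  -- gradient. The potentials carry the scalars that normalize the projections.
  have e2 := traction_kelvinGradient hΩ (harmHom_regField' (partUp (k + 1) G))
    (p := fun y => ((-((((k + 1 : ℕ) : ℂ) + 1) * (2 * (k + 1 : ℕ) + 3)))⁻¹
      • lowerT (k + 1) G) ⬝ᵥ regY (k + 1) y)
    (by
      have := (harmHom_regY (k + 1) ((-((((k + 1 : ℕ) : ℂ) + 1) * (2 * (k + 1 : ℕ) + 3)))⁻¹
        • lowerT (k + 1) G)).mono (Set.subset_univ ({0}ᶜ : Set E3))
      rwa [show ((k + 1 : ℕ) : ℤ) = ((k + 1 + 1 : ℕ) : ℤ) - 1 by push_cast; ring] at this)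
    (fun y hy i => by
      rw [← regField_gradUp (k + 1) _ hy i, map_smul]
      rfl) (lame_coefM hmu hconv (n := k + 2) (by omega)) hx0 hx
  have e3 := traction_gradient lam mu M hΩ (harmHom_regField' (partDown (k + 2) G))
    (p := fun y => ((-((((k + 2 : ℕ) : ℂ) + 1) * (2 * (k + 2 : ℕ) + 1)))⁻¹
      • raiseT (k + 2) G) ⬝ᵥ regY (k + 2 + 1) y)
    ((harmHom_regY (k + 2 + 1) _).mono (Set.subset_univ ({0}ᶜ : Set E3)))
    (fun y hy i => by
      rw [← regField_gradDown (k + 2) _ y i, map_smul]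
      rfl) hx0 hx
  rw [hG, traction_corrField_add lam mu R M hΩ (harmHom_regField' _) (harmHom_regField' _) _ hx0,
    hG', traction_corrField_add lam mu R M hΩ (harmHom_regField' _) (harmHom_regField' _) _ hx0,
    e1, e2, e3, regField_add, regField_add, regField_smul, regField_smul, regField_smul]
  ext i
  simp only [Pi.add_apply, Pi.smul_apply, smul_eq_mul]
  push_cast
  ring

/-- The exterior traction on the sphere. -/
lemma traction_outer (hmu : 0 < mu) (hconv : 0 < 3 * lam + 2 * mu) (hR : 0 < R)
    (G : Coeff (k + 2)) {x : E3} (hx : ‖x‖ = R) :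
    traction lam mu (corrField R (coefK lam mu (k + 2) : ℂ) (decField R G)) (R⁻¹ • x) x =
      ((R : ℂ)⁻¹ * mu) • regField
        (((-((k + 2 : ℕ) + 2) : ℝ) : ℂ) • partTor (k + 1) G
          + ((-(2 * ((k + 2 : ℕ) + 1)) : ℝ) : ℂ) • partUp (k + 1) G
          + ((-(1 + 2 * coefK lam mu (k + 2) * ((k + 2 : ℕ) + 1) * (2 * (k + 2 : ℕ) + 1)) : ℝ) : ℂ)
            • partDown (k + 2) G) x := by
  have hx0 : x ≠ 0 := norm_pos_iff.1 (hx ▸ hR)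
  have hΩ : IsOpen ({0}ᶜ : Set E3) := isOpen_compl_singleton
  set M : ℂ := (coefK lam mu (k + 2) : ℂ)
  set s : ℂ := (R : ℂ) ^ (2 * (k + 2) + 1)
  have hG : decField R G = fun y => (decField R (partTor (k + 1) G + partUp (k + 1) G) y)
      + decField R (partDown (k + 2) G) y := by
    ext y : 1
    rw [← decField_add, partTor_add]
  have hG' : decField R (partTor (k + 1) G + partUp (k + 1) G) =
      fun y => decField R (partTor (k + 1) G) y + decField R (partUp (k + 1) G) y :=
    funext fun y => decField_add R _ _ y
  have e1 := traction_toroidal lam mu M hΩ (harmHom_decField R (partTor (k + 1) G))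
    (fun y hy => by
      rw [decField, divergence_irrField _ hy, map_smul, raiseT_partTor, smul_zero, zero_dotProduct])
    (fun y hy => by
      simp only [decField, irrField_eq _ hy]
      rw [Finset.sum_congr rfl fun j _ => mul_left_comm _ _ _, ← Finset.mul_sum,
        sum_mul_regField_eq_zero (by rw [map_smul, raiseT_partTor, smul_zero])
        (by rw [map_smul, lowerT_partTor, smul_zero]) y, mul_zero]) hx0 hx
  -- Outside the roles are exchanged: `partUp` is now the gradient and `partDown` has the Kelvin
  -- form.
  have e2 := traction_gradient lam mu M hΩ (harmHom_decField R (partUp (k + 1) G))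
    (p := fun y => (s • (-((((k + 1 : ℕ) : ℂ) + 1) * (2 * (k + 1 : ℕ) + 3)))⁻¹
      • lowerT (k + 1) G) ⬝ᵥ irrY (k + 1) y)
    (by
      have := harmHom_irrY (k + 1) (s • (-((((k + 1 : ℕ) : ℂ) + 1) * (2 * (k + 1 : ℕ) + 3)))⁻¹
        • lowerT (k + 1) G)
      rwa [show -((k + 1 : ℕ) : ℤ) - 1 = -((k + 2 : ℕ) : ℤ) - 1 + 1 by push_cast; ring] at this)
    (fun y hy i => by
      rw [← irrField_gradUp (k + 1) _ hy i, map_smul, map_smul]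
      rfl) hx0 hx
  have e3 := traction_kelvinGradient hΩ (harmHom_decField R (partDown (k + 2) G))
    (p := fun y => (s • (-((((k + 2 : ℕ) : ℂ) + 1) * (2 * (k + 2 : ℕ) + 1)))⁻¹
      • raiseT (k + 2) G) ⬝ᵥ irrY (k + 2 + 1) y)
    (by
      have := harmHom_irrY (k + 2 + 1) (s • (-((((k + 2 : ℕ) : ℂ) + 1) * (2 * (k + 2 : ℕ) + 1)))⁻¹
        • raiseT (k + 2) G)
      rwa [show -((k + 2 + 1 : ℕ) : ℤ) - 1 = -((k + 2 : ℕ) : ℤ) - 1 - 1 by push_cast; ring] at this)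
    (fun y hy i => by
      rw [← irrField_gradDown (k + 2) _ hy i, map_smul, map_smul]
      rfl) (lame_coefK hmu hconv (k + 2)) hx0 hx
  rw [hG, traction_corrField_add lam mu R M hΩ (harmHom_decField R _) (harmHom_decField R _) _ hx0,
    hG', traction_corrField_add lam mu R M hΩ (harmHom_decField R _) (harmHom_decField R _) _ hx0,
    e1, e2, e3, regField_add, regField_add, regField_smul, regField_smul, regField_smul,
    decField_eq_regField hR _ hx, decField_eq_regField hR _ hx, decField_eq_regField hR _ hx]
  ext i
  simp only [Pi.add_apply, Pi.smul_apply, smul_eq_mul]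
  push_cast
  ring

/-- The sum of the three components is direct: `lowerT` sees only the second and `raiseT` only the
third. -/
lemma eq_zero_of_parts_smul {a b c : ℂ} {G : Coeff (k + 1)}
    (h : a • partTor k G + b • partUp k G + c • partDown (k + 1) G = 0) :
    a • partTor k G = 0 ∧ b • partUp k G = 0 ∧ c • partDown (k + 1) G = 0 := by
  have h3 : b • lowerT k G = 0 := by
    have := congrArg (lowerT k) h
    simpa [lowerT_partTor, lowerT_partUp, lowerT_partDown] using this
  have h1 : c • raiseT (k + 1) G = 0 := by
    have := congrArg (raiseT (k + 1)) h
    simpa [raiseT_partTor, raiseT_partUp, raiseT_partDown] using this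
  have hU : b • partUp k G = 0 := by
    rw [← map_smul, partUp_eq_zero_iff, map_smul, h3]
  have hD : c • partDown (k + 1) G = 0 := by
    rw [← map_smul, partDown_eq_zero_iff, map_smul, h1]
  rw [hU, hD, add_zero, add_zero] at h
  exact ⟨h, hU, hD⟩

/-- The matching of tractions is a linear equation for the trace on the sphere, and the trace
determines its matrix. Both traction maps are diagonal, so the equation splits into one scalar
condition per component, `(c - ζ)` times a nonzero inner eigenvalue. -/
theorem isTransmissionSolution_waveGen_iff (hmu : 0 < mu) (hconv : 0 < 3 * lam + 2 * mu)
    (hR : 0 < R) (c : ℝ) (G : Coeff (k + 2)) :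
    IsTransmissionSolution lam mu c R (waveGen lam mu R G) ↔
      (c = zetaOne (k + 2) ∨ partTor (k + 1) G = 0) ∧
      (c = zetaTwo lam mu (k + 2) ∨ partUp (k + 1) G = 0) ∧
      (c = zetaThree lam mu (k + 2) ∨ partDown (k + 2) G = 0) := by
  have hn : 2 ≤ k + 2 := by omega
  have hR' : (R : ℂ) ≠ 0 := by exact_mod_cast hR.ne'
  have hmu' : (mu : ℂ) ≠ 0 := by exact_mod_cast hmu.ne'
  have hinner : ∀ i x, ContDiffAt ℝ ∞ (fun y =>
      corrField R (-(coefM lam mu (k + 2) : ℂ)) (regField G) y i) x := fun i x =>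
    contDiffAt_corrField R _ isOpen_univ (harmHom_regField G) i (Set.mem_univ x)
  have houter : ∀ i x, x ≠ 0 → ContDiffAt ℝ ∞ (fun y =>
      corrField R (coefK lam mu (k + 2) : ℂ) (decField R G) y i) x := fun i x hx =>
    contDiffAt_corrField R _ isOpen_compl_singleton (harmHom_decField R G) i hx
  rw [waveGen_eq_glue hR, isTransmissionSolution_glue_iff c hR hinner houter
    (fun x hx => by
      rw [corrField_of_norm_eq _ _ _ hx, corrField_of_norm_eq _ _ _ hx,
        decField_eq_regField hR G hx])
    (fun x => lameOp_corrField R isOpen_univ (harmHom_regField G) (lame_coefM hmu hconv hn)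
      (Set.mem_univ x))
    (fun x hx => lameOp_corrField R isOpen_compl_singleton (harmHom_decField R G)
      (lame_coefK hmu hconv (k + 2)) hx)
    (isBigO_corrField_decField R _ G)]
  have hn1 : ((((k + 2 : ℕ) : ℝ) - 1 : ℝ) : ℂ) ≠ 0 := by
    have h : (0 : ℝ) < ((k + 2 : ℕ) : ℝ) - 1 := by
      push_cast
      linarith [(k.cast_nonneg : (0 : ℝ) ≤ k)]
    exact_mod_cast h.ne'
  have hn2 : ((2 * coefM lam mu (k + 2) * (k + 2 : ℕ) * (2 * (k + 2 : ℕ) + 1) - 1 : ℝ) : ℂ) ≠ 0 :=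
    Complex.ofReal_ne_zero.2 (energyUp_pos hmu hconv hn).ne'
  have hn3 : ((2 * (k + 2 : ℕ) : ℝ) : ℂ) ≠ 0 := by
    have h : (0 : ℝ) < 2 * (k + 2 : ℕ) := by positivity
    exact Complex.ofReal_ne_zero.2 h.ne'
  have h1 := zetaOne_mul hn
  have h2 := zetaTwo_mul hmu hconv hn
  have h3 := zetaThree_mul hmu hconv hn
  -- Each outer eigenvalue is rewritten as `ζ` times the inner one, so that `c · inner - outer`
  -- becomes `(c - ζ) · inner` on each component.
  have hstep : (∀ x, ‖x‖ = R → (c : ℂ) • traction lam mu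
      (corrField R (-(coefM lam mu (k + 2) : ℂ)) (regField G)) (R⁻¹ • x) x =
      traction lam mu (corrField R (coefK lam mu (k + 2) : ℂ) (decField R G)) (R⁻¹ • x) x) ↔
      ((c - zetaOne (k + 2) : ℝ) * ((((k + 2 : ℕ) : ℝ) - 1 : ℝ) : ℂ)) • partTor (k + 1) G
      + ((c - zetaTwo lam mu (k + 2) : ℝ) * ((2 * coefM lam mu (k + 2) * (k + 2 : ℕ) *
          (2 * (k + 2 : ℕ) + 1) - 1 : ℝ) : ℂ)) • partUp (k + 1) G
      + ((c - zetaThree lam mu (k + 2) : ℝ) * ((2 * (k + 2 : ℕ) : ℝ) : ℂ))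
        • partDown (k + 2) G = 0 := by
    rw [← Complex.ofReal_mul, ← Complex.ofReal_mul, ← Complex.ofReal_mul, sub_mul, sub_mul, sub_mul,
      h1, h2, h3]
    set α : ℝ := ((k + 2 : ℕ) : ℝ) - 1
    set β : ℝ := 2 * coefM lam mu (k + 2) * (k + 2 : ℕ) * (2 * (k + 2 : ℕ) + 1) - 1 with hβ
    set γ : ℝ := 2 * (k + 2 : ℕ)
    have hcomb : ∀ a b d : ℝ, ((c * α - a : ℝ) : ℂ) • partTor (k + 1) G
        + ((c * β - b : ℝ) : ℂ) • partUp (k + 1) G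
        + ((c * γ - d : ℝ) : ℂ) • partDown (k + 2) G = 0 ↔
        (c : ℂ) • ((α : ℂ) • partTor (k + 1) G + (β : ℂ) • partUp (k + 1) G
          + (γ : ℂ) • partDown (k + 2) G) =
        (a : ℂ) • partTor (k + 1) G + (b : ℂ) • partUp (k + 1) G
          + (d : ℂ) • partDown (k + 2) G := by
      intro a b d
      rw [← sub_eq_zero (a := (c : ℂ) • _)]
      push_cast
      refine Eq.congr_left ?_
      module
    rw [hcomb]
    constructor
    · intro h
      refine eq_of_regField_eq_on_sphere hR fun x hx => ?_
      have hx0 : x ≠ 0 := norm_pos_iff.1 (hx ▸ hR)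
      have h' := h x hx
      rw [traction_inner hmu hconv G hx0 hx, traction_outer hmu hconv hR G hx, smul_comm,
        ← regField_smul] at h'
      exact smul_right_injective _ (mul_ne_zero (inv_ne_zero hR') hmu') h'
    · intro h x hx
      have hx0 : x ≠ 0 := norm_pos_iff.1 (hx ▸ hR)
      rw [traction_inner hmu hconv G hx0 hx, traction_outer hmu hconv hR G hx, smul_comm,
        ← regField_smul, h]
  have hsm : ∀ (z : ℝ) (a : ℂ) (H : Coeff (k + 2)), a ≠ 0 →
      ((((c - z : ℝ) : ℂ) * a) • H = 0 ↔ c = z ∨ H = 0) := by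
    intro z a H ha
    rw [smul_eq_zero, mul_eq_zero, or_iff_left ha, Complex.ofReal_eq_zero, sub_eq_zero]
  rw [hstep, ← hsm _ _ _ hn1, ← hsm _ _ _ hn2, ← hsm _ _ _ hn3]
  constructor
  · exact fun h => eq_zero_of_parts_smul h
  · rintro ⟨ha, hb, hc⟩
    rw [ha, hb, hc, add_zero, add_zero]

end Solutions

/-! ### Multiplicities -/

section Multiplicity

variable {k : ℕ}

/-- The coefficient matrices with `t¹ = 0` and `t³ = 0`. -/
def torSpace (k : ℕ) : Submodule ℂ (Coeff (k + 1)) :=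
  LinearMap.ker (lowerT k) ⊓ LinearMap.ker (raiseT (k + 1))

/-- The coefficient matrices of gradients of decaying harmonic functions. -/
def upSpace (k : ℕ) : Submodule ℂ (Coeff (k + 1)) := LinearMap.range (gradUp k)

/-- The coefficient matrices of gradients of regular harmonic functions. -/
def downSpace (k : ℕ) : Submodule ℂ (Coeff (k + 1)) := LinearMap.range (gradDown (k + 1))

lemma partUp_of_mem {G : Coeff (k + 1)} (hG : G ∈ upSpace k) : partUp k G = G := by
  obtain ⟨a, rfl⟩ := hG
  rw [partUp, LinearMap.smul_apply, LinearMap.comp_apply, lowerT_gradUp, map_smul, smul_smul,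
    inv_mul_cancel₀ (gradUp_const_ne_zero k), one_smul]

lemma partDown_of_mem {G : Coeff (k + 1)} (hG : G ∈ downSpace k) : partDown (k + 1) G = G := by
  obtain ⟨a, rfl⟩ := hG
  rw [partDown, LinearMap.smul_apply, LinearMap.comp_apply, raiseT_gradDown, map_smul, smul_smul,
    inv_mul_cancel₀ (gradDown_const_ne_zero (k + 1)), one_smul]

lemma raiseT_of_mem_upSpace {G : Coeff (k + 1)} (hG : G ∈ upSpace k) : raiseT (k + 1) G = 0 := by
  obtain ⟨a, rfl⟩ := hG
  exact raiseT_gradUp k a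

lemma lowerT_of_mem_downSpace {G : Coeff (k + 1)} (hG : G ∈ downSpace k) : lowerT k G = 0 := by
  obtain ⟨a, rfl⟩ := hG
  exact lowerT_gradDown k a

lemma partUp_mem (G : Coeff (k + 1)) : partUp k G ∈ upSpace k :=
  Submodule.smul_mem _ _ ⟨_, rfl⟩

lemma partDown_mem (G : Coeff (k + 1)) : partDown (k + 1) G ∈ downSpace k :=
  Submodule.smul_mem _ _ ⟨_, rfl⟩

lemma partTor_mem (G : Coeff (k + 1)) : partTor k G ∈ torSpace k :=
  ⟨lowerT_partTor k G, raiseT_partTor k G⟩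

lemma parts_of_sum {g u d : Coeff (k + 1)} (hg : g ∈ torSpace k) (hu : u ∈ upSpace k)
    (hd : d ∈ downSpace k) : partTor k (g + u + d) = g ∧ partUp k (g + u + d) = u ∧
      partDown (k + 1) (g + u + d) = d := by
  have h1 : partUp k (g + u + d) = u := by
    rw [map_add, map_add, partUp_of_mem hu, partUp_eq_zero_iff.2 hg.1,
      partUp_eq_zero_iff.2 (lowerT_of_mem_downSpace hd), zero_add, add_zero]
  have h2 : partDown (k + 1) (g + u + d) = d := by
    rw [map_add, map_add, partDown_of_mem hd, partDown_eq_zero_iff.2 hg.2,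
      partDown_eq_zero_iff.2 (raiseT_of_mem_upSpace hu), zero_add, zero_add]
  refine ⟨?_, h1, h2⟩
  have h := partTor_add k (g + u + d)
  rw [h1, h2] at h
  exact add_right_cancel (add_right_cancel h)

/-- The projections separate the summands: an element of two of them has a component that is both
itself and zero. -/
lemma finrank_sup_sup {A B C : Submodule ℂ (Coeff (k + 1))} (hA : A ≤ torSpace k)
    (hB : B ≤ upSpace k) (hC : C ≤ downSpace k) :
    Module.finrank ℂ (A ⊔ B ⊔ C : Submodule ℂ (Coeff (k + 1))) =
      Module.finrank ℂ A + Module.finrank ℂ B + Module.finrank ℂ C := by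
  have h1 : A ⊓ B = ⊥ := by
    refine (Submodule.eq_bot_iff _).2 fun x hx => ?_
    have h := parts_of_sum (hA hx.1) (Submodule.zero_mem (upSpace k))
      (Submodule.zero_mem (downSpace k))
    rw [add_zero, add_zero] at h
    rw [← partUp_of_mem (hB hx.2), h.2.1]
  have h2 : (A ⊔ B) ⊓ C = ⊥ := by
    refine (Submodule.eq_bot_iff _).2 fun x hx => ?_
    obtain ⟨a, ha, b, hb, rfl⟩ := Submodule.mem_sup.1 hx.1
    have h := parts_of_sum (hA ha) (hB hb) (Submodule.zero_mem (downSpace k))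
    rw [add_zero] at h
    rw [← partDown_of_mem (hC hx.2), h.2.2]
  have e1 := Submodule.finrank_sup_add_finrank_inf_eq A B
  have e2 := Submodule.finrank_sup_add_finrank_inf_eq (A ⊔ B) C
  rw [h1, finrank_bot] at e1
  rw [h2, finrank_bot] at e2
  omega

lemma finrank_upSpace (k : ℕ) : Module.finrank ℂ (upSpace k) = 2 * k + 1 := by
  have hinj : Function.Injective (gradUp k) := by
    refine (injective_iff_map_eq_zero _).2 fun a ha => ?_
    have h := lowerT_gradUp k a
    rw [ha, map_zero] at h
    exact (smul_eq_zero.1 h.symm).resolve_left (gradUp_const_ne_zero k)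
  rw [upSpace, LinearMap.finrank_range_of_inj hinj]
  simp

lemma finrank_downSpace (k : ℕ) : Module.finrank ℂ (downSpace k) = 2 * (k + 1 + 1) + 1 := by
  have hinj : Function.Injective (gradDown (k + 1)) := by
    refine (injective_iff_map_eq_zero _).2 fun a ha => ?_
    have h := raiseT_gradDown (k + 1) a
    rw [ha, map_zero] at h
    exact (smul_eq_zero.1 h.symm).resolve_left (gradDown_const_ne_zero (k + 1))
  rw [downSpace, LinearMap.finrank_range_of_inj hinj]
  simp

/-- This space is complementary to the two ranges, whose dimensions come from injectivity: `3(2k+3)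
- (2k+1) - (2k+5) = 2k+3`. -/
lemma finrank_torSpace (k : ℕ) : Module.finrank ℂ (torSpace k) = 2 * (k + 1) + 1 := by
  have htop : torSpace k ⊔ upSpace k ⊔ downSpace k = ⊤ := by
    refine eq_top_iff.2 fun G _ => ?_
    rw [← partTor_add k G]
    exact Submodule.add_mem_sup (Submodule.add_mem_sup (partTor_mem G) (partUp_mem G))
      (partDown_mem G)
  have h := finrank_sup_sup (le_refl (torSpace k)) (le_refl (upSpace k)) (le_refl (downSpace k))
  rw [htop, finrank_top, finrank_upSpace, finrank_downSpace, Module.finrank_matrix] at h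
  simp at h
  omega

lemma exists_linearIndependent_of_finrank {V : Type*} [AddCommGroup V] [Module ℂ V]
    [FiniteDimensional ℂ V] {S : Submodule ℂ V} {N : ℕ} (h : Module.finrank ℂ S = N) :
    ∃ G : Fin N → V, LinearIndependent ℂ G ∧ ∀ i, G i ∈ S := by
  let b := Module.finBasisOfFinrankEq ℂ S h
  exact ⟨fun i => b i, b.linearIndependent.map' S.subtype (Submodule.ker_subtype S),
    fun i => (b i).2⟩

/-- A relation between the waves restricts to the sphere, where every wave is `G r^n Y_n`, and there
it determines the matrix. -/
lemma linearIndependent_wave {n N : ℕ} {R : ℝ} (hR : 0 < R) {G : Fin N → Coeff n}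
    (hG : LinearIndependent ℂ G) {W : Coeff n → E3 → Fin 3 → ℂ}
    (hW : ∀ H x, ‖x‖ = R → W H x = regField H x) : LinearIndependent ℂ fun i => W (G i) := by
  rw [Fintype.linearIndependent_iff] at hG ⊢
  intro a ha
  refine hG a (eq_of_regField_eq_on_sphere hR fun x hx => ?_)
  have h := congrFun ha x
  rw [Finset.sum_apply] at h
  have hz : regField (0 : Coeff n) x = 0 := Matrix.zero_mulVec _
  have hs : regField (∑ i, a i • G i) x = ∑ i, regField (a i • G i) x :=
    Matrix.sum_mulVec _ _ _
  rw [hz, hs, ← Pi.zero_apply (M := fun _ : E3 => Fin 3 → ℂ) x, ← h]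
  exact Finset.sum_congr rfl fun i _ => by rw [regField_smul, Pi.smul_apply, hW _ x hx]

/-- The set of solutions is already a subspace, the direct sum of those of the three spaces whose
constant equals `c`. The dimensions therefore add up even if some of the constants coincide. -/
lemma finrank_span_solutions {lam mu R : ℝ} (hmu : 0 < mu) (hconv : 0 < 3 * lam + 2 * mu)
    (hR : 0 < R) (c : ℝ) :
    Module.finrank ℂ (Submodule.span ℂ
        {G : Coeff (k + 2) | IsTransmissionSolution lam mu c R (waveGen lam mu R G)}) =
      (if c = zetaOne (k + 2) then 2 * (k + 1 + 1) + 1 else 0) +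
      (if c = zetaTwo lam mu (k + 2) then 2 * (k + 1) + 1 else 0) +
      (if c = zetaThree lam mu (k + 2) then 2 * (k + 1 + 1 + 1) + 1 else 0) := by
  set A : Submodule ℂ (Coeff (k + 2)) := if c = zetaOne (k + 2) then torSpace (k + 1) else ⊥
    with hA
  set B : Submodule ℂ (Coeff (k + 2)) := if c = zetaTwo lam mu (k + 2) then upSpace (k + 1) else ⊥
    with hB
  set C : Submodule ℂ (Coeff (k + 2)) :=
    if c = zetaThree lam mu (k + 2) then downSpace (k + 1) else ⊥ with hC
  have mem_ite : ∀ (p : Prop) [Decidable p] (S : Submodule ℂ (Coeff (k + 2))) (G : Coeff (k + 2)),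
      G ∈ (if p then S else ⊥) ↔ G ∈ S ∧ (p ∨ G = 0) := by
    intro p _ S G
    split_ifs with h
    · simp [h]
    · simp only [Submodule.mem_bot, h, false_or]
      exact ⟨fun h0 => ⟨h0 ▸ S.zero_mem, h0⟩, fun h0 => h0.2⟩
  have hset : {G : Coeff (k + 2) | IsTransmissionSolution lam mu c R (waveGen lam mu R G)} =
      ((A ⊔ B ⊔ C : Submodule ℂ (Coeff (k + 2))) : Set (Coeff (k + 2))) := by
    ext G
    rw [Set.mem_ofPred_eq, isTransmissionSolution_waveGen_iff hmu hconv hR, SetLike.mem_coe]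
    constructor
    · rintro ⟨h1, h2, h3⟩
      rw [← partTor_add (k + 1) G]
      exact Submodule.add_mem_sup (Submodule.add_mem_sup
        ((mem_ite _ _ _).2 ⟨partTor_mem G, h1⟩) ((mem_ite _ _ _).2 ⟨partUp_mem G, h2⟩))
        ((mem_ite _ _ _).2 ⟨partDown_mem G, h3⟩)
    · intro h
      obtain ⟨ab, hab, d, hd, rfl⟩ := Submodule.mem_sup.1 h
      obtain ⟨a, ha, b, hb, rfl⟩ := Submodule.mem_sup.1 hab
      rw [hA, mem_ite] at ha
      rw [hB, mem_ite] at hb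
      rw [hC, mem_ite] at hd
      obtain ⟨e1, e2, e3⟩ := parts_of_sum ha.1 hb.1 hd.1
      rw [e1, e2, e3]
      exact ⟨ha.2, hb.2, hd.2⟩
  have finrank_ite : ∀ (p : Prop) [Decidable p] {S : Submodule ℂ (Coeff (k + 2))} {N : ℕ},
      Module.finrank ℂ S = N →
        Module.finrank ℂ (if p then S else ⊥ : Submodule ℂ (Coeff (k + 2))) =
          if p then N else 0 := by
    intro p _ S N h
    by_cases hp : p
    · rw [if_pos hp, if_pos hp, h]
    · rw [if_neg hp, if_neg hp, finrank_bot]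
  rw [hset, Submodule.span_eq, finrank_sup_sup, hA, hB, hC,
    finrank_ite _ (finrank_torSpace (k + 1)), finrank_ite _ (finrank_upSpace (k + 1)),
    finrank_ite _ (finrank_downSpace (k + 1))]
  · intro G hG
    exact ((mem_ite _ _ _).1 hG).1
  · intro G hG
    exact ((mem_ite _ _ _).1 hG).1
  · intro G hG
    exact ((mem_ite _ _ _).1 hG).1

end Multiplicity

end ElasticPlasmon

end

open ElasticPlasmon
theorem theorem3p1 (lam mu R : ℝ) (hmu : 0 < mu) (hconv : 0 < 3 * lam + 2 * mu) (hR : 0 < R)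
    (n : ℕ) (hn : 2 ≤ n) :
    -- the three constants are negative
    (zetaOne n < 0 ∧ zetaTwo lam mu n < 0 ∧ zetaThree lam mu n < 0) ∧
    -- `c = ζ₁`: `2n+1` linearly independent waves of the first form
    (∃ G : Fin (2 * n + 1) → Coeff n,
      LinearIndependent ℂ (fun k => waveOne R (G k)) ∧
      ∀ k, tOne (G k) = 0 ∧ tThree (G k) = 0 ∧
        IsTransmissionSolution lam mu (zetaOne n) R (waveOne R (G k))) ∧
    -- `c = ζ₂`: `2n-1` linearly independent waves of the second form
    (∃ G : Fin (2 * n - 1) → Coeff n,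
      LinearIndependent ℂ (fun k => waveTwo lam mu R (G k)) ∧
      ∀ k, tOne (G k) = 0 ∧ tThree (G k) ≠ 0 ∧
        IsTransmissionSolution lam mu (zetaTwo lam mu n) R (waveTwo lam mu R (G k))) ∧
    -- `c = ζ₃`: `2n+3` linearly independent waves of the third form
    (∃ G : Fin (2 * n + 3) → Coeff n,
      LinearIndependent ℂ (fun k => waveThree lam mu R (G k)) ∧
      ∀ k, tOne (G k) ≠ 0 ∧ tThree (G k) = 0 ∧
        IsTransmissionSolution lam mu (zetaThree lam mu n) R (waveThree lam mu R (G k))) ∧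
    -- these are the only constants for which solutions of the respective form exist
    (∀ c : ℝ, ∀ G : Coeff n,
      (G ≠ 0 → tOne G = 0 → tThree G = 0 →
        IsTransmissionSolution lam mu c R (waveOne R G) → c = zetaOne n) ∧
      (tOne G = 0 → tThree G ≠ 0 →
        IsTransmissionSolution lam mu c R (waveTwo lam mu R G) → c = zetaTwo lam mu n) ∧
      (tOne G ≠ 0 → tThree G = 0 →
        IsTransmissionSolution lam mu c R (waveThree lam mu R G) → c = zetaThree lam mu n)) ∧
    -- and the only ones for the general degree-`n` wave, with the stated multiplicities
    (∀ c : ℝ,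
      Module.finrank ℂ (Submodule.span ℂ
          {G : Coeff n | IsTransmissionSolution lam mu c R (waveGen lam mu R G)}) =
        (if c = zetaOne n then 2 * n + 1 else 0) +
        (if c = zetaTwo lam mu n then 2 * n - 1 else 0) +
        (if c = zetaThree lam mu n then 2 * n + 3 else 0)) := by
  -- In this form the truncated subtractions in the index types reduce, and the next identifications
  -- of `t¹` and `t³` hold by `rfl`.
  obtain ⟨k, rfl⟩ : ∃ k, n = k + 2 := ⟨n - 2, by omega⟩
  have hiff := fun (c : ℝ) (G : Coeff (k + 2)) =>
    isTransmissionSolution_waveGen_iff (lam := lam) (mu := mu) hmu hconv hR c G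
  have ht1 : ∀ G : Coeff (k + 2), tOne G = raiseT (k + 2) G := fun _ => rfl
  have ht3 : ∀ G : Coeff (k + 2), tThree G = lowerT (k + 1) G := fun _ => rfl
  refine ⟨⟨zetaOne_neg hn, zetaTwo_neg hmu hconv hn, zetaThree_neg hmu hconv hn⟩,
    ?_, ?_, ?_, fun c G => ⟨?_, ?_, ?_⟩, fun c => ?_⟩
  · obtain ⟨G, hG, hmem⟩ := exists_linearIndependent_of_finrank (finrank_torSpace (k + 1))
    refine ⟨G, linearIndependent_wave hR hG fun H x hx => by rw [waveOne, if_pos hx.le]; rfl,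
      fun i => ?_⟩
    have h1 : tOne (G i) = 0 := (hmem i).2
    have h3 : tThree (G i) = 0 := (hmem i).1
    refine ⟨h1, h3, ?_⟩
    rw [waveOne_eq_waveGen lam mu h1 h3, hiff]
    exact ⟨Or.inl rfl, Or.inr (partUp_eq_zero_iff.2 h3), Or.inr (partDown_eq_zero_iff.2 h1)⟩
  · obtain ⟨G, hG, hmem⟩ := exists_linearIndependent_of_finrank
      ((finrank_upSpace (k + 1)).trans (show 2 * (k + 1) + 1 = 2 * (k + 2) - 1 by omega))
    refine ⟨G, linearIndependent_wave hR hG fun H x hx => by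
      rw [waveTwo, if_pos hx.le, innerMain_sub_innerCorr, corrField_of_norm_eq _ _ _ hx],
      fun i => ?_⟩
    have h1 : tOne (G i) = 0 := raiseT_of_mem_upSpace (hmem i)
    have h3 : partUp (k + 1) (G i) = G i := partUp_of_mem (hmem i)
    -- The matrix equals its own `partUp` component, so `t³ = 0` would make it zero, against linear
    -- independence.
    refine ⟨h1, fun h => hG.ne_zero i ?_, ?_⟩
    · rw [← h3]
      exact partUp_eq_zero_iff.2 h
    · have ht : partTor (k + 1) (G i) = 0 := by
        rw [partTor, LinearMap.sub_apply, LinearMap.sub_apply, h3, partDown_eq_zero_iff.2 h1]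
        simp
      rw [waveTwo_eq_waveGen h1, hiff]
      exact ⟨Or.inr ht, Or.inl rfl, Or.inr (partDown_eq_zero_iff.2 h1)⟩
  · obtain ⟨G, hG, hmem⟩ := exists_linearIndependent_of_finrank
      ((finrank_downSpace (k + 1)).trans
        (show 2 * (k + 1 + 1 + 1) + 1 = 2 * (k + 2) + 3 by omega))
    refine ⟨G, linearIndependent_wave hR hG fun H x hx => by
      rw [waveThree, if_pos hx.le]; rfl, fun i => ?_⟩
    have h3 : tThree (G i) = 0 := lowerT_of_mem_downSpace (hmem i)
    have h1 : partDown (k + 2) (G i) = G i := partDown_of_mem (hmem i)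
    refine ⟨fun h => hG.ne_zero i ?_, h3, ?_⟩
    · rw [← h1]
      exact partDown_eq_zero_iff.2 h
    · have ht : partTor (k + 1) (G i) = 0 := by
        rw [partTor, LinearMap.sub_apply, LinearMap.sub_apply, h1, partUp_eq_zero_iff.2 h3]
        simp
      rw [waveThree_eq_waveGen h3, hiff]
      exact ⟨Or.inr ht, Or.inr (partUp_eq_zero_iff.2 h3), Or.inl rfl⟩
  · intro hG h1 h3 hsol
    rw [waveOne_eq_waveGen lam mu h1 h3, hiff] at hsol
    refine hsol.1.resolve_right fun h => hG ?_
    rw [← partTor_add (k + 1) G, h, partUp_eq_zero_iff.2 h3, partDown_eq_zero_iff.2 h1]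
    simp
  · intro h1 h3 hsol
    rw [waveTwo_eq_waveGen h1, hiff] at hsol
    exact hsol.2.1.resolve_right fun h => h3 (partUp_eq_zero_iff.1 h)
  · intro h1 h3 hsol
    rw [waveThree_eq_waveGen h3, hiff] at hsol
    exact hsol.2.2.resolve_right fun h => h1 (partDown_eq_zero_iff.1 h)
  · exact finrank_span_solutions hmu hconv hR c
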